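/- Let $k$ be a field and let $H$ be a Hopf algebra over $k$ whose antipode $S$ is invertible; write $\Delta(h)=h^1\otimes h^2$ for the coproduct and ${}_H\mathcal M$ for the category of left $H$-modules. For a ring map $f:A\to B$ let $f_*N=\mathrm{Hom}_A(B,N)$, a functor from left $A$-modules to left $B$-modules. The algebras $H^{\otimes(n+1)}$, with the faces given by $\Delta$ (the last face sends $h_0\otimes\cdots\otimes h_n$ to $h_0^2\otimes h_1\otimes\cdots\otimes h_n\otimes h_0^1$), the degeneracies given by the counit $\epsilon$, and the cyclic permutations, form a functor from Connes' cyclic category $\Lambda$ to algebras. Let $HC({}_H\mathcal M)$ be the inverse limit over $\Lambda$ of the categories of $H^{\otimes(n+1)}$-modules with the functors $f_*$: an object is a family of $H^{\otimes(n+1)}$-modules $M_n$, $n\ge 0$, with isomorphisms $\tau_f:f_*M_m\to M_n$ for every $f:[m]\to[n]$ in $\Lambda$, such that $\tau_{\mathrm{Id}}=\mathrm{Id}$ and $\tau_g\circ g_*(\tau_f)=\tau_{gf}$ up to the canonical identifications $\mathrm{Id}_*\simeq\mathrm{Id}$ and $g_*f_*\simeq(gf)_*$; morphisms are the families of module maps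 compatible with the $\tau_f$. Let $HH({}_H\mathcal M)$ be the inverse limit defined in the same way over the simplex category $\Delta\subset\Lambda$. For $M\in HH({}_H\mathcal M)$ put $\tau=\tau_{\delta_1}^{-1}\tau_{\delta_0}:\delta_{0*}M_0\to\delta_{1*}M_0$ and $\varsigma_M=s_{1*}(\tau):M_0\to M_0$, where $s_1:[1]\to[0]$ is the extra degeneracy, $H\otimes H\to H$, $a\otimes h\mapsto\epsilon(a)h$. An anti-Yetter-Drinfeld contramodule is a left $H$-module $M$ with a $k$-linear map $\alpha:\mathrm{Hom}_k(H,M)\to M$ such that $\alpha(h\mapsto\epsilon(h)m)=m$, $\alpha(x\mapsto\alpha(y\mapsto F(x)(y)))=\alpha(h\mapsto F(h^1)(h^2))$ and $\alpha(h\mapsto a^2\varphi(S(a^3)ha^1))=a\,\alpha(\varphi)$ for all $m\in M$, $F\in\mathrm{Hom}_k(H,\mathrm{Hom}_k(H,M))$, $\varphi\in\mathrm{Hom}_k(H,M)$, $a\in H$; morphisms are the $H$-linear maps that commute with $\alpha$. It is stable if $\alpha(h\mapsto hm)=m$ for all $m\in M$. Then: (1) $HC({}_H\mathcal M)$ is equivalent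 to the category of stable anti-Yetter-Drinfeld contramodules, by an equivalence that preserves the underlying $H$-modules, where the underlying $H$-module of an object of $HC({}_H\mathcal M)$ is $M_0$. (2) The maps $\varsigma_M$ are the components at $[0]$ of an automorphism $\varsigma$ of the identity functor of $HH({}_H\mathcal M)$, and the canonical functor $HC({}_H\mathcal M)\to HH({}_H\mathcal M)$ is fully faithful, with essential image the objects on which $\varsigma$ is the identity. -/

import Mathlib

open CategoryTheory
open scoped TensorProduct

universe u

/-! ### Modules over a varying ring and coinduction -/

section Coinduction

variable {R S T : Type u} [Ring R] [Ring S] [Ring T]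

/-- The value at `s : S` of an element `φ` of the coinduced module `f_* M = Hom_R(S, M)`. -/
noncomputable def coindEval (f : R →+* S) {M : ModuleCat.{u} R}
    (φ : (ModuleCat.coextendScalars.{u, u, u} f).obj M) (s : S) : M :=
  ModuleCat.CoextendScalars.equiv f M φ s

/-- An `R`-linear function `S → M` as an element of the coinduced module. -/
noncomputable def coindMk (f : R →+* S) {M : ModuleCat.{u} R} (φ : S → M)
    (hadd : ∀ s t : S, φ (s + t) = φ s + φ t)
    (hsmul : ∀ (r : R) (s : S), φ (f r * s) = r • φ s) :
    (ModuleCat.coextendScalars.{u, u, u} f).obj M :=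
  (ModuleCat.CoextendScalars.equiv f M).symm
    { toFun := φ
      map_add' := hadd
      map_smul' := hsmul }

theorem coindEval_mk (f : R →+* S) {M : ModuleCat.{u} R} (φ : S → M)
    (hadd : ∀ s t : S, φ (s + t) = φ s + φ t)
    (hsmul : ∀ (r : R) (s : S), φ (f r * s) = r • φ s) (s : S) :
    coindEval f (coindMk f φ hadd hsmul) s = φ s := rfl

theorem coind_ext (f : R →+* S) {M : ModuleCat.{u} R}
    {φ ψ : (ModuleCat.coextendScalars.{u, u, u} f).obj M}
    (h : ∀ s, coindEval f φ s = coindEval f ψ s) : φ = ψ := by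
  apply ModuleCat.CoextendScalars.ext
  apply LinearMap.ext
  intro s
  exact h s

theorem coindEval_add (f : R →+* S) {M : ModuleCat.{u} R}
    (φ ψ : (ModuleCat.coextendScalars.{u, u, u} f).obj M) (s : S) :
    coindEval f (φ + ψ) s = coindEval f φ s + coindEval f ψ s := rfl

theorem coindEval_smul (f : R →+* S) {M : ModuleCat.{u} R} (t : S)
    (φ : (ModuleCat.coextendScalars.{u, u, u} f).obj M) (s : S) :
    coindEval f (t • φ) s = coindEval f φ (s * t) := rfl

theorem coindEval_map_add (f : R →+* S) {M : ModuleCat.{u} R}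
    (φ : (ModuleCat.coextendScalars.{u, u, u} f).obj M) (s t : S) :
    coindEval f φ (s + t) = coindEval f φ s + coindEval f φ t :=
  (ModuleCat.CoextendScalars.equiv f M φ).map_add s t

theorem coindEval_map_mul (f : R →+* S) {M : ModuleCat.{u} R}
    (φ : (ModuleCat.coextendScalars.{u, u, u} f).obj M) (r : R) (s : S) :
    coindEval f φ (f r * s) = r • coindEval f φ s :=
  (ModuleCat.CoextendScalars.equiv f M φ).map_smul r s

/-- The canonical isomorphism `f_* M = Hom_R(R, M) ≅ M`, `φ ↦ φ 1`, for `f` the identity. -/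
noncomputable def coindIdEquiv (f : R →+* R) (hf : f = RingHom.id R) (M : ModuleCat.{u} R) :
    (ModuleCat.coextendScalars.{u, u, u} f).obj M ≃ₗ[R] M where
  toFun φ := coindEval f φ 1
  invFun m := coindMk f (fun r => r • m) (fun a b => add_smul a b m)
    (fun a b => by rw [hf]; exact mul_smul a b m)
  map_add' φ ψ := rfl
  map_smul' r φ := by
    have hr : f r = r := by rw [hf, RingHom.id_apply]
    rw [coindEval_smul, RingHom.id_apply, ← coindEval_map_mul, hr, one_mul, mul_one]
  left_inv φ := coind_ext f fun r => by
    have hr : f r = r := by rw [hf, RingHom.id_apply]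
    rw [coindEval_mk, ← coindEval_map_mul, hr, mul_one]
  right_inv m := one_smul R m

/-- `coindIdEquiv` as an isomorphism of modules. -/
noncomputable def coindIdIso (f : R →+* R) (hf : f = RingHom.id R) (M : ModuleCat.{u} R) :
    (ModuleCat.coextendScalars.{u, u, u} f).obj M ≅ M :=
  (coindIdEquiv f hf M).toModuleIso

/-- The canonical isomorphism `g_* f_* M ≅ (g f)_* M`, that is
`Hom_S(T, Hom_R(S, M)) ≅ Hom_R(T, M)`, `Φ ↦ (t ↦ Φ t 1)`. -/
noncomputable def coindCompEquiv (f : R →+* S) (g : S →+* T) (gf : R →+* T) (h : gf = g.comp f)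
    (M : ModuleCat.{u} R) :
    (ModuleCat.coextendScalars.{u, u, u} g).obj
        ((ModuleCat.coextendScalars.{u, u, u} f).obj M) ≃ₗ[T]
      (ModuleCat.coextendScalars.{u, u, u} gf).obj M where
  toFun Φ := coindMk gf (fun t => coindEval f (coindEval g Φ t) 1)
    (fun a b => by rw [coindEval_map_add, coindEval_add])
    (fun r t => by
      rw [h, RingHom.comp_apply, coindEval_map_mul, coindEval_smul, ← coindEval_map_mul,
        one_mul, mul_one])
  invFun ψ := coindMk g
    (fun t => coindMk f (fun s => coindEval gf ψ (g s * t))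
      (fun a b => by rw [map_add, add_mul, coindEval_map_add])
      (fun r s => by
        have hr : gf r = g (f r) := by rw [h, RingHom.comp_apply]
        rw [← coindEval_map_mul, hr, map_mul, mul_assoc]))
    (fun a b => coind_ext f fun s => by
      rw [coindEval_add, coindEval_mk, coindEval_mk, coindEval_mk, mul_add, coindEval_map_add])
    (fun s t => coind_ext f fun s' => by
      rw [coindEval_smul, coindEval_mk, coindEval_mk, map_mul, mul_assoc])
  map_add' φ ψ := rfl
  map_smul' r φ := rfl
  left_inv Φ := coind_ext g fun t => coind_ext f fun s => by
    rw [coindEval_mk, coindEval_mk, coindEval_mk, coindEval_map_mul, coindEval_smul, one_mul]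
  right_inv ψ := coind_ext gf fun t => by
    rw [coindEval_mk, coindEval_mk, coindEval_mk, map_one, one_mul]

/-- `coindCompEquiv` as an isomorphism of modules. -/
noncomputable def coindCompIso (f : R →+* S) (g : S →+* T) (gf : R →+* T) (h : gf = g.comp f)
    (M : ModuleCat.{u} R) :
    (ModuleCat.coextendScalars.{u, u, u} g).obj ((ModuleCat.coextendScalars.{u, u, u} f).obj M) ≅
      (ModuleCat.coextendScalars.{u, u, u} gf).obj M :=
  (coindCompEquiv f g gf h M).toModuleIso

end Coinduction

/-! ### The inverse limit of module categories along coinduction -/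

section Limit

variable {J : Type} [SmallCategory J]

/-- An object of the inverse limit of the categories of modules over the rings `F x`, where an
arrow `f : x ⟶ y` acts by coinduction `(F f)_* = Hom_{F x}(F y, -)`: a module `M_x` for every `x`,
and isomorphisms `τ_f : f_* M_x ≅ M_y` with `τ_id = Id` and `τ_g ∘ g_* τ_f = τ_{gf}`, up to the
canonical identifications `id_* ≅ Id` and `g_* f_* ≅ (g f)_*`. -/
structure CoindLim (F : J ⥤ RingCat.{u}) where
  obj : ∀ x : J, ModuleCat.{u} (F.obj x)
  τ : ∀ {x y : J} (f : x ⟶ y),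
    (ModuleCat.coextendScalars.{u, u, u} (F.map f).hom).obj (obj x) ≅ obj y
  τ_id : ∀ x : J, (τ (𝟙 x)).hom = (coindIdIso (F.map (𝟙 x)).hom (by simp) (obj x)).hom
  τ_comp : ∀ {x y z : J} (f : x ⟶ y) (g : y ⟶ z),
    (ModuleCat.coextendScalars.{u, u, u} (F.map g).hom).map (τ f).hom ≫ (τ g).hom =
      (coindCompIso (F.map f).hom (F.map g).hom (F.map (f ≫ g)).hom (by simp) (obj x)).hom ≫
        (τ (f ≫ g)).hom

namespace CoindLim

variable {F : J ⥤ RingCat.{u}}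

/-- Morphisms in the inverse limit: families of module maps compatible with the `τ_f`. -/
@[ext]
structure Hom (M N : CoindLim F) where
  app : ∀ x : J, M.obj x ⟶ N.obj x
  comm : ∀ {x y : J} (f : x ⟶ y),
    (ModuleCat.coextendScalars.{u, u, u} (F.map f).hom).map (app x) ≫ (N.τ f).hom =
      (M.τ f).hom ≫ app y

instance : Category (CoindLim F) where
  Hom := Hom
  id M := { app := fun x => 𝟙 (M.obj x), comm := fun f => by simp }
  comp a b :=
    { app := fun x => a.app x ≫ b.app x
      comm := fun f => by
        rw [Functor.map_comp, Category.assoc, b.comm, ← Category.assoc, a.comm, Category.assoc] }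

/-- The projection of the inverse limit to the module category at `x`. -/
def proj (F : J ⥤ RingCat.{u}) (x : J) : CoindLim F ⥤ ModuleCat.{u} (F.obj x) where
  obj M := M.obj x
  map a := Hom.app a x

/-- Restriction of the inverse limit along a functor of index categories. -/
def restrict {I : Type} [SmallCategory I] (G : I ⥤ J) (F : J ⥤ RingCat.{u}) :
    CoindLim F ⥤ CoindLim (G ⋙ F) where
  obj M :=
    { obj := fun x => M.obj (G.obj x)
      τ := fun f => M.τ (G.map f)
      τ_id := fun x => by
        have h : ∀ (f : G.obj x ⟶ G.obj x) (hf : f = 𝟙 _),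
            (M.τ f).hom =
              (coindIdIso (F.map f).hom (by simp [hf]) (M.obj (G.obj x))).hom := by
          rintro f rfl
          exact M.τ_id _
        exact h (G.map (𝟙 x)) (G.map_id x)
      τ_comp := fun {x y z} f g => by
        have h : ∀ (c : G.obj x ⟶ G.obj z) (hc : c = G.map f ≫ G.map g),
            (ModuleCat.coextendScalars.{u, u, u} (F.map (G.map g)).hom).map (M.τ (G.map f)).hom ≫
              (M.τ (G.map g)).hom =
            (coindCompIso (F.map (G.map f)).hom (F.map (G.map g)).hom (F.map c).hom
              (by simp [hc]) (M.obj (G.obj x))).hom ≫ (M.τ c).hom := by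
          rintro c rfl
          exact M.τ_comp _ _
        exact h (G.map (f ≫ g)) (G.map_comp f g) }
  map a :=
    { app := fun x => a.app (G.obj x)
      comm := fun f => a.comm (G.map f) }

end CoindLim

end Limit

/-! ### Connes' cyclic category -/

/-- The category `Λ` has an object `[n]`, thought of as the cyclically ordered set `ℤ / (n + 1)`,
for every natural number `n`. -/
@[ext]
structure CyclicCat where
  len : ℕ

namespace CyclicCat

/-- Monotone maps `f : ℤ → ℤ` with `f (i + m + 1) = f i + n + 1`. -/
@[ext]
structure Lift (m n : ℕ) where
  toFun : ℤ → ℤ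
  mono : Monotone toFun
  period : ∀ i, toFun (i + (m + 1)) = toFun i + (n + 1)

theorem Lift.period_mul {m n : ℕ} (f : Lift m n) (i q : ℤ) :
    f.toFun (i + (m + 1) * q) = f.toFun i + (n + 1) * q := by
  induction q using Int.induction_on with
  | zero => simp
  | succ q ih =>
    have := f.period (i + (m + 1) * q)
    rw [show i + ((m : ℤ) + 1) * (q + 1) = i + (m + 1) * q + (m + 1) by ring, this, ih]; ring
  | pred q ih =>
    have := f.period (i + (m + 1) * (-q - 1))
    rw [show i + ((m : ℤ) + 1) * (-q - 1) + (m + 1) = i + (m + 1) * (-q) by ring, ih] at this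
    linarith

/-- Two monotone maps are identified if they differ by a translation by a multiple of `n + 1`. -/
instance Lift.setoid (m n : ℕ) : Setoid (Lift m n) where
  r f g := ∃ q : ℤ, ∀ i, g.toFun i = f.toFun i + (n + 1) * q
  iseqv :=
    { refl := fun f => ⟨0, fun i => by simp⟩
      symm := fun {f g} ⟨q, h⟩ => ⟨-q, fun i => by rw [h]; ring⟩
      trans := fun {f g l} ⟨q, h⟩ ⟨r, h'⟩ => ⟨q + r, fun i => by rw [h', h]; ring⟩ }

def Lift.id (n : ℕ) : Lift n n where
  toFun i := i
  mono := monotone_id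
  period _ := rfl

def Lift.comp {l m n : ℕ} (f : Lift l m) (g : Lift m n) : Lift l n where
  toFun i := g.toFun (f.toFun i)
  mono := g.mono.comp f.mono
  period i := by rw [f.period, g.period]

/-- The cyclic category of Connes: the morphisms `[m] ⟶ [n]` are the monotone maps `f : ℤ → ℤ` with
`f (i + m + 1) = f i + n + 1`, modulo translation by multiples of `n + 1`. -/
instance : SmallCategory CyclicCat where
  Hom x y := Quotient (Lift.setoid x.len y.len)
  id x := Quotient.mk _ (Lift.id x.len)
  comp {x y z} a b := Quotient.map₂ Lift.comp (by
    rintro f f' ⟨q, hf⟩ g g' ⟨r, hg⟩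
    refine ⟨q + r, fun i => ?_⟩
    simp only [Lift.comp]
    rw [hg, hf, g.period_mul]; ring) a b
  id_comp := by rintro x y ⟨f⟩; rfl
  comp_id := by rintro x y ⟨f⟩; rfl
  assoc := by rintro x y z w ⟨f⟩ ⟨g⟩ ⟨h⟩; rfl

/-- The morphism of `Λ` represented by a monotone map. -/
def homMk {x y : CyclicCat} (f : Lift x.len y.len) : x ⟶ y := Quotient.mk _ f

/-- The periodic extension of a monotone map `{0, …, m} → {0, …, n}`. -/
def Lift.ofOrderHom {m n : ℕ} (f : Fin (m + 1) →o Fin (n + 1)) : Lift m n where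
  toFun i := ((f (Fin.ofNat (m + 1) (i % (m + 1)).toNat) : ℕ) : ℤ) + (n + 1) * (i / (m + 1))
  mono := by
    intro i j hij
    have hm : (0 : ℤ) < m + 1 := by positivity
    have hd : i / ((m : ℤ) + 1) ≤ j / (m + 1) := Int.ediv_le_ediv hm hij
    have hi := Int.emod_nonneg i hm.ne'
    have hj := Int.emod_nonneg j hm.ne'
    have hi' := Int.emod_lt_of_pos i hm
    have hj' := Int.emod_lt_of_pos j hm
    dsimp only
    rcases hd.lt_or_eq with h | h
    · have h1 : i / ((m : ℤ) + 1) + 1 ≤ j / (m + 1) := h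
      have h2 := (f (Fin.ofNat (m + 1) (i % (m + 1)).toNat)).is_lt
      nlinarith
    · rw [h]
      have h3 : i % ((m : ℤ) + 1) ≤ j % (m + 1) := by
        have h4 := Int.emod_add_mul_ediv i (m + 1)
        have h5 := Int.emod_add_mul_ediv j (m + 1)
        rw [h] at h4
        linarith
      have h6 : f (Fin.ofNat (m + 1) (i % (m + 1)).toNat) ≤
          f (Fin.ofNat (m + 1) (j % (m + 1)).toNat) := by
        apply f.monotone
        rw [Fin.le_def]
        simp only [Fin.val_ofNat]
        rw [Nat.mod_eq_of_lt (by omega), Nat.mod_eq_of_lt (by omega)]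
        omega
      have h7 : ((f (Fin.ofNat (m + 1) (i % (m + 1)).toNat) : ℕ) : ℤ) ≤
          (f (Fin.ofNat (m + 1) (j % (m + 1)).toNat) : ℕ) := by exact_mod_cast h6
      linarith
  period i := by
    have hm : ((m : ℤ) + 1) ≠ 0 := by positivity
    rw [Int.add_emod_right, Int.add_ediv_of_dvd_right dvd_rfl, Int.ediv_self hm]
    ring

theorem Lift.ofOrderHom_apply {m n : ℕ} (f : Fin (m + 1) →o Fin (n + 1)) (a : Fin (m + 1))
    (q : ℤ) :
    (Lift.ofOrderHom f).toFun (((a : ℕ) : ℤ) + (m + 1) * q) = ((f a : ℕ) : ℤ) + (n + 1) * q := by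
  have hm : ((m : ℤ) + 1) ≠ 0 := by positivity
  have ha := a.is_lt
  have h1 : (((a : ℕ) : ℤ) + (m + 1) * q) % (m + 1) = (a : ℕ) := by
    rw [Int.add_mul_emod_self_left]
    exact Int.emod_eq_of_lt (by positivity) (by exact_mod_cast ha)
  have h2 : (((a : ℕ) : ℤ) + (m + 1) * q) / (m + 1) = q := by
    rw [Int.add_mul_ediv_left _ _ hm, Int.ediv_eq_zero_of_lt (by positivity) (by exact_mod_cast ha),
      zero_add]
  have h3 : Fin.ofNat (m + 1) (a : ℕ) = a := by
    ext
    simp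
  simp only [Lift.ofOrderHom]
  rw [h1, h2, Int.toNat_natCast, h3]

theorem Lift.ext_period {m n : ℕ} {f g : Lift m n}
    (h : ∀ a : Fin (m + 1), f.toFun (a : ℕ) = g.toFun (a : ℕ)) : f = g := by
  ext i
  have hm : (0 : ℤ) < (m : ℤ) + 1 := by positivity
  have h1 := Int.emod_nonneg i hm.ne'
  have h2 := Int.emod_lt_of_pos i hm
  have h3 := h ⟨(i % (m + 1)).toNat, by omega⟩
  simp only [Int.toNat_of_nonneg h1] at h3
  rw [← Int.emod_add_mul_ediv i (m + 1), f.period_mul, g.period_mul, h3]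

/-- The inclusion of the simplex category in the cyclic category. -/
def ofSimplex : SimplexCategory ⥤ CyclicCat where
  obj x := ⟨x.len⟩
  map f := homMk (Lift.ofOrderHom f.toOrderHom)
  map_id x := by
    refine congrArg (Quotient.mk _) (Lift.ext_period fun a => ?_)
    have := Lift.ofOrderHom_apply (SimplexCategory.Hom.toOrderHom (𝟙 x)) a 0
    simp only [mul_zero, add_zero] at this
    exact this
  map_comp {x y z} f g := by
    refine congrArg (Quotient.mk _) (Lift.ext_period fun a => ?_)
    have h1 := Lift.ofOrderHom_apply f.toOrderHom a 0
    have h2 := Lift.ofOrderHom_apply g.toOrderHom (f.toOrderHom a) 0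
    have h3 := Lift.ofOrderHom_apply (SimplexCategory.Hom.toOrderHom (f ≫ g)) a 0
    simp only [mul_zero, add_zero] at h1 h2 h3
    simp only [Lift.comp]
    rw [h1, h2, h3]
    rfl

/-- The extra degeneracy `[1] ⟶ [0]`, represented by `i ↦ ⌊(i + 1) / 2⌋`. The ordinary degeneracy
is represented by `i ↦ ⌊i / 2⌋`. -/
def extraDegeneracy : CyclicCat.mk 1 ⟶ CyclicCat.mk 0 :=
  homMk
    { toFun := fun i => (i + 1) / 2
      mono := fun i j h => by dsimp only; omega
      period := fun i => by push_cast; omega }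

theorem δ_extraDegeneracy (i : Fin 2) :
    (show CyclicCat.mk 0 ⟶ CyclicCat.mk 1 from ofSimplex.map (SimplexCategory.δ i)) ≫
      extraDegeneracy = 𝟙 (CyclicCat.mk 0) := by
  have key : ∀ j : ℤ, (Lift.ofOrderHom (SimplexCategory.δ (n := 0) i).toOrderHom).toFun j =
      (((SimplexCategory.δ (n := 0) i).toOrderHom 0 : ℕ) : ℤ) + 2 * j := by
    intro j
    have := Lift.ofOrderHom_apply (SimplexCategory.δ (n := 0) i).toOrderHom 0 j
    simpa [one_add_one_eq_two] using this
  refine Quotient.sound ?_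
  fin_cases i
  · refine ⟨-1, fun j => ?_⟩
    have h0 : (((SimplexCategory.δ (n := 0) (0 : Fin 2)).toOrderHom 0 : ℕ) : ℤ) = 1 := rfl
    have h1 := key j
    simp only [Fin.zero_eta] at h1
    rw [h0] at h1
    simp only [Lift.comp, Lift.id, Fin.zero_eta]
    rw [h1]
    push_cast
    omega
  · refine ⟨0, fun j => ?_⟩
    have h0 : (((SimplexCategory.δ (n := 0) (1 : Fin 2)).toOrderHom 0 : ℕ) : ℤ) = 0 := rfl
    have h1 := key j
    simp only [Fin.mk_one] at h1
    rw [h0] at h1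
    simp only [Lift.comp, Lift.id, Fin.mk_one]
    rw [h1]
    push_cast
    omega

end CyclicCat

/-! ### The cocyclic algebra of a bialgebra -/

section CocyclicAlgebra

variable (k H : Type u) [Field k] [Ring H] [Bialgebra k H]

/-- The algebra `H^{⊗ (n + 1)}`. -/
abbrev TensorPow (n : ℕ) : Type u := ⨂[k] _ : Fin (n + 1), H

/-- The residue of an integer modulo `n + 1`. -/
def residue (n : ℕ) (p : ℤ) : Fin (n + 1) := Fin.ofNat (n + 1) (p % (n + 1)).toNat

theorem residue_val (n : ℕ) (p : ℤ) : ((residue n p : ℕ) : ℤ) = p % (n + 1) := by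
  have hn : (0 : ℤ) < (n : ℤ) + 1 := by positivity
  have h1 := Int.emod_nonneg p hn.ne'
  have h2 := Int.emod_lt_of_pos p hn
  simp only [residue, Fin.val_ofNat]
  rw [Nat.mod_eq_of_lt (by omega)]
  omega

theorem residue_add_mul (n : ℕ) (p q : ℤ) : residue n (p + (n + 1) * q) = residue n p := by
  simp [residue]

theorem residue_coe (n : ℕ) (j : Fin (n + 1)) : residue n (j : ℕ) = j := by
  apply Fin.ext
  have := residue_val n (j : ℕ)
  rw [Int.emod_eq_of_lt (by positivity) (by exact_mod_cast j.is_lt)] at this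
  exact_mod_cast this

theorem residue_ne (n : ℕ) {p q : ℤ} (h1 : p < q) (h2 : q < p + (n + 1)) :
    residue n p ≠ residue n q := by
  intro h
  have h3 : p % ((n : ℤ) + 1) = q % (n + 1) := by rw [← residue_val, ← residue_val, h]
  have h4 : ((n : ℤ) + 1) ∣ q - p := Int.ModEq.dvd h3
  have h5 := Int.le_of_dvd (by linarith) h4
  linarith

/-- The inclusion of `H` in `H^{⊗ (n + 1)}` at the position `p` modulo `n + 1`. -/
noncomputable def insertAt (n : ℕ) (p : ℤ) : H →ₐ[k] TensorPow k H n :=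
  PiTensorProduct.singleAlgHom (R := k) (A := fun _ : Fin (n + 1) => H) (residue n p)

/-- The map `H → H^{⊗ (n + 1)}` that applies the iterated coproduct and places
`h¹, …, h^N` at the positions `a + 1, …, a + N` modulo `n + 1`; for `N = 0` it is the counit. It is
the product of the inclusions in the convolution algebra. -/
noncomputable def spread (n : ℕ) (a : ℤ) (N : ℕ) : WithConv (H →ₗ[k] TensorPow k H n) :=
  ((List.range N).map fun t : ℕ =>
    WithConv.toConv (insertAt k H n (a + 1 + t)).toLinearMap).prod

variable {k H}

theorem spread_succ (n : ℕ) (a : ℤ) (N : ℕ) :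
    spread k H n a (N + 1) =
      spread k H n a N * WithConv.toConv (insertAt k H n (a + 1 + N)).toLinearMap := by
  simp [spread, List.range_succ]

theorem spread_add (n : ℕ) (a : ℤ) (N M : ℕ) :
    spread k H n a (N + M) = spread k H n a N * spread k H n (a + N) M := by
  induction M with
  | zero => simp [spread]
  | succ M ih =>
    rw [← add_assoc, spread_succ, ih, spread_succ, mul_assoc]
    push_cast
    rw [show a + 1 + ((N : ℤ) + M) = a + N + 1 + M by ring]

theorem spread_shift (n : ℕ) (a q : ℤ) (N : ℕ) :
    spread k H n (a + (n + 1) * q) N = spread k H n a N := by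
  unfold spread
  congr 2
  funext t
  have : residue n (a + (n + 1) * q + 1 + t) = residue n (a + 1 + t) := by
    rw [← residue_add_mul n (a + 1 + t) q]
    congr 1
    ring
  simp only [insertAt, this]

theorem commute_insertAt (n : ℕ) {p q : ℤ} (h : residue n p ≠ residue n q) (x y : H) :
    Commute (insertAt k H n p x) (insertAt k H n q y) := by
  simp only [insertAt, PiTensorProduct.singleAlgHom_apply]
  apply Commute.tprod
  exact Pi.mulSingle_commute (f := fun _ : Fin (n + 1) => H) h x y

theorem commute_spread (n : ℕ) (a : ℤ) (N : ℕ) (x : TensorPow k H n)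
    (hx : ∀ t : ℕ, t < N → ∀ h, Commute (insertAt k H n (a + 1 + t) h) x) (h : H) :
    Commute (spread k H n a N h) x := by
  induction N generalizing h with
  | zero => simpa [spread] using Algebra.commute_algebraMap_left _ x
  | succ N ih =>
    rw [spread_succ, (Coalgebra.Repr.arbitrary k h).convMul_apply]
    refine Commute.sum_left _ _ _ fun i _ => Commute.mul_left ?_ ?_
    · exact ih (fun t ht => hx t (by omega)) _
    · exact hx N (by omega) _

theorem exists_algHom_spread (n : ℕ) (a : ℤ) (N : ℕ) (hN : N ≤ n + 1) :
    ∃ φ : H →ₐ[k] TensorPow k H n, ∀ h, φ h = spread k H n a N h := by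
  induction N with
  | zero =>
    exact ⟨(Algebra.ofId k _).comp (Bialgebra.counitAlgHom k H), fun h => by
      simp [spread, Algebra.ofId_apply]⟩
  | succ N ih =>
    obtain ⟨φ, hφ⟩ := ih (by omega)
    have hc : ∀ x y, Commute (φ x) (insertAt k H n (a + 1 + N) y) := by
      intro x y
      rw [hφ]
      refine commute_spread n a N _ (fun t ht h => commute_insertAt n ?_ h y) x
      refine residue_ne n (by omega) (by omega)
    refine ⟨(Algebra.TensorProduct.lift φ _ hc).comp (Bialgebra.comulAlgHom k H), fun h => ?_⟩
    rw [spread_succ, (Coalgebra.Repr.arbitrary k h).convMul_apply]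
    rw [AlgHom.comp_apply, Bialgebra.comulAlgHom_apply, ← (Coalgebra.Repr.arbitrary k h).eq,
      map_sum]
    refine Finset.sum_congr rfl fun i _ => ?_
    rw [Algebra.TensorProduct.lift_tmul, hφ]
    rfl

theorem list_prod_ofFn_mul {R : Type u} [Monoid R] {n : ℕ} (a b : Fin n → R)
    (h : ∀ i j, i ≠ j → Commute (a i) (b j)) :
    (List.ofFn fun i => a i * b i).prod = (List.ofFn a).prod * (List.ofFn b).prod := by
  induction n with
  | zero => simp
  | succ n ih =>
    have hc : Commute (List.ofFn fun i : Fin n => a i.succ).prod (b 0) := by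
      refine Commute.list_prod_left _ _ fun x hx => ?_
      obtain ⟨i, rfl⟩ := (List.mem_ofFn' _ _).1 hx
      exact h _ _ (Fin.succ_ne_zero i)
    simp only [List.ofFn_succ, List.prod_cons]
    rw [ih _ _ fun i j hij => h _ _ fun e => hij (Fin.succ_injective _ e)]
    rw [mul_assoc, ← mul_assoc (b 0), ← hc.eq]
    simp only [mul_assoc]

theorem list_prod_ofFn_single {R : Type u} [Monoid R] {n : ℕ} (a : Fin n → R) (j : Fin n)
    (h : ∀ i, i ≠ j → a i = 1) : (List.ofFn a).prod = a j := by
  induction n with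
  | zero => exact j.elim0
  | succ n ih =>
    rw [List.ofFn_succ, List.prod_cons]
    induction j using Fin.cases with
    | zero =>
      have : (fun i : Fin n => a i.succ) = fun _ => 1 := by
        funext i
        exact h _ (Fin.succ_ne_zero i)
      rw [this]
      simp
    | succ j =>
      rw [h 0 (Fin.succ_ne_zero j).symm, one_mul]
      exact ih (fun i => a i.succ) j fun i hij => h _ fun e => hij (Fin.succ_injective _ e)

open CyclicCat (Lift)

/-- The length of the interval `f (p - 1) + 1, …, f p`. -/
def CyclicCat.Lift.width {m n : ℕ} (f : Lift m n) (p : ℤ) : ℕ :=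
  (f.toFun p - f.toFun (p - 1)).toNat

theorem CyclicCat.Lift.width_eq {m n : ℕ} (f : Lift m n) (p : ℤ) :
    (f.width p : ℤ) = f.toFun p - f.toFun (p - 1) :=
  Int.toNat_of_nonneg (sub_nonneg.2 (f.mono (by omega)))

theorem CyclicCat.Lift.width_le {m n : ℕ} (f : Lift m n) (p : ℤ) : f.width p ≤ n + 1 := by
  have h1 := f.width_eq p
  have h2 := f.period (p - 1)
  have h3 : f.toFun p ≤ f.toFun (p - 1 + (m + 1)) := f.mono (by omega)
  omega

theorem commute_blocks {m n : ℕ} (f : Lift m n) {i j : Fin (m + 1)} (hij : i ≠ j) (x y : H) :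
    Commute (spread k H n (f.toFun ((i : ℕ) - 1)) (f.width (i : ℕ)) x)
      (spread k H n (f.toFun ((j : ℕ) - 1)) (f.width (j : ℕ)) y) := by
  wlog hlt : i < j generalizing i j x y
  · exact (this hij.symm y x (lt_of_le_of_ne (not_lt.1 hlt) hij.symm)).symm
  refine commute_spread _ _ _ _ (fun t ht x' => Commute.symm ?_) x
  refine commute_spread _ _ _ _ (fun s hs y' => Commute.symm ?_) y
  have h1 := f.width_eq (i : ℕ)
  have h2 := f.width_eq (j : ℕ)
  have hlt' : (i : ℕ) < (j : ℕ) := hlt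
  have hj := j.is_lt
  have h3 : f.toFun (i : ℕ) ≤ f.toFun ((j : ℕ) - 1) := f.mono (by omega)
  have h4 : f.toFun (j : ℕ) ≤ f.toFun ((i : ℕ) - 1 + (m + 1)) := f.mono (by omega)
  rw [f.period] at h4
  exact commute_insertAt n (residue_ne n (by omega) (by omega)) x' y'

/-- The algebra map `H^{⊗ (m + 1)} → H^{⊗ (n + 1)}` attached to a monotone map `f`: the tensor
factor `j` is distributed, by the iterated coproduct, over the positions `f (j - 1) + 1, …, f j`
modulo `n + 1`. -/
noncomputable def cocyclicMap {m n : ℕ} (f : Lift m n) : TensorPow k H m →ₐ[k] TensorPow k H n :=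
  PiTensorProduct.liftAlgHom
    ((MultilinearMap.mkPiAlgebraFin k (m + 1) (TensorPow k H n)).compLinearMap fun j =>
      (spread k H n (f.toFun ((j : ℕ) - 1)) (f.width (j : ℕ))).ofConv)
    (by
      rw [MultilinearMap.compLinearMap_apply, MultilinearMap.mkPiAlgebraFin_apply]
      refine List.prod_eq_one fun x hx => ?_
      obtain ⟨i, rfl⟩ := (List.mem_ofFn' _ _).1 hx
      obtain ⟨φ, hφ⟩ := exists_algHom_spread (k := k) (H := H) n (f.toFun ((i : ℕ) - 1))
        (f.width (i : ℕ)) (f.width_le _)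
      exact (hφ 1).symm.trans (map_one φ))
    (fun x y => by
      simp only [MultilinearMap.compLinearMap_apply, MultilinearMap.mkPiAlgebraFin_apply]
      refine Eq.trans ?_ (list_prod_ofFn_mul _ _ fun i j hij => commute_blocks f hij (x i) (y j))
      congr 2
      funext i
      obtain ⟨φ, hφ⟩ := exists_algHom_spread (k := k) (H := H) n (f.toFun ((i : ℕ) - 1))
        (f.width (i : ℕ)) (f.width_le _)
      refine (hφ _).symm.trans ?_
      rw [Pi.mul_apply, map_mul, hφ, hφ])

theorem cocyclicMap_insertAt {m n : ℕ} (f : Lift m n) (p : ℤ) (h : H) :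
    cocyclicMap (k := k) f (insertAt k H m p h) =
      spread k H n (f.toFun (p - 1)) (f.width p) h := by
  have hm : (0 : ℤ) < (m : ℤ) + 1 := by positivity
  have h0 : ∀ j : Fin (m + 1), cocyclicMap (k := k) f
      (PiTensorProduct.singleAlgHom (R := k) (A := fun _ : Fin (m + 1) => H) j h) =
      spread k H n (f.toFun ((j : ℕ) - 1)) (f.width (j : ℕ)) h := by
    intro j
    simp only [cocyclicMap, PiTensorProduct.singleAlgHom_apply, PiTensorProduct.liftAlgHom_apply,
      PiTensorProduct.lift.tprod, MultilinearMap.compLinearMap_apply,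
      MultilinearMap.mkPiAlgebraFin_apply]
    rw [list_prod_ofFn_single _ j]
    · simp
    · intro i hij
      obtain ⟨φ, hφ⟩ := exists_algHom_spread (k := k) (H := H) n (f.toFun ((i : ℕ) - 1))
        (f.width (i : ℕ)) (f.width_le _)
      simp only [MonoidHom.mulSingle_apply, Pi.mulSingle_eq_of_ne hij]
      exact (hφ 1).symm.trans (map_one φ)
  have h1 : p = ((residue m p : ℕ) : ℤ) + (m + 1) * (p / (m + 1)) := by
    rw [residue_val, Int.emod_add_mul_ediv]
  have h2 : f.toFun (p - 1) =
      f.toFun ((residue m p : ℕ) - 1) + (n + 1) * (p / (m + 1)) := by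
    rw [← f.period_mul]
    congr 1
    linarith
  have h3 : f.toFun p = f.toFun (residue m p : ℕ) + (n + 1) * (p / (m + 1)) := by
    rw [← f.period_mul, ← h1]
  have h4 : f.width p = f.width (residue m p : ℕ) := by
    unfold CyclicCat.Lift.width
    rw [h2, h3]
    congr 1
    ring
  rw [h2, h4, spread_shift]
  exact h0 _

theorem cocyclicMap_spread {l m : ℕ} (g : Lift l m) (a : ℤ) (N : ℕ) (h : H) :
    cocyclicMap (k := k) g (spread k H l a N h) =
      spread k H m (g.toFun a) (g.toFun (a + N) - g.toFun a).toNat h := by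
  induction N generalizing h with
  | zero => simp [spread]
  | succ N ih =>
    have h1 : (g.toFun (a + (N + 1 : ℕ)) - g.toFun a).toNat =
        (g.toFun (a + N) - g.toFun a).toNat + g.width (a + 1 + N) := by
      have e1 : g.toFun a ≤ g.toFun (a + N) := g.mono (by omega)
      have e2 := g.width_eq (a + 1 + N)
      rw [show a + 1 + (N : ℤ) - 1 = a + N by ring,
        show a + 1 + (N : ℤ) = a + (N + 1 : ℕ) by push_cast; ring] at e2
      rw [show a + 1 + (N : ℤ) = a + (N + 1 : ℕ) by push_cast; ring]
      omega
    have h2 : g.toFun a + ((g.toFun (a + N) - g.toFun a).toNat : ℤ) =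
        g.toFun (a + 1 + N - 1) := by
      have e1 : g.toFun a ≤ g.toFun (a + N) := g.mono (by omega)
      rw [show a + 1 + (N : ℤ) - 1 = a + N by ring]
      omega
    rw [h1, spread_add (N := (g.toFun (a + N) - g.toFun a).toNat), h2, spread_succ, (Coalgebra.Repr.arbitrary k h).convMul_apply,
      (Coalgebra.Repr.arbitrary k h).convMul_apply, map_sum]
    refine Finset.sum_congr rfl fun i _ => ?_
    rw [map_mul, ih]
    congr 1
    exact cocyclicMap_insertAt g _ _

theorem cocyclicMap_id (n : ℕ) : cocyclicMap (k := k) (H := H) (Lift.id n) = AlgHom.id k _ := by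
  apply PiTensorProduct.algHom_ext
  intro j
  ext h
  have h1 := cocyclicMap_insertAt (k := k) (Lift.id n) (j : ℕ) h
  have h2 : (Lift.id n).width (j : ℕ) = 1 := by simp [CyclicCat.Lift.width, Lift.id]
  rw [h2] at h1
  have h3 := spread_succ (k := k) (H := H) n ((Lift.id n).toFun ((j : ℕ) - 1)) 0
  rw [zero_add] at h3
  rw [h3] at h1
  simp only [insertAt, residue_coe] at h1
  refine h1.trans ?_
  simp [spread, Lift.id, residue_coe]

theorem cocyclicMap_comp {l m n : ℕ} (f : Lift l m) (g : Lift m n) :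
    cocyclicMap (k := k) (H := H) (Lift.comp f g) = (cocyclicMap g).comp (cocyclicMap f) := by
  apply PiTensorProduct.algHom_ext
  intro j
  ext h
  have h1 := cocyclicMap_insertAt (k := k) (Lift.comp f g) (j : ℕ) h
  have h2 := cocyclicMap_insertAt (k := k) f (j : ℕ) h
  have h3 := cocyclicMap_spread (k := k) g (f.toFun ((j : ℕ) - 1)) (f.width (j : ℕ)) h
  simp only [insertAt, residue_coe] at h1 h2
  rw [← h2, f.width_eq] at h3
  rw [show f.toFun ((j : ℕ) - 1) + (f.toFun (j : ℕ) - f.toFun ((j : ℕ) - 1)) =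
    f.toFun (j : ℕ) by ring] at h3
  exact h1.trans h3.symm

theorem cocyclicMap_congr {m n : ℕ} {f g : Lift m n} (h : f ≈ g) :
    cocyclicMap (k := k) (H := H) f = cocyclicMap g := by
  obtain ⟨q, hq⟩ := h
  apply PiTensorProduct.algHom_ext
  intro j
  ext x
  have h1 := cocyclicMap_insertAt (k := k) f (j : ℕ) x
  have h2 := cocyclicMap_insertAt (k := k) g (j : ℕ) x
  have h3 : g.width (j : ℕ) = f.width (j : ℕ) := by
    unfold CyclicCat.Lift.width
    rw [hq, hq]
    congr 1
    ring
  simp only [insertAt, residue_coe] at h1 h2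
  rw [hq, h3, spread_shift, ← h1] at h2
  exact h2.symm

variable (k H)

/-- The cocyclic algebra `[n] ↦ H^{⊗ (n + 1)}`, as a functor on the cyclic category. -/
noncomputable def cocyclicAlgebra : CyclicCat ⥤ RingCat.{u} where
  obj x := RingCat.of (TensorPow k H x.len)
  map {x y} a := Quotient.lift (s := Lift.setoid x.len y.len)
    (fun f : Lift x.len y.len => RingCat.ofHom (cocyclicMap (k := k) (H := H) f).toRingHom)
    (fun f g h => by rw [cocyclicMap_congr h]) a
  map_id x := by
    refine congrArg (fun φ : TensorPow k H x.len →ₐ[k] TensorPow k H x.len =>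
      RingCat.ofHom φ.toRingHom) (cocyclicMap_id x.len)
  map_comp {x y z} a b := by
    induction a using Quotient.inductionOn with
    | h f =>
      induction b using Quotient.inductionOn with
      | h g =>
        exact congrArg (fun φ : TensorPow k H x.len →ₐ[k] TensorPow k H z.len =>
          RingCat.ofHom φ.toRingHom) (cocyclicMap_comp f g)

/-- The underlying cosimplicial algebra. -/
noncomputable abbrev cosimplicialAlgebra : SimplexCategory ⥤ RingCat.{u} :=
  CyclicCat.ofSimplex ⋙ cocyclicAlgebra k H

end CocyclicAlgebra

/-! ### Naive Hochschild and cyclic homology categories of the category of `H`-modules -/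

section Homology

variable (k H : Type u) [Field k] [Ring H] [Bialgebra k H]

/-- `HH(_H M)`: the inverse limit over the simplex category of the categories of modules over
`H^{⊗ (n + 1)}`, with coinduction functors. -/
abbrev HochschildCat := CoindLim (cosimplicialAlgebra k H)

/-- `HC(_H M)`: the inverse limit over the cyclic category of the categories of modules over
`H^{⊗ (n + 1)}`, with coinduction functors. -/
abbrev CyclicHomologyCat := CoindLim (cocyclicAlgebra k H)

/-- The canonical functor `HC(_H M) ⥤ HH(_H M)`. -/
noncomputable abbrev cyclicToHochschild : CyclicHomologyCat k H ⥤ HochschildCat k H :=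
  CoindLim.restrict CyclicCat.ofSimplex (cocyclicAlgebra k H)

/-- The underlying `H`-module of an object of `HC(_H M)`: its component at `[0]`, with
`H ≅ H^{⊗ 1}` acting. -/
noncomputable def CyclicHomologyCat.underlying : CyclicHomologyCat k H ⥤ ModuleCat.{u} H :=
  CoindLim.proj (cocyclicAlgebra k H) (CyclicCat.mk 0) ⋙
    ModuleCat.restrictScalars (insertAt k H 0 0).toRingHom

variable {k H}

/-- The object `[0]` of the simplex category. -/
abbrev simplexZero : SimplexCategory := SimplexCategory.mk 0

/-- The object `[1]` of the simplex category. -/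
abbrev simplexOne : SimplexCategory := SimplexCategory.mk 1

/-- The ring map `H ⊗ H → H` of the extra degeneracy `s₁ : [1] → [0]`. -/
noncomputable def extraDegeneracyHom :
    (cosimplicialAlgebra k H).obj simplexOne →+* (cosimplicialAlgebra k H).obj simplexZero :=
  ((cocyclicAlgebra k H).map CyclicCat.extraDegeneracy).hom

theorem extraDegeneracyHom_comp (i : Fin 2) :
    RingHom.id _ = (extraDegeneracyHom (k := k) (H := H)).comp
      ((cosimplicialAlgebra k H).map (SimplexCategory.δ (n := 0) i)).hom := by
  have h1 := (cocyclicAlgebra k H).map_comp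
    (show CyclicCat.mk 0 ⟶ CyclicCat.mk 1 from
      CyclicCat.ofSimplex.map (SimplexCategory.δ (n := 0) i)) CyclicCat.extraDegeneracy
  rw [CyclicCat.δ_extraDegeneracy, CategoryTheory.Functor.map_id] at h1
  exact congrArg RingCat.Hom.hom h1

/-- The canonical isomorphism `s₁_* δ_i_* N ≅ N`, for `i = 0, 1`. -/
noncomputable def extraDegeneracyIso (i : Fin 2)
    (N : ModuleCat.{u} ((cosimplicialAlgebra k H).obj simplexZero)) :
    (ModuleCat.coextendScalars.{u, u, u} extraDegeneracyHom).obj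
      ((ModuleCat.coextendScalars.{u, u, u}
        ((cosimplicialAlgebra k H).map (SimplexCategory.δ (n := 0) i)).hom).obj N) ≅ N :=
  coindCompIso _ _ (RingHom.id _) (extraDegeneracyHom_comp i) N ≪≫ coindIdIso _ rfl N

/-- The isomorphism `τ : δ₀_* M₀ ≅ M₁ ≅ δ₁_* M₀` of an object of `HH(_H M)`. -/
noncomputable def HochschildCat.tau (M : HochschildCat k H) :
    (ModuleCat.coextendScalars.{u, u, u}
        ((cosimplicialAlgebra k H).map (SimplexCategory.δ (n := 0) 0)).hom).obj
          (M.obj simplexZero) ≅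
      (ModuleCat.coextendScalars.{u, u, u}
        ((cosimplicialAlgebra k H).map (SimplexCategory.δ (n := 0) 1)).hom).obj
          (M.obj simplexZero) :=
  M.τ (SimplexCategory.δ (n := 0) 0) ≪≫ (M.τ (SimplexCategory.δ (n := 0) 1)).symm

/-- The automorphism `ς = s₁_* τ` of the component at `[0]` of an object of `HH(_H M)`, where `s₁`
is the extra degeneracy. -/
noncomputable def HochschildCat.sigma (M : HochschildCat k H) :
    M.obj simplexZero ≅ M.obj simplexZero :=
  (extraDegeneracyIso 0 (M.obj simplexZero)).symm ≪≫
    (ModuleCat.coextendScalars.{u, u, u} extraDegeneracyHom).mapIso M.tau ≪≫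
      extraDegeneracyIso 1 (M.obj simplexZero)

end Homology

/-! ### Anti-Yetter-Drinfeld contramodules -/

section Contramodules

open Coalgebra

variable (k H : Type u) [Field k] [Ring H] [HopfAlgebra k H]

section Twist

variable {k H} {M : Type u} [AddCommGroup M] [Module k M] [Module H M] [IsScalarTower k H M]

/-- For `φ : H → M`, the linear map `x ⊗ y ⊗ z ↦ (h ↦ y φ (S z h x))`. -/
noncomputable def aydTwist (φ : H →ₗ[k] M) : H ⊗[k] (H ⊗[k] H) →ₗ[k] (H →ₗ[k] M) :=
  TensorProduct.lift <| LinearMap.mk₂ k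
    (fun (x : H) (w : H ⊗[k] H) =>
      (TensorProduct.lift (LinearMap.mk₂ k
        (fun y z : H => Algebra.lsmul k k M y ∘ₗ φ ∘ₗ
          LinearMap.mulLeft k (HopfAlgebra.antipode k z))
        (fun y y' z => by ext; simp)
        (fun c y z => by ext; simp)
        (fun y z z' => by ext; simp [add_mul])
        (fun c y z => by ext; simp [smul_comm y c]))) w ∘ₗ LinearMap.mulRight k x)
    (fun x x' w => by ext; simp [mul_add])
    (fun c x w => by ext; simp)
    (fun x w w' => by ext; simp)
    (fun c x w => by ext; simp)

theorem aydTwist_tmul (φ : H →ₗ[k] M) (x y z h : H) :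
    aydTwist φ (x ⊗ₜ (y ⊗ₜ z)) h = y • φ (HopfAlgebra.antipode k z * (h * x)) := rfl

end Twist

/-- An anti-Yetter-Drinfeld contramodule over `H`: a left `H`-module `M` with an `H`-contramodule
structure `α : Hom_k(H, M) → M` such that
`α (h ↦ a² φ (S(a³) h a¹)) = a α(φ)` for all `a` in `H` and `φ` in `Hom_k(H, M)`. -/
structure AYDContramodule where
  carrier : Type u
  [addCommGroup : AddCommGroup carrier]
  [moduleField : Module k carrier]
  [module : Module H carrier]
  [isScalarTower : IsScalarTower k H carrier]
  /-- The contraaction. -/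
  α : (H →ₗ[k] carrier) →ₗ[k] carrier
  /-- Contraassociativity: `α (x ↦ α (y ↦ F x y)) = α (h ↦ F h¹ h²)`. -/
  contra_assoc : ∀ F : H →ₗ[k] H →ₗ[k] carrier, α (α ∘ₗ F) = α (TensorProduct.lift F ∘ₗ comul)
  /-- Contraunitality: `α (h ↦ ε(h) m) = m`. -/
  contra_unit : ∀ m : carrier, α ((counit : H →ₗ[k] k).smulRight m) = m
  /-- The anti-Yetter-Drinfeld compatibility. -/
  ayd : ∀ (a : H) (φ : H →ₗ[k] carrier),
    α (aydTwist φ (comul.lTensor H (comul (R := k) a))) = a • α φ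

namespace AYDContramodule

attribute [instance] addCommGroup moduleField module isScalarTower

variable {k H}

/-- Morphisms of anti-Yetter-Drinfeld contramodules: `H`-linear maps that commute with the
contraactions. -/
@[ext]
structure Hom (M N : AYDContramodule k H) where
  toLin : M.carrier →ₗ[H] N.carrier
  comm : ∀ φ : H →ₗ[k] M.carrier, toLin (M.α φ) = N.α (toLin.restrictScalars k ∘ₗ φ)

instance : Category (AYDContramodule k H) where
  Hom := Hom
  id M := { toLin := LinearMap.id, comm := fun φ => rfl }
  comp f g :=
    { toLin := g.toLin ∘ₗ f.toLin
      comm := fun φ => by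
        rw [LinearMap.comp_apply, f.comm, g.comm]
        rfl }

/-- The contramodule is stable if `α (h ↦ h m) = m` for all `m`. -/
def IsStable : ObjectProperty (AYDContramodule k H) := fun M =>
  ∀ m : M.carrier, M.α ((LinearMap.toSpanSingleton H M.carrier m).restrictScalars k) = m

variable (k H)

/-- The underlying `H`-module. -/
def forgetToModule : AYDContramodule k H ⥤ ModuleCat.{u} H where
  obj M := ModuleCat.of H M.carrier
  map f := ModuleCat.ofHom (Hom.toLin f)

end AYDContramodule

/-- The category of stable anti-Yetter-Drinfeld contramodules. -/
abbrev StableAYDContramodule := (AYDContramodule.IsStable (k := k) (H := H)).FullSubcategory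

end Contramodules

/-!
An object `M` of the inverse limit over a category `J` is determined by its evaluation maps
`CoindLim.ev M f : M_y → M_x` for `f : x ⟶ y`, the value at `1` of the element of
`f_* M_x = Hom_{F x}(F y, M_x)` that corresponds to a given element of `M_y`. They are semilinear and
contravariantly functorial, and `m ↦ (s ↦ ev_f (s m))` is a bijection onto the semilinear
functions `F y → M_x`; conversely such data give an object (`EvaluationData.toCoindLim`), and
morphisms are the families of linear maps that commute with evaluation (`CoindLim.homMk`).

*Cyclic objects among the simplicial ones.* This part holds for every functor `F` from `Λ` to
rings. An object `M` over the simplex category has, for each edge `g` of `[n]` in `Λ` with source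
`a` and target `b`, a transport operator from the functions `F[n] → M₀` that are semilinear over
the vertex `b` to those over `a`, obtained from `τ : δ₀_* M₀ ≅ δ₁_* M₀` by base change along `g`.
The cocycle condition makes transport transitive on the triangles of `Λ`
(`CoindLim.transport_transport`), because every triangle of `Λ` is the image of the standard
2-simplex. The edge of `[0]` that winds once around gives the monodromy `ς`. For the edges of the
simplex category transport matches the functions `s ↦ ev_a (s m)` and `s ↦ ev_b (s m)` of an
element `m` of `M_n`. An edge of `Λ` that is not one of these is the complementary arc of one, and
transport along an edge after transport along its complement is `ς`
(`CoindLim.transport_rotation`). So `ς` acts on all of `M` and is natural, and if it is the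
identity, then transport matches the functions of `m` along all edges of `Λ`, which is what is
needed to define `ev_f` for all `f` in `Λ` (`CoindLim.cyclicEv`).

*Contramodules.* For the algebras `H^{⊗ (n + 1)}` the transport along the arc of `[n]` from `a` to
`b` is `ψ ↦ (x ↦ α (h ↦ ψ (h¹ ⊗ ⋯ ⊗ h^{b - a} · x)))`, with the factors placed at `a + 1, …, b`
(`AYDContramodule.transport`). Contraassociativity says that it is transitive, contraunitality
that it is the identity for `a = b`, stability that it is the identity for `b = a + n + 1`, and
the anti-Yetter-Drinfeld condition that it maps functions semilinear over `b` to functions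
semilinear over `a`. So a stable contramodule `M` gives the object whose component at `[n]` is the
module of the functions `H^{⊗ (n + 1)} → M` that are semilinear over the vertex `0`, with
evaluation maps given by transport (`AYDContramodule.toCyclic`). Conversely `α` is read off from
an object `N` as transport along the arc of `[1]` from `1` to `0`, and the axioms follow from the
existence of enough semilinear functions on `H^{⊗ 2}` and `H^{⊗ 3}`: as `c ↦ c¹ ⊗ w(c²)` makes
`H ⊗ B` a free `H`-module on `1 ⊗ B`, such functions can be prescribed on all tensor factors but
one (`semilinearExtension`). This shows that `AYDContramodule.toCyclic` is fully faithful and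
essentially surjective.
-/

/-! ### The inverse limit in terms of evaluation maps -/

section Evaluation

/-- `φ : S → M` is an element of the coinduced module `Hom_R(S, M)` along `f : R → S`. -/
structure IsCoind {R S M : Type*} [Ring R] [Ring S] [AddCommGroup M] [Module R M] (f : R →+* S)
    (φ : S → M) : Prop where
  map_add : ∀ s t, φ (s + t) = φ s + φ t
  map_mul : ∀ r s, φ (f r * s) = r • φ s

theorem IsCoind.mul_right {R S M : Type*} [Ring R] [Ring S] [AddCommGroup M] [Module R M]
    {f : R →+* S} {φ : S → M} (h : IsCoind f φ) (t : S) : IsCoind f fun s => φ (s * t) :=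
  ⟨fun s s' => by rw [add_mul, h.map_add], fun r s => by rw [mul_assoc, h.map_mul]⟩

/-- Precomposition with a ring map is restriction of the coinduced module. -/
theorem IsCoind.comp {R S T M : Type*} [Ring R] [Ring S] [Ring T] [AddCommGroup M] [Module R M]
    {f : R →+* S} {g : S →+* T} {φ : T → M} (h : IsCoind (g.comp f) φ) :
    IsCoind f fun s => φ (g s) :=
  ⟨fun s s' => by rw [_root_.map_add, h.map_add],
    fun r s => by rw [_root_.map_mul, ← RingHom.comp_apply, h.map_mul]⟩

theorem IsCoind.linear_comp {R S M N : Type*} [Ring R] [Ring S] [AddCommGroup M] [Module R M]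
    [AddCommGroup N] [Module R N] {f : R →+* S} {φ : S → M} (h : IsCoind f φ) (l : M →ₗ[R] N) :
    IsCoind f fun s => l (φ s) :=
  ⟨fun s t => by rw [h.map_add, _root_.map_add], fun r s => by rw [h.map_mul, l.map_smul]⟩

end Evaluation

section EvaluationMaps

variable {J : Type} [SmallCategory J] {F : J ⥤ RingCat.{u}}

namespace CoindLim

/-- The evaluation `M_y → M_x` of an object of the inverse limit along `f : x ⟶ y`: it sends `m` to
the value at `1` of the element of `Hom_{F x}(F y, M_x)` that corresponds to `m` under `τ_f`. -/
noncomputable def ev (M : CoindLim F) {x y : J} (f : x ⟶ y) : M.obj y →+ M.obj x where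
  toFun m := coindEval (F.map f).hom ((M.τ f).inv.hom m) 1
  map_zero' := by rw [map_zero]; rfl
  map_add' m m' := by rw [map_add, coindEval_add]

theorem coindEval_τ_inv (M : CoindLim F) {x y : J} (f : x ⟶ y) (m : M.obj y) (s : F.obj y) :
    coindEval (F.map f).hom ((M.τ f).inv.hom m) s = M.ev f (s • m) := by
  change _ = coindEval (F.map f).hom ((M.τ f).inv.hom (s • m)) 1
  rw [map_smul, coindEval_smul, one_mul]

theorem τ_hom_inv (M : CoindLim F) {x y : J} (f : x ⟶ y) (m : M.obj y) :
    (M.τ f).hom.hom ((M.τ f).inv.hom m) = m :=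
  congrArg (fun a => ModuleCat.Hom.hom a m) (M.τ f).inv_hom_id

theorem τ_inv_hom (M : CoindLim F) {x y : J} (f : x ⟶ y) (φ) :
    (M.τ f).inv.hom ((M.τ f).hom.hom φ) = φ :=
  congrArg (fun a => ModuleCat.Hom.hom a φ) (M.τ f).hom_inv_id

theorem isCoind_ev (M : CoindLim F) {x y : J} (f : x ⟶ y) (m : M.obj y) :
    IsCoind (F.map f).hom fun s : F.obj y => M.ev f (s • m) :=
  ⟨fun s t => by rw [add_smul, map_add], fun r s => by
    rw [← coindEval_τ_inv, ← coindEval_τ_inv, coindEval_map_mul]⟩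

theorem ev_map_smul (M : CoindLim F) {x y : J} (f : x ⟶ y) (r : F.obj x) (m : M.obj y) :
    M.ev f ((F.map f).hom r • m) = r • M.ev f m := by
  have := (M.isCoind_ev f m).map_mul r 1
  rwa [mul_one, one_smul] at this

theorem ev_ext (M : CoindLim F) {x y : J} (f : x ⟶ y) {m m' : M.obj y}
    (h : ∀ s : F.obj y, M.ev f (s • m) = M.ev f (s • m')) : m = m' := by
  rw [← M.τ_hom_inv f m, ← M.τ_hom_inv f m']
  congr 1
  refine coind_ext _ fun s => ?_
  rw [coindEval_τ_inv, coindEval_τ_inv, h]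

theorem exists_ev (M : CoindLim F) {x y : J} (f : x ⟶ y) {φ : F.obj y → M.obj x}
    (h : IsCoind (F.map f).hom φ) : ∃ m : M.obj y, ∀ s : F.obj y, M.ev f (s • m) = φ s := by
  refine ⟨(M.τ f).hom.hom (coindMk (F.map f).hom φ h.map_add h.map_mul), fun s => ?_⟩
  rw [← coindEval_τ_inv, τ_inv_hom, coindEval_mk]

theorem ev_id (M : CoindLim F) (x : J) (m : M.obj x) : M.ev (𝟙 x) m = m := by
  have h := congrArg (fun a => ModuleCat.Hom.hom a ((M.τ (𝟙 x)).inv.hom m)) (M.τ_id x)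
  exact ((M.τ_hom_inv (𝟙 x) m).symm.trans h).symm

theorem ev_comp (M : CoindLim F) {x y z : J} (f : x ⟶ y) (g : y ⟶ z) (m : M.obj z) :
    M.ev (f ≫ g) m = M.ev f (M.ev g m) := by
  have h := congrArg (fun a => ModuleCat.Hom.hom a
    ((ModuleCat.coextendScalars (F.map g).hom).map (M.τ f).inv
      ((M.τ g).inv.hom m))) (M.τ_comp f g)
  have h1 := congrArg (fun a => ModuleCat.Hom.hom a ((M.τ g).inv.hom m))
    (((ModuleCat.coextendScalars (F.map g).hom).mapIso (M.τ f)).inv_hom_id)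
  dsimp at h h1
  erw [h1, τ_hom_inv] at h
  have h2 := congrArg (M.τ (f ≫ g)).inv.hom h
  erw [τ_inv_hom] at h2
  exact congrArg (fun φ => coindEval (F.map (f ≫ g)).hom φ 1) h2

theorem Hom.ev_app {M N : CoindLim F} (a : M ⟶ N) {x y : J} (f : x ⟶ y) (m : M.obj y) :
    N.ev f ((Hom.app a y).hom m) = (Hom.app a x).hom (M.ev f m) := by
  have h := congrArg (fun b => ModuleCat.Hom.hom b ((M.τ f).inv.hom m)) (Hom.comm a f)
  dsimp at h
  rw [τ_hom_inv] at h
  have h2 := congrArg (N.τ f).inv.hom h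
  erw [τ_inv_hom] at h2
  exact (congrArg (fun φ => coindEval (F.map f).hom φ 1) h2).symm

/-- A family of module maps that commutes with the evaluation maps is a morphism. -/
noncomputable def homMk {M N : CoindLim F} (app : ∀ x : J, M.obj x ⟶ N.obj x)
    (h : ∀ {x y : J} (f : x ⟶ y) (m : M.obj y),
      N.ev f ((app y).hom m) = (app x).hom (M.ev f m)) : M ⟶ N :=
  Hom.mk app fun {x y} f => by
    rw [← Iso.inv_comp_eq, ← Category.assoc, ← Iso.eq_comp_inv]
    refine ModuleCat.hom_ext (LinearMap.ext fun m => coind_ext (F.map f).hom fun s => ?_)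
    refine Eq.trans (b := (app x).hom (coindEval (F.map f).hom ((M.τ f).inv.hom m) s)) rfl ?_
    refine Eq.trans ?_ (coindEval_τ_inv N f ((app y).hom m) s).symm
    rw [coindEval_τ_inv, ← map_smul, h]

theorem hom_ext {M N : CoindLim F} {a b : M ⟶ N}
    (h : ∀ x (m : M.obj x), (Hom.app a x).hom m = (Hom.app b x).hom m) : a = b := by
  refine Hom.ext (funext fun x => ?_)
  ext m
  exact h x m

/-- A morphism is determined by its component at `x`, if every object is the target of an arrow
from `x`. -/
theorem hom_ext_of_app {M N : CoindLim F} {a b : M ⟶ N} (x : J) (v : ∀ y, x ⟶ y)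
    (h : ∀ m : M.obj x, (Hom.app a x).hom m = (Hom.app b x).hom m) : a = b := by
  refine hom_ext fun y m => N.ev_ext (v y) fun s => ?_
  rw [← map_smul, ← map_smul, Hom.ev_app, Hom.ev_app, h]

theorem comp_app {M N P : CoindLim F} (a : M ⟶ N) (b : N ⟶ P) (x : J) :
    Hom.app (a ≫ b) x = Hom.app a x ≫ Hom.app b x := rfl

/-- A morphism whose components are bijective is an isomorphism. -/
theorem isIso_of_bijective {M N : CoindLim F} (a : M ⟶ N)
    (h : ∀ x, Function.Bijective (Hom.app a x).hom) : IsIso a := by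
  have hi : ∀ x, IsIso (Hom.app a x) := fun x =>
    (ConcreteCategory.isIso_iff_bijective _).2 (h x)
  have hc : ∀ x (m : N.obj x), (Hom.app a x).hom ((inv (Hom.app a x)).hom m) = m := fun x m =>
    congrArg (fun b => ModuleCat.Hom.hom b m) (IsIso.inv_hom_id (Hom.app a x))
  refine ⟨homMk (fun x => inv (Hom.app a x)) fun {x y} f m => (h x).1 ?_, ?_, ?_⟩
  · rw [hc, ← Hom.ev_app, hc]
  · exact Hom.ext (funext fun x => IsIso.hom_inv_id (Hom.app a x))
  · exact Hom.ext (funext fun x => IsIso.inv_hom_id (Hom.app a x))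

/-- The components of a morphism are bijective if the one at `x` is, and every object is the target
of an arrow from `x`. -/
theorem bijective_app {M N : CoindLim F} (a : M ⟶ N) {x y : J} (v : x ⟶ y)
    (h : Function.Bijective (Hom.app a x).hom) : Function.Bijective (Hom.app a y).hom := by
  constructor
  · intro m m' e
    refine M.ev_ext v fun s => h.1 ?_
    rw [← Hom.ev_app, ← Hom.ev_app, LinearMap.map_smul, LinearMap.map_smul, e]
  · intro n
    choose φ hφ using fun s : F.obj y => h.2 (N.ev v (s • n))
    obtain ⟨m, hm⟩ := M.exists_ev v (φ := φ)
      ⟨fun s t => h.1 (by rw [map_add, hφ, hφ, hφ, add_smul, map_add]),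
        fun r s => h.1 (by rw [map_smul, hφ, hφ, (N.isCoind_ev v n).map_mul])⟩
    refine ⟨m, N.ev_ext v fun s => ?_⟩
    rw [← map_smul, Hom.ev_app, hm, hφ]

end CoindLim

/-- A description of an object of the inverse limit by a contravariantly functorial family of
semilinear maps `e_f : M_y → M_x` such that `M_y → Hom_{F x}(F y, M_x)`, `m ↦ (s ↦ e_f (s m))`, is
bijective. -/
structure EvaluationData (F : J ⥤ RingCat.{u}) where
  obj : ∀ x : J, ModuleCat.{u} (F.obj x)
  e : ∀ {x y : J} (_ : x ⟶ y), obj y →+ obj x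
  e_smul : ∀ {x y : J} (f : x ⟶ y) (r : F.obj x) (m : obj y),
    e f ((F.map f).hom r • m) = r • e f m
  e_id : ∀ (x : J) (m : obj x), e (𝟙 x) m = m
  e_comp : ∀ {x y z : J} (f : x ⟶ y) (g : y ⟶ z) (m : obj z), e (f ≫ g) m = e f (e g m)
  eq_zero : ∀ {x y : J} (f : x ⟶ y) (m : obj y), (∀ s : F.obj y, e f (s • m) = 0) → m = 0
  exists_e : ∀ {x y : J} (f : x ⟶ y) (φ : F.obj y → obj x), IsCoind (F.map f).hom φ →
    ∃ m : obj y, ∀ s : F.obj y, e f (s • m) = φ s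

namespace EvaluationData

variable (D : EvaluationData F)

/-- The isomorphism `M_y ≅ Hom_{F x}(F y, M_x)`, `m ↦ (s ↦ e_f (s m))`. -/
noncomputable def equiv {x y : J} (f : x ⟶ y) :
    D.obj y ≃ₗ[F.obj y] (ModuleCat.coextendScalars.{u, u, u} (F.map f).hom).obj (D.obj x) :=
  LinearEquiv.ofBijective
    { toFun := fun m => coindMk (F.map f).hom (fun s => D.e f (s • m))
        (fun s t => by rw [add_smul, map_add]) (fun r s => by rw [mul_smul, D.e_smul])
      map_add' := fun m m' => coind_ext _ fun s => by
        rw [coindEval_add, coindEval_mk, coindEval_mk, coindEval_mk, smul_add, map_add]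
      map_smul' := fun t m => coind_ext _ fun s => by
        rw [RingHom.id_apply, coindEval_smul, coindEval_mk, coindEval_mk, mul_smul] }
    ⟨by
      refine (injective_iff_map_eq_zero _).2 fun m hm => D.eq_zero f m fun s => ?_
      exact congrArg (fun φ => coindEval (F.map f).hom φ s) hm,
    fun φ => by
      obtain ⟨m, hm⟩ := D.exists_e f (coindEval (F.map f).hom φ)
        ⟨coindEval_map_add _ φ, coindEval_map_mul _ φ⟩
      exact ⟨m, coind_ext _ hm⟩⟩

theorem coindEval_equiv {x y : J} (f : x ⟶ y) (m : D.obj y) (s : F.obj y) :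
    coindEval (F.map f).hom (D.equiv f m) s = D.e f (s • m) := rfl

/-- The object of the inverse limit with the given evaluation maps. -/
noncomputable def toCoindLim : CoindLim F where
  obj := D.obj
  τ f := (D.equiv f).symm.toModuleIso
  τ_id x := by
    rw [← cancel_epi (D.equiv (𝟙 x)).toModuleIso.hom]
    ext m
    refine Eq.trans ((D.equiv (𝟙 x)).symm_apply_apply m) ?_
    refine Eq.trans ?_ (D.coindEval_equiv (𝟙 x) m 1).symm
    rw [one_smul, D.e_id]
  τ_comp {x y z} f g := by
    have h : ∀ m : D.obj z, (coindCompIso (F.map f).hom (F.map g).hom (F.map (f ≫ g)).hom (by simp)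
        (D.obj x)).hom.hom (((ModuleCat.coextendScalars.{u, u, u} (F.map g).hom).map
          (D.equiv f).toModuleIso.hom).hom (D.equiv g m)) = D.equiv (f ≫ g) m := by
      intro m
      refine coind_ext _ fun s => ?_
      rw [coindEval_equiv, D.e_comp]
      refine Eq.trans (b := D.e f ((1 : F.obj y) • D.e g (s • m))) rfl ?_
      rw [one_smul]
    rw [← cancel_epi ((ModuleCat.coextendScalars.{u, u, u} (F.map g).hom).map
          (D.equiv f).toModuleIso.hom),
      ← cancel_epi (D.equiv g).toModuleIso.hom, ← Functor.map_comp_assoc]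
    have h3 : (D.equiv f).toModuleIso.hom ≫ (D.equiv f).symm.toModuleIso.hom = 𝟙 _ :=
      (D.equiv f).toModuleIso.hom_inv_id
    rw [h3, CategoryTheory.Functor.map_id, Category.id_comp]
    have h4 : (D.equiv g).toModuleIso.hom ≫ (D.equiv g).symm.toModuleIso.hom = 𝟙 _ :=
      (D.equiv g).toModuleIso.hom_inv_id
    rw [h4]
    ext m
    refine Eq.symm ?_
    refine Eq.trans (congrArg (D.equiv (f ≫ g)).symm (h m)) ?_
    exact (D.equiv (f ≫ g)).symm_apply_apply m

theorem toCoindLim_ev {x y : J} (f : x ⟶ y) (m : D.obj y) : D.toCoindLim.ev f m = D.e f m := by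
  refine Eq.trans (D.coindEval_equiv f m 1) ?_
  rw [one_smul]

end EvaluationData

namespace CoindLim

theorem restrict_ev {I : Type} [SmallCategory I] (G : I ⥤ J) (M : CoindLim F) {x y : I}
    (f : x ⟶ y) (m : M.obj (G.obj y)) :
    ((restrict G F).obj M).ev f m = M.ev (G.map f) m := rfl

end CoindLim

end EvaluationMaps

/-! ### Vertices, edges and triangles in the cyclic category -/

namespace CyclicCat

open SimplexCategory (δ)

theorem homMk_eq_homMk {m n : ℕ} {f g : Lift m n} (q : ℤ)
    (h : ∀ i, g.toFun i = f.toFun i + (n + 1) * q) :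
    (homMk f : CyclicCat.mk m ⟶ CyclicCat.mk n) = homMk g :=
  Quotient.sound ⟨q, h⟩

theorem ofSimplex_map_eq {x y : SimplexCategory} (f : x ⟶ y) (g : Lift x.len y.len)
    (h : ∀ a : Fin (x.len + 1), g.toFun ((a : ℕ) : ℤ) = ((f.toOrderHom a : ℕ) : ℤ)) :
    ofSimplex.map f = homMk g := by
  refine congrArg (Quotient.mk _) (Lift.ext_period fun a => ?_)
  have := Lift.ofOrderHom_apply f.toOrderHom a 0
  simp only [mul_zero, add_zero] at this
  rw [this, h]

/-- The rotation of `[1]`. -/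
def rotation : ofSimplex.obj simplexOne ⟶ ofSimplex.obj simplexOne :=
  homMk (x := ⟨1⟩) (y := ⟨1⟩)
    { toFun := fun i => i + 1
      mono := fun i j h => by dsimp only; omega
      period := fun i => by push_cast; ring }

/-- The triangle `0 ≤ 1 ≤ 2` in `[1]`, whose long edge winds once around. -/
def triangle : ofSimplex.obj (SimplexCategory.mk 2) ⟶ ofSimplex.obj simplexOne :=
  homMk (x := ⟨2⟩) (y := ⟨1⟩)
    { toFun := fun i => i - i / 3
      mono := fun i j h => by dsimp only; omega
      period := fun i => by push_cast; omega }

/-- The extra degeneracy, with its source and target written as images of simplices. -/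
def extra : ofSimplex.obj simplexOne ⟶ ofSimplex.obj simplexZero := extraDegeneracy

theorem δ_extra (i : Fin 2) :
    ofSimplex.map (δ (n := 0) i) ≫ extra = 𝟙 (ofSimplex.obj simplexZero) :=
  δ_extraDegeneracy i

theorem map_δ_zero : ofSimplex.map (δ (n := 0) 0) = homMk (x := ⟨0⟩) (y := ⟨1⟩)
    { toFun := fun i => 2 * i + 1
      mono := fun i j h => by dsimp only; omega
      period := fun i => by push_cast; ring } :=
  ofSimplex_map_eq _ _ fun a => by fin_cases a; rfl

theorem map_δ_one : ofSimplex.map (δ (n := 0) 1) = homMk (x := ⟨0⟩) (y := ⟨1⟩)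
    { toFun := fun i => 2 * i
      mono := fun i j h => by dsimp only; omega
      period := fun i => by push_cast; ring } :=
  ofSimplex_map_eq _ _ fun a => by fin_cases a; rfl

theorem map_δ_zero' : ofSimplex.map (δ (n := 1) 0) = homMk (x := ⟨1⟩) (y := ⟨2⟩)
    { toFun := fun i => i + i / 2 + 1
      mono := fun i j h => by dsimp only; omega
      period := fun i => by push_cast; omega } :=
  ofSimplex_map_eq _ _ fun a => by fin_cases a <;> rfl

theorem map_δ_one' : ofSimplex.map (δ (n := 1) 1) = homMk (x := ⟨1⟩) (y := ⟨2⟩)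
    { toFun := fun i => i + (i + 1) / 2
      mono := fun i j h => by dsimp only; omega
      period := fun i => by push_cast; omega } :=
  ofSimplex_map_eq _ _ fun a => by fin_cases a <;> rfl

theorem map_δ_two' : ofSimplex.map (δ (n := 1) 2) = homMk (x := ⟨1⟩) (y := ⟨2⟩)
    { toFun := fun i => i + i / 2
      mono := fun i j h => by dsimp only; omega
      period := fun i => by push_cast; omega } :=
  ofSimplex_map_eq _ _ fun a => by fin_cases a <;> rfl

theorem δ_zero_rotation :
    ofSimplex.map (δ (n := 0) 0) ≫ rotation = ofSimplex.map (δ (n := 0) 1) := by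
  rw [map_δ_zero, map_δ_one]
  exact homMk_eq_homMk (-1) fun i => by simp only [Lift.comp]; push_cast; ring

theorem δ_one_rotation :
    ofSimplex.map (δ (n := 0) 1) ≫ rotation = ofSimplex.map (δ (n := 0) 0) := by
  rw [map_δ_zero, map_δ_one]
  exact homMk_eq_homMk 0 fun i => by simp only [Lift.comp]; push_cast; ring

theorem rotation_rotation : rotation ≫ rotation = 𝟙 _ :=
  homMk_eq_homMk (-1) fun i => by simp only [Lift.comp, Lift.id]; push_cast; ring

theorem δ_two_triangle : ofSimplex.map (δ (n := 1) 2) ≫ triangle = 𝟙 _ := by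
  rw [map_δ_two']
  exact homMk_eq_homMk 0 fun i => by simp only [Lift.comp, Lift.id]; push_cast; omega

theorem δ_zero_triangle : ofSimplex.map (δ (n := 1) 0) ≫ triangle = rotation := by
  rw [map_δ_zero']
  exact homMk_eq_homMk 0 fun i => by simp only [Lift.comp]; push_cast; omega

theorem δ_one_triangle :
    ofSimplex.map (δ (n := 1) 1) ≫ triangle = extra ≫ ofSimplex.map (δ (n := 0) 1) := by
  rw [map_δ_one', map_δ_one]
  exact homMk_eq_homMk 0 fun i => by simp only [Lift.comp]; push_cast; omega

theorem eq_of_map_eq {y : SimplexCategory} {v w : simplexZero ⟶ y}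
    (h : ofSimplex.map v = ofSimplex.map w) : v = w := by
  obtain ⟨q, hq⟩ := Quotient.exact h
  have h1 := hq 0
  have h2 := Lift.ofOrderHom_apply v.toOrderHom 0 0
  have h3 := Lift.ofOrderHom_apply w.toOrderHom 0 0
  simp only [Fin.val_zero, Nat.cast_zero, mul_zero, add_zero] at h2 h3
  refine SimplexCategory.Hom.ext_zero_left _ _ (Fin.ext ?_)
  have h4 := (v.toOrderHom 0).is_lt
  have h5 := (w.toOrderHom 0).is_lt
  have h6 : q = 0 := by
    have e : ((w.toOrderHom 0 : ℕ) : ℤ) = (v.toOrderHom 0 : ℕ) + (y.len + 1) * q := by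
      rw [← h2, ← h3]; exact h1
    rcases lt_trichotomy q 0 with hq | hq | hq
    · nlinarith
    · exact hq
    · nlinarith
  subst h6
  have e : ((w.toOrderHom 0 : ℕ) : ℤ) = (v.toOrderHom 0 : ℕ) := by
    rw [← h2, ← h3]
    exact h1.trans (by ring)
  exact_mod_cast e.symm

/-- Every morphism of `Λ` has a representative that maps `0` into `{0, …, n}`. -/
theorem exists_lift {m n : ℕ} (f : CyclicCat.mk m ⟶ CyclicCat.mk n) :
    ∃ g : Lift m n, homMk g = f ∧ 0 ≤ g.toFun 0 ∧ g.toFun 0 ≤ n := by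
  induction f using Quotient.inductionOn with
  | h f =>
    have hn : (0 : ℤ) < n + 1 := by positivity
    refine ⟨⟨fun i => f.toFun i + (n + 1) * (-(f.toFun 0 / (n + 1))),
      fun i j h => by dsimp only; linarith [f.mono h],
      fun i => by dsimp only; rw [f.period]; ring⟩,
      homMk_eq_homMk (f.toFun 0 / (n + 1)) fun i => by dsimp only; ring, ?_, ?_⟩
    · have := Int.emod_nonneg (f.toFun 0) hn.ne'
      have := Int.emod_add_mul_ediv (f.toFun 0) (n + 1)
      dsimp only
      linarith
    · have := Int.emod_lt_of_pos (f.toFun 0) hn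
      have := Int.emod_add_mul_ediv (f.toFun 0) (n + 1)
      dsimp only
      linarith

theorem exists_map_vertex {y : SimplexCategory} (u : ofSimplex.obj simplexZero ⟶ ofSimplex.obj y) :
    ∃ v : simplexZero ⟶ y, ofSimplex.map v = u := by
  obtain ⟨g, hg, h0, h1⟩ := exists_lift (m := 0) (n := y.len) u
  refine ⟨SimplexCategory.const _ _ ⟨(g.toFun 0).toNat, by omega⟩, ?_⟩
  rw [← hg]
  refine ofSimplex_map_eq _ _ fun a => ?_
  fin_cases a
  simpa using h0

/-- An edge of `[n]` in `Λ` either comes from the simplex category, or becomes an edge of the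
simplex category when it is replaced by the complementary arc of the circle. -/
theorem exists_map_edge {y : SimplexCategory} (h : ofSimplex.obj simplexOne ⟶ ofSimplex.obj y) :
    ∃ g : simplexOne ⟶ y, h = ofSimplex.map g ∨ h = rotation ≫ ofSimplex.map g := by
  obtain ⟨f, rfl, h0, h1⟩ := exists_lift (m := 1) (n := y.len) h
  have h2 : f.toFun 0 ≤ f.toFun 1 := f.mono (by omega)
  have h3 : f.toFun 1 ≤ f.toFun 0 + (y.len + 1) := by
    rw [← f.period]
    exact f.mono (by simp)
  have key : ∀ i : ℤ, f.toFun (2 * i) = f.toFun 0 + (y.len + 1) * i ∧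
      f.toFun (2 * i + 1) = f.toFun 1 + (y.len + 1) * i := by
    intro i
    rw [← f.period_mul, ← f.period_mul]
    constructor <;> congr 1 <;> push_cast <;> ring
  by_cases hb : f.toFun 1 ≤ y.len
  · refine ⟨SimplexCategory.mkOfLe (n := y.len) ⟨(f.toFun 0).toNat, by omega⟩
      ⟨(f.toFun 1).toNat, by omega⟩ (by simp only [Fin.mk_le_mk]; omega), Or.inl ?_⟩
    refine (ofSimplex_map_eq _ f fun a => ?_).symm
    fin_cases a
    · refine Eq.trans ?_ (Int.toNat_of_nonneg h0).symm
      rfl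
    · refine Eq.trans ?_ (Int.toNat_of_nonneg (h0.trans h2)).symm
      rfl
  · push Not at hb
    have h4 : 0 ≤ f.toFun 1 - (y.len + 1) := by omega
    refine ⟨SimplexCategory.mkOfLe (n := y.len) ⟨(f.toFun 1 - (y.len + 1)).toNat, by omega⟩
      ⟨(f.toFun 0).toNat, by omega⟩ (by simp only [Fin.mk_le_mk]; omega), Or.inr ?_⟩
    rw [ofSimplex_map_eq _ (Lift.mk (fun i => f.toFun (i - 1)) (fun i j h => f.mono (by omega))
      (fun i => by dsimp only; rw [← f.period]; congr 1; ring)) ?_]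
    · exact homMk_eq_homMk 0 fun i => by simp only [Lift.comp]; simp
    · intro a
      fin_cases a
      · refine Eq.trans ?_ (Int.toNat_of_nonneg h4).symm
        have := (key (-1)).2
        norm_num at this
        norm_num
        rw [this]; ring
      · refine Eq.trans ?_ (Int.toNat_of_nonneg h0).symm
        simp

/-- Every vertex of a simplex is joined by an edge to the last one. -/
theorem exists_edge_last {x : SimplexCategory} (v : simplexZero ⟶ x) :
    ∃ g : simplexOne ⟶ x, δ (n := 0) 1 ≫ g = v ∧
      δ (n := 0) 0 ≫ g = SimplexCategory.const simplexZero x (Fin.last _) :=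
  ⟨SimplexCategory.mkOfLe (n := x.len) (v.toOrderHom 0) (Fin.last _) (Fin.le_last _),
    SimplexCategory.Hom.ext_zero_left _ _, SimplexCategory.Hom.ext_zero_left _ _⟩

end CyclicCat

/-! ### Transport along edges of the cyclic category -/

namespace CoindLim

open CyclicCat
open SimplexCategory (δ)

variable {F : CyclicCat ⥤ RingCat.{u}}

/-- The ring map of a morphism of `Λ` between simplices. -/
def ringMap (F : CyclicCat ⥤ RingCat.{u}) {x y : SimplexCategory}
    (g : ofSimplex.obj x ⟶ ofSimplex.obj y) :
    (ofSimplex ⋙ F).obj x →+* (ofSimplex ⋙ F).obj y :=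
  (F.map g).hom

theorem ringMap_comp {x y z : SimplexCategory} (f : ofSimplex.obj x ⟶ ofSimplex.obj y)
    (g : ofSimplex.obj y ⟶ ofSimplex.obj z) :
    ringMap F (f ≫ g) = (ringMap F g).comp (ringMap F f) :=
  congrArg RingCat.Hom.hom (F.map_comp f g)

theorem ringMap_comp_apply {x y z : SimplexCategory} (f : ofSimplex.obj x ⟶ ofSimplex.obj y)
    (g : ofSimplex.obj y ⟶ ofSimplex.obj z) (s) :
    ringMap F (f ≫ g) s = ringMap F g (ringMap F f s) := by
  rw [ringMap_comp]; rfl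

theorem ringMap_id {x : SimplexCategory} (s) : ringMap F (𝟙 (ofSimplex.obj x)) s = s :=
  congrArg (fun f => RingCat.Hom.hom f s) (F.map_id (ofSimplex.obj x))

section Transport

variable (M : CoindLim (ofSimplex ⋙ F))

open Classical in
/-- The map `Hom_{F[0]}(F[1], M₀) → M₀`, `φ ↦ τ(φ)(1)`, where `τ : δ₀_* M₀ ≅ δ₁_* M₀`; it is
extended by `0` to functions that are not semilinear. -/
noncomputable def contract (φ : (ofSimplex ⋙ F).obj simplexOne → M.obj simplexZero) :
    M.obj simplexZero :=
  if h : ∃ m : M.obj simplexOne, ∀ s : (ofSimplex ⋙ F).obj simplexOne,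
      M.ev (δ (n := 0) 0) (s • m) = φ s
  then M.ev (δ (n := 0) 1) h.choose else 0

variable {M}

theorem contract_eq {φ : (ofSimplex ⋙ F).obj simplexOne → M.obj simplexZero}
    (m : M.obj simplexOne)
    (hm : ∀ s : (ofSimplex ⋙ F).obj simplexOne, M.ev (δ (n := 0) 0) (s • m) = φ s) :
    M.contract φ = M.ev (δ (n := 0) 1) m := by
  have h : ∃ m : M.obj simplexOne, ∀ s : (ofSimplex ⋙ F).obj simplexOne,
      M.ev (δ (n := 0) 0) (s • m) = φ s := ⟨m, hm⟩
  rw [contract, dif_pos h]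
  congr 1
  exact M.ev_ext _ fun s => by rw [h.choose_spec, hm]

variable (M)

/-- Transport along an edge `g` of `Λ` with source `a` and target `b`: it maps `Hom(F x, M₀)`, with
`F[0]` acting on `F x` through `b`, to the same with `a` in place of `b`. It is the base change
along `g` of the isomorphism `τ : δ₀_* M₀ ≅ δ₁_* M₀`. -/
noncomputable def transport {x : SimplexCategory} (g : ofSimplex.obj simplexOne ⟶ ofSimplex.obj x)
    (ψ : (ofSimplex ⋙ F).obj x → M.obj simplexZero) (s : (ofSimplex ⋙ F).obj x) :
    M.obj simplexZero :=
  M.contract fun t => ψ (ringMap F g t * s)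

variable {M}

theorem transport_map {x : SimplexCategory} (g : simplexOne ⟶ x) (m : M.obj x)
    (s : (ofSimplex ⋙ F).obj x) :
    M.transport (ofSimplex.map g) (fun r => M.ev (δ (n := 0) 0 ≫ g) (r • m)) s =
      M.ev (δ (n := 0) 1 ≫ g) (s • m) := by
  rw [ev_comp]
  refine contract_eq _ fun t => ?_
  dsimp only
  rw [ev_comp, mul_smul, ← ev_map_smul]
  rfl

/-- The cocycle condition: transport around a triangle is transitive. -/
theorem transport_transport {x : SimplexCategory}
    (t : ofSimplex.obj (SimplexCategory.mk 2) ⟶ ofSimplex.obj x)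
    {ψ : (ofSimplex ⋙ F).obj x → M.obj simplexZero}
    (hψ : IsCoind (ringMap F (ofSimplex.map (δ (n := 0) 0 ≫ δ (n := 1) 0) ≫ t)) ψ) :
    M.transport (ofSimplex.map (δ (n := 1) 2) ≫ t)
        (M.transport (ofSimplex.map (δ (n := 1) 0) ≫ t) ψ) =
      M.transport (ofSimplex.map (δ (n := 1) 1) ≫ t) ψ := by
  have e1 : δ (n := 0) 0 ≫ δ (n := 1) 0 = δ (n := 0) 0 ≫ δ (n := 1) 1 :=
    SimplexCategory.Hom.ext_zero_left _ _
  have e2 : δ (n := 0) 0 ≫ δ (n := 1) 2 = δ (n := 0) 1 ≫ δ (n := 1) 0 :=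
    SimplexCategory.Hom.ext_zero_left _ _
  have e3 : δ (n := 0) 1 ≫ δ (n := 1) 2 = δ (n := 0) 1 ≫ δ (n := 1) 1 :=
    SimplexCategory.Hom.ext_zero_left _ _
  funext s
  rw [ringMap_comp] at hψ
  obtain ⟨m, hm⟩ := M.exists_ev (δ (n := 0) 0 ≫ δ (n := 1) 0) (hψ.mul_right s).comp
  have h1 : M.transport (ofSimplex.map (δ (n := 1) 1) ≫ t) ψ s =
      M.ev (δ (n := 0) 1) (M.ev (δ (n := 1) 1) m) := by
    refine contract_eq _ fun r => ?_
    rw [← ev_map_smul, ← ev_comp, ← e1, hm, ringMap_comp_apply]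
    rfl
  have h0 : ∀ r, M.transport (ofSimplex.map (δ (n := 1) 0) ≫ t) ψ (ringMap F t r * s) =
      M.ev (δ (n := 0) 1) (M.ev (δ (n := 1) 0) (r • m)) := by
    intro r
    refine contract_eq _ fun r' => ?_
    rw [← ev_map_smul, ← ev_comp, smul_smul, hm, ringMap_comp_apply, map_mul, mul_assoc]
    rfl
  rw [h1, ← ev_comp, ← e3, ev_comp]
  refine contract_eq _ fun r => ?_
  rw [ringMap_comp_apply, h0, ← ev_map_smul, ← ev_comp, e2, ev_comp]
  rfl

variable (M)

theorem isCoind_extra (m : M.obj simplexZero) (i : Fin 2) :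
    IsCoind ((ofSimplex ⋙ F).map (δ (n := 0) i)).hom
      fun s : (ofSimplex ⋙ F).obj simplexOne => ringMap F extra s • m := by
  refine ⟨fun s t => by rw [map_add, add_smul], fun r s => ?_⟩
  have h : ringMap F extra (((ofSimplex ⋙ F).map (δ (n := 0) i)).hom r) = r := by
    refine (ringMap_comp_apply (ofSimplex.map (δ (n := 0) i)) extra r).symm.trans ?_
    rw [δ_extra, ringMap_id]
  rw [map_mul, h, mul_smul]

/-- The monodromy `ς : M₀ → M₀`: the transport along the edge of `[0]` in `Λ` that winds once
around. -/
noncomputable def monodromy : M.obj simplexZero →ₗ[(ofSimplex ⋙ F).obj simplexZero]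
    M.obj simplexZero where
  toFun m := M.contract fun s => ringMap F extra s • m
  map_add' m m' := by
    obtain ⟨a, ha⟩ := M.exists_ev _ (M.isCoind_extra m 0)
    obtain ⟨b, hb⟩ := M.exists_ev _ (M.isCoind_extra m' 0)
    rw [contract_eq a ha, contract_eq b hb, contract_eq (a + b), map_add]
    intro s
    rw [smul_add, smul_add, map_add, ha, hb]
  map_smul' r m := by
    obtain ⟨a, ha⟩ := M.exists_ev _ (M.isCoind_extra m 0)
    rw [contract_eq a ha, RingHom.id_apply, ← ev_map_smul, contract_eq]
    intro s
    rw [smul_smul, ha, map_mul, mul_smul]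
    congr 1
    refine (ringMap_comp_apply (ofSimplex.map (δ (n := 0) 1)) extra r).symm.trans ?_ ▸ rfl
    rw [δ_extra, ringMap_id]

variable {M}

theorem monodromy_eq {m : M.obj simplexZero} (a : M.obj simplexOne)
    (h : ∀ s : (ofSimplex ⋙ F).obj simplexOne,
      M.ev (δ (n := 0) 0) (s • a) = ringMap F extra s • m) :
    M.monodromy m = M.ev (δ (n := 0) 1) a :=
  contract_eq a h

theorem transport_extra {x : SimplexCategory} (v : ofSimplex.obj simplexZero ⟶ ofSimplex.obj x)
    {ψ : (ofSimplex ⋙ F).obj x → M.obj simplexZero} (hψ : IsCoind (ringMap F v) ψ) :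
    M.transport (extra ≫ v) ψ = fun s => M.monodromy (ψ s) := by
  funext s
  refine congrArg M.contract (funext fun t => ?_)
  rw [ringMap_comp_apply, hψ.map_mul]

/-- Transport along an edge after transport along the complementary arc is the monodromy. -/
theorem transport_rotation {x : SimplexCategory} (g : ofSimplex.obj simplexOne ⟶ ofSimplex.obj x)
    {ψ : (ofSimplex ⋙ F).obj x → M.obj simplexZero}
    (hψ : IsCoind (ringMap F (ofSimplex.map (δ (n := 0) 1) ≫ g)) ψ) :
    M.transport g (M.transport (rotation ≫ g) ψ) = fun s => M.monodromy (ψ s) := by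
  have h := transport_transport (M := M) (triangle ≫ g) (ψ := ψ) (by
    rw [Functor.map_comp, Category.assoc, ← Category.assoc (ofSimplex.map (δ (n := 1) 0)),
      δ_zero_triangle, ← Category.assoc, δ_zero_rotation]
    exact hψ)
  simp only [← Category.assoc] at h
  rw [δ_two_triangle, δ_zero_triangle, δ_one_triangle, Category.id_comp, Category.assoc,
    transport_extra _ hψ] at h
  exact h

theorem transport_rotation' {x : SimplexCategory} (g : ofSimplex.obj simplexOne ⟶ ofSimplex.obj x)
    {ψ : (ofSimplex ⋙ F).obj x → M.obj simplexZero}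
    (hψ : IsCoind (ringMap F (ofSimplex.map (δ (n := 0) 0) ≫ g)) ψ) :
    M.transport (rotation ≫ g) (M.transport g ψ) = fun s => M.monodromy (ψ s) := by
  have h := transport_rotation (M := M) (rotation ≫ g) (ψ := ψ)
    (by rwa [← Category.assoc, δ_one_rotation])
  rwa [← Category.assoc, rotation_rotation, Category.id_comp] at h

/-- A family of semilinear functions on `F x`, one for every vertex of the simplex `x`, that is
compatible with transport along the edges comes from an element of `M x`. -/
theorem exists_of_vertices {x : SimplexCategory}
    (χ : (simplexZero ⟶ x) → (ofSimplex ⋙ F).obj x → M.obj simplexZero)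
    (h : ∀ v, IsCoind (ringMap F (ofSimplex.map v)) (χ v))
    (ht : ∀ g : simplexOne ⟶ x,
      M.transport (ofSimplex.map g) (χ (δ (n := 0) 0 ≫ g)) = χ (δ (n := 0) 1 ≫ g)) :
    ∃ w : M.obj x, ∀ v (s : (ofSimplex ⋙ F).obj x), M.ev v (s • w) = χ v s := by
  obtain ⟨w, hw⟩ := M.exists_ev _ (h (SimplexCategory.const simplexZero x (Fin.last _)))
  refine ⟨w, fun v s => ?_⟩
  obtain ⟨g, rfl, hg⟩ := exists_edge_last v
  rw [← transport_map, ← ht, hg]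
  congr 1
  exact funext hw

theorem isCoind_ev' {x : SimplexCategory} (v : simplexZero ⟶ x) (m : M.obj x) :
    IsCoind (ringMap F (ofSimplex.map v)) fun s : (ofSimplex ⋙ F).obj x => M.ev v (s • m) :=
  M.isCoind_ev v m

/-! ### The automorphism `ς` of the identity functor -/

/-- Since the monodromy commutes with transport along every edge of `x`, it acts on `M x`. -/
theorem exists_monodromy {x : SimplexCategory} (m : M.obj x) :
    ∃ w : M.obj x, ∀ v : simplexZero ⟶ x, ∀ s : (ofSimplex ⋙ F).obj x,
      M.ev v (s • w) = M.monodromy (M.ev v (s • m)) := by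
  refine exists_of_vertices (fun v s => M.monodromy (M.ev v (s • m)))
    (fun v => (isCoind_ev' v m).linear_comp _) fun g => ?_
  have h0 := isCoind_ev' (δ (n := 0) 0 ≫ g) m
  have h1 := isCoind_ev' (δ (n := 0) 1 ≫ g) m
  rw [Functor.map_comp] at h0 h1
  have e0 := transport_rotation' (ofSimplex.map g) h0
  have e1 := transport_rotation (ofSimplex.map g) h1
  rw [funext (transport_map g m)] at e0
  rw [e0] at e1
  exact e1

/-- The component of `ς` at `x`. -/
noncomputable def monodromyApp (M : CoindLim (ofSimplex ⋙ F)) (x : SimplexCategory) :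
    M.obj x →ₗ[(ofSimplex ⋙ F).obj x] M.obj x where
  toFun m := (exists_monodromy m).choose
  map_add' m m' := by
    refine M.ev_ext (SimplexCategory.const simplexZero x 0) fun s => ?_
    rw [smul_add, map_add, (exists_monodromy _).choose_spec, (exists_monodromy _).choose_spec,
      (exists_monodromy _).choose_spec, smul_add, map_add, map_add]
  map_smul' r m := by
    refine M.ev_ext (SimplexCategory.const simplexZero x 0) fun s => ?_
    rw [RingHom.id_apply, smul_smul, (exists_monodromy _).choose_spec,
      (exists_monodromy _).choose_spec, smul_smul]

theorem ev_monodromyApp {x : SimplexCategory} (v : simplexZero ⟶ x) (m : M.obj x) :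
    M.ev v (M.monodromyApp x m) = M.monodromy (M.ev v m) := by
  have := (exists_monodromy m).choose_spec v 1
  rwa [one_smul, one_smul] at this

/-- `ς` as an endomorphism of `M`. -/
noncomputable def monodromyHom (M : CoindLim (ofSimplex ⋙ F)) : M ⟶ M :=
  homMk (fun x => ModuleCat.ofHom (M.monodromyApp x)) fun {x y} f m => by
    refine M.ev_ext (SimplexCategory.const simplexZero x 0) fun s => ?_
    simp only [ModuleCat.hom_ofHom]
    rw [← ev_map_smul, ← ev_comp, ← LinearMap.map_smul, ← LinearMap.map_smul, ev_monodromyApp,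
      ev_monodromyApp, ev_comp, ev_map_smul]

theorem monodromyHom_app_zero (m : M.obj simplexZero) :
    (Hom.app M.monodromyHom simplexZero).hom m = M.monodromy m := by
  have := ev_monodromyApp (𝟙 simplexZero) m
  rwa [ev_id, ev_id] at this

theorem monodromy_naturality {N : CoindLim (ofSimplex ⋙ F)} (a : M ⟶ N) (m : M.obj simplexZero) :
    N.monodromy ((Hom.app a simplexZero).hom m) = (Hom.app a simplexZero).hom (M.monodromy m) := by
  obtain ⟨b, hb⟩ := M.exists_ev _ (M.isCoind_extra m 0)
  rw [monodromy_eq b hb, ← Hom.ev_app]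
  refine monodromy_eq _ fun s => ?_
  rw [← LinearMap.map_smul, Hom.ev_app, hb, LinearMap.map_smul]

theorem monodromyHom_naturality {N : CoindLim (ofSimplex ⋙ F)} (a : M ⟶ N) :
    a ≫ N.monodromyHom = M.monodromyHom ≫ a := by
  refine hom_ext_of_app simplexZero (fun y => SimplexCategory.const _ y 0) fun m => ?_
  simp only [comp_app, ModuleCat.hom_comp, LinearMap.comp_apply]
  rw [monodromyHom_app_zero, monodromyHom_app_zero, monodromy_naturality]

/-- If the element `a` of `M₁` corresponds under one face to a function that factors through the
extra degeneracy, then so it does under the other face. -/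
theorem ev_smul_of_extra {m : M.obj simplexZero} {a : M.obj simplexOne} {i : Fin 2}
    (h : ∀ s : (ofSimplex ⋙ F).obj simplexOne, M.ev (δ (n := 0) i) (s • a) = ringMap F extra s • m)
    (j : Fin 2) (s : (ofSimplex ⋙ F).obj simplexOne) :
    M.ev (δ (n := 0) j) (s • a) = ringMap F extra s • M.ev (δ (n := 0) j) a := by
  have e : s • a = ((ofSimplex ⋙ F).map (δ (n := 0) j)).hom (ringMap F extra s) • a := by
    refine M.ev_ext (δ (n := 0) i) fun t => ?_
    have h1 : ringMap F extra
        (((ofSimplex ⋙ F).map (δ (n := 0) j)).hom (ringMap F extra s)) = ringMap F extra s := by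
      refine (ringMap_comp_apply (ofSimplex.map (δ (n := 0) j)) extra _).symm.trans ?_
      rw [δ_extra, ringMap_id]
    rw [smul_smul, smul_smul, h, h, map_mul, map_mul, h1]
  rw [e, ev_map_smul]

theorem monodromy_bijective (M : CoindLim (ofSimplex ⋙ F)) : Function.Bijective M.monodromy := by
  constructor
  · intro m m' h
    obtain ⟨a, ha⟩ := M.exists_ev _ (M.isCoind_extra m 0)
    obtain ⟨b, hb⟩ := M.exists_ev _ (M.isCoind_extra m' 0)
    rw [monodromy_eq a ha, monodromy_eq b hb] at h
    have e : a = b := M.ev_ext (δ (n := 0) 1) fun s => by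
      rw [ev_smul_of_extra ha, ev_smul_of_extra hb, h]
    have h1 := ha 1
    rwa [e, hb, map_one, one_smul, one_smul, eq_comm] at h1
  · intro m
    obtain ⟨a, ha⟩ := M.exists_ev _ (M.isCoind_extra m 1)
    refine ⟨M.ev (δ (n := 0) 0) a, ?_⟩
    have h1 := ha 1
    rw [one_smul, map_one, one_smul] at h1
    rw [monodromy_eq a (ev_smul_of_extra ha 0), h1]

theorem isIso_monodromyHom (M : CoindLim (ofSimplex ⋙ F)) : IsIso M.monodromyHom :=
  isIso_of_bijective _ fun x => bijective_app _ (SimplexCategory.const simplexZero x 0) (by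
    rw [show ⇑(Hom.app M.monodromyHom simplexZero).hom = M.monodromy from
      funext monodromyHom_app_zero]
    exact M.monodromy_bijective)

/-- The automorphism `ς` of the identity functor. -/
noncomputable def monodromyIso (F : CyclicCat ⥤ RingCat.{u}) :
    𝟭 (CoindLim (ofSimplex ⋙ F)) ≅ 𝟭 (CoindLim (ofSimplex ⋙ F)) :=
  NatIso.ofComponents (fun M => @asIso _ _ _ _ M.monodromyHom M.isIso_monodromyHom)
    fun a => monodromyHom_naturality a

end Transport

end CoindLim

/-! ### The inverse limit over the cyclic category inside the one over the simplex category -/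

namespace CoindLim

open CyclicCat
open SimplexCategory (δ)

variable {F : CyclicCat ⥤ RingCat.{u}}

/-- The vertex of the simplex category that represents a vertex of `Λ`. -/
noncomputable def vertex {x : SimplexCategory} (u : ofSimplex.obj simplexZero ⟶ ofSimplex.obj x) :
    simplexZero ⟶ x :=
  (exists_map_vertex u).choose

theorem map_vertex {x : SimplexCategory} (u : ofSimplex.obj simplexZero ⟶ ofSimplex.obj x) :
    ofSimplex.map (vertex u) = u :=
  (exists_map_vertex u).choose_spec

theorem vertex_map {x : SimplexCategory} (v : simplexZero ⟶ x) : vertex (ofSimplex.map v) = v :=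
  eq_of_map_eq (map_vertex _)

theorem restrict_ev_vertex (N : CoindLim F) {x : SimplexCategory}
    (u : ofSimplex.obj simplexZero ⟶ ofSimplex.obj x) (m : N.obj (ofSimplex.obj x)) :
    ((restrict ofSimplex F).obj N).ev (vertex u) m = N.ev u m := by
  refine (restrict_ev ofSimplex N (vertex u) m).trans ?_
  rw [map_vertex]

theorem restrict_faithful : (restrict ofSimplex F).Faithful where
  map_injective {M N a b} h := by
    refine hom_ext fun x m => ?_
    exact congrArg (fun c => (Hom.app c (SimplexCategory.mk x.len)).hom m) h

/-- A map commutes with all evaluations if it commutes with those at vertices, and every vertex of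
`Λ` comes from the simplex category. -/
theorem restrict_full : (restrict ofSimplex F).Full where
  map_surjective {M N} a := by
    refine ⟨homMk (fun x => Hom.app a (SimplexCategory.mk x.len)) fun {x y} f m => ?_, rfl⟩
    let v : ofSimplex.obj simplexZero ⟶ x :=
      ofSimplex.map (SimplexCategory.const simplexZero (SimplexCategory.mk x.len) 0)
    have hv : ∀ {z : CyclicCat} (u : ofSimplex.obj simplexZero ⟶ z) (n : M.obj z),
        N.ev u ((Hom.app a (SimplexCategory.mk z.len)).hom n) =
          (Hom.app a simplexZero).hom (M.ev u n) := by
      intro z u n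
      have := Hom.ev_app a (x := simplexZero) (y := SimplexCategory.mk z.len) (vertex u) n
      exact (restrict_ev_vertex N (x := SimplexCategory.mk z.len) u _).symm.trans
        (this.trans (congrArg _ (restrict_ev_vertex M (x := SimplexCategory.mk z.len) u n)))
    refine N.ev_ext v fun s => ?_
    refine (congrArg (N.ev v) (N.ev_map_smul f s _)).symm.trans ?_
    refine (N.ev_comp v f _).symm.trans ?_
    refine (congrArg (N.ev (v ≫ f)) ((Hom.app a (SimplexCategory.mk y.len)).hom.map_smul
      ((F.map f).hom s) m).symm).trans ?_
    refine (hv (v ≫ f) _).trans ?_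
    refine (congrArg _ ((M.ev_comp v f _).trans (congrArg _ (M.ev_map_smul f s m)))).trans ?_
    refine (hv v _).symm.trans (congrArg (N.ev v) ?_)
    exact (Hom.app a (SimplexCategory.mk x.len)).hom.map_smul s (M.ev f m)

/-- The monodromy of an object that comes from the cyclic category is trivial. -/
theorem monodromy_restrict (N : CoindLim F) (m) :
    ((restrict ofSimplex F).obj N).monodromy m = m := by
  have h : ∀ i : Fin 2, ∀ m,
      ((restrict ofSimplex F).obj N).ev (δ (n := 0) i) (N.ev extra m) = m := by
    intro i m
    refine (N.ev_comp (ofSimplex.map (δ (n := 0) i)) extra m).symm.trans ?_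
    rw [δ_extra, ev_id]
  refine (monodromy_eq (M := (restrict ofSimplex F).obj N) (N.ev extra m) fun s => ?_).trans (h 1 m)
  exact (congrArg _ (N.ev_map_smul extra s m).symm).trans (h 0 _)

section Cyclic

variable {M : CoindLim (ofSimplex ⋙ F)}

/-- The function on `F x` that corresponds to `m` under evaluation at a vertex of `Λ`. -/
noncomputable def vertexEval {x : SimplexCategory}
    (u : ofSimplex.obj simplexZero ⟶ ofSimplex.obj x) (m : M.obj x)
    (s : (ofSimplex ⋙ F).obj x) : M.obj simplexZero :=
  M.ev (vertex u) (s • m)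

theorem vertexEval_map {x : SimplexCategory} (v : simplexZero ⟶ x) (m : M.obj x)
    (s : (ofSimplex ⋙ F).obj x) : vertexEval (ofSimplex.map v) m s = M.ev v (s • m) := by
  rw [vertexEval, vertex_map]

theorem isCoind_vertexEval {x : SimplexCategory}
    (u : ofSimplex.obj simplexZero ⟶ ofSimplex.obj x) (m : M.obj x) :
    IsCoind (ringMap F u) (vertexEval u m) := by
  have := isCoind_ev' (vertex u) m
  rwa [map_vertex] at this

/-- If the monodromy is trivial, then transport along every edge of `Λ` is compatible with
evaluation at the vertices. -/
theorem transport_vertexEval (hM : ∀ m, M.monodromy m = m) {x : SimplexCategory}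
    (h : ofSimplex.obj simplexOne ⟶ ofSimplex.obj x) (m : M.obj x) :
    M.transport h (vertexEval (ofSimplex.map (δ (n := 0) 0) ≫ h) m) =
      vertexEval (ofSimplex.map (δ (n := 0) 1) ≫ h) m := by
  have key : ∀ g : simplexOne ⟶ x, M.transport (ofSimplex.map g)
      (vertexEval (ofSimplex.map (δ (n := 0) 0) ≫ ofSimplex.map g) m) =
      vertexEval (ofSimplex.map (δ (n := 0) 1) ≫ ofSimplex.map g) m := by
    intro g
    rw [← Functor.map_comp, ← Functor.map_comp]
    funext s
    rw [vertexEval_map, ← transport_map]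
    simp only [funext (vertexEval_map (δ (n := 0) 0 ≫ g) m)]
  obtain ⟨g, rfl | rfl⟩ := exists_map_edge h
  · exact key g
  · rw [← Category.assoc, ← Category.assoc, δ_zero_rotation, δ_one_rotation, ← key g,
      transport_rotation' _ (isCoind_vertexEval _ m)]
    simp only [hM]

theorem exists_cyclicEv (hM : ∀ m, M.monodromy m = m) {x y : SimplexCategory}
    (f : ofSimplex.obj x ⟶ ofSimplex.obj y) (m : M.obj y) :
    ∃ w : M.obj x, ∀ (v : simplexZero ⟶ x) (s : (ofSimplex ⋙ F).obj x),
      M.ev v (s • w) = vertexEval (ofSimplex.map v ≫ f) m (ringMap F f s) := by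
  refine exists_of_vertices (fun v s => vertexEval (ofSimplex.map v ≫ f) m (ringMap F f s))
    (fun v => ?_) fun g => ?_
  · have := isCoind_vertexEval (ofSimplex.map v ≫ f) m
    rw [ringMap_comp] at this
    exact this.comp
  · have := transport_vertexEval hM (ofSimplex.map g ≫ f) m
    rw [Functor.map_comp, Functor.map_comp, Category.assoc, Category.assoc, ← this]
    funext s
    simp only [transport, map_mul, ringMap_comp_apply]

/-- If the monodromy is trivial, the evaluation maps extend to the morphisms of `Λ`. -/
noncomputable def cyclicEv (hM : ∀ m, M.monodromy m = m) {x y : SimplexCategory}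
    (f : ofSimplex.obj x ⟶ ofSimplex.obj y) : M.obj y →+ M.obj x where
  toFun m := (exists_cyclicEv hM f m).choose
  map_zero' := by
    refine M.ev_ext (SimplexCategory.const simplexZero x 0) fun s => ?_
    rw [(exists_cyclicEv hM f 0).choose_spec, vertexEval, smul_zero, smul_zero, map_zero, map_zero]
  map_add' m m' := by
    refine M.ev_ext (SimplexCategory.const simplexZero x 0) fun s => ?_
    rw [smul_add, map_add, (exists_cyclicEv hM f _).choose_spec,
      (exists_cyclicEv hM f _).choose_spec, (exists_cyclicEv hM f _).choose_spec, vertexEval,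
      vertexEval, vertexEval, smul_add, map_add]

theorem ev_cyclicEv (hM : ∀ m, M.monodromy m = m) {x y : SimplexCategory}
    (f : ofSimplex.obj x ⟶ ofSimplex.obj y) (m : M.obj y) (v : simplexZero ⟶ x)
    (s : (ofSimplex ⋙ F).obj x) :
    M.ev v (s • cyclicEv hM f m) = vertexEval (ofSimplex.map v ≫ f) m (ringMap F f s) :=
  (exists_cyclicEv hM f m).choose_spec v s

theorem vertexEval_cyclicEv (hM : ∀ m, M.monodromy m = m) {x y : SimplexCategory}
    (f : ofSimplex.obj x ⟶ ofSimplex.obj y) (m : M.obj y)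
    (u : ofSimplex.obj simplexZero ⟶ ofSimplex.obj x) (s : (ofSimplex ⋙ F).obj x) :
    vertexEval u (cyclicEv hM f m) s = vertexEval (u ≫ f) m (ringMap F f s) := by
  rw [vertexEval, ev_cyclicEv, map_vertex]

theorem eq_of_vertexEval {x : SimplexCategory} (u : ofSimplex.obj simplexZero ⟶ ofSimplex.obj x)
    {m m' : M.obj x} (h : ∀ s, vertexEval u m s = vertexEval u m' s) : m = m' :=
  M.ev_ext (vertex u) h

theorem vertexEval_smul {x : SimplexCategory} (u : ofSimplex.obj simplexZero ⟶ ofSimplex.obj x)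
    (r : (ofSimplex ⋙ F).obj x) (m : M.obj x) (s : (ofSimplex ⋙ F).obj x) :
    vertexEval u (r • m) s = vertexEval u m (s * r) := by
  rw [vertexEval, vertexEval, smul_smul]

theorem cyclicEv_smul (hM : ∀ m, M.monodromy m = m) {x y : SimplexCategory}
    (f : ofSimplex.obj x ⟶ ofSimplex.obj y) (r : (ofSimplex ⋙ F).obj x) (m : M.obj y) :
    cyclicEv hM f (ringMap F f r • m) = r • cyclicEv hM f m := by
  refine eq_of_vertexEval (ofSimplex.map (SimplexCategory.const simplexZero x 0)) fun s => ?_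
  rw [vertexEval_smul, vertexEval_cyclicEv, vertexEval_cyclicEv, vertexEval_smul, map_mul]

theorem cyclicEv_map (hM : ∀ m, M.monodromy m = m) {x y : SimplexCategory} (f : x ⟶ y)
    (m : M.obj y) : cyclicEv hM (ofSimplex.map f) m = M.ev f m := by
  refine M.ev_ext (SimplexCategory.const simplexZero x 0) fun s => ?_
  rw [ev_cyclicEv, ← Functor.map_comp, vertexEval_map, ev_comp, ← ev_map_smul]
  rfl

theorem cyclicEv_comp (hM : ∀ m, M.monodromy m = m) {x y z : SimplexCategory}
    (f : ofSimplex.obj x ⟶ ofSimplex.obj y) (g : ofSimplex.obj y ⟶ ofSimplex.obj z)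
    (m : M.obj z) : cyclicEv hM (f ≫ g) m = cyclicEv hM f (cyclicEv hM g m) := by
  refine eq_of_vertexEval (ofSimplex.map (SimplexCategory.const simplexZero x 0)) fun s => ?_
  rw [vertexEval_cyclicEv, vertexEval_cyclicEv, vertexEval_cyclicEv, Category.assoc,
    ringMap_comp_apply]

theorem eq_zero_of_cyclicEv (hM : ∀ m, M.monodromy m = m) {x y : SimplexCategory}
    (f : ofSimplex.obj x ⟶ ofSimplex.obj y) (m : M.obj y)
    (h : ∀ s : (ofSimplex ⋙ F).obj y, cyclicEv hM f (s • m) = 0) : m = 0 := by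
  refine eq_of_vertexEval
    (ofSimplex.map (SimplexCategory.const simplexZero x 0) ≫ f) fun s => ?_
  have h1 := vertexEval_cyclicEv hM f (s • m)
    (ofSimplex.map (SimplexCategory.const simplexZero x 0)) 1
  rw [h, map_one, vertexEval_smul, one_mul] at h1
  rw [← h1, vertexEval, vertexEval, smul_zero, smul_zero, map_zero, map_zero]

theorem exists_of_cyclicEv (hM : ∀ m, M.monodromy m = m) {x y : SimplexCategory}
    (f : ofSimplex.obj x ⟶ ofSimplex.obj y) (φ : (ofSimplex ⋙ F).obj y → M.obj x)
    (hφ : IsCoind (ringMap F f) φ) :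
    ∃ m : M.obj y, ∀ s : (ofSimplex ⋙ F).obj y, cyclicEv hM f (s • m) = φ s := by
  let v := SimplexCategory.const simplexZero x 0
  have h : IsCoind (ringMap F (ofSimplex.map v ≫ f)) fun s => M.ev v (φ s) := by
    refine ⟨fun s t => by rw [hφ.map_add, map_add], fun r s => ?_⟩
    rw [ringMap_comp_apply, hφ.map_mul, ← ev_map_smul]
    rfl
  rw [← map_vertex (ofSimplex.map v ≫ f)] at h
  obtain ⟨m, hm⟩ := M.exists_ev (vertex (ofSimplex.map v ≫ f)) h
  refine ⟨m, fun s => M.ev_ext v fun r => ?_⟩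
  rw [ev_cyclicEv, vertexEval_smul, vertexEval, hm, hφ.map_mul]

/-- The evaluation maps over `Λ` of an object with trivial monodromy. -/
noncomputable def cyclicData (hM : ∀ m, M.monodromy m = m) : EvaluationData F where
  obj x := M.obj (SimplexCategory.mk x.len)
  e {x y} f := cyclicEv hM (x := SimplexCategory.mk x.len) (y := SimplexCategory.mk y.len) f
  e_smul {x y} f r m := cyclicEv_smul hM (x := SimplexCategory.mk x.len)
    (y := SimplexCategory.mk y.len) f r m
  e_id x m := by
    have h := cyclicEv_map hM (𝟙 (SimplexCategory.mk x.len)) m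
    rw [ev_id, CategoryTheory.Functor.map_id] at h
    exact h
  e_comp {x y z} f g m := cyclicEv_comp hM (x := SimplexCategory.mk x.len)
    (y := SimplexCategory.mk y.len) (z := SimplexCategory.mk z.len) f g m
  eq_zero {x y} f m h := eq_zero_of_cyclicEv hM (x := SimplexCategory.mk x.len)
    (y := SimplexCategory.mk y.len) f m h
  exists_e {x y} f φ hφ := exists_of_cyclicEv hM (x := SimplexCategory.mk x.len)
    (y := SimplexCategory.mk y.len) f φ hφ

/-- The object of the inverse limit over `Λ` given by an object with trivial monodromy. -/
noncomputable def cyclicExtension (hM : ∀ m, M.monodromy m = m) : CoindLim F :=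
  (cyclicData hM).toCoindLim

theorem restrict_cyclicExtension_ev (hM : ∀ m, M.monodromy m = m) {x y : SimplexCategory}
    (f : x ⟶ y) (m : M.obj y) :
    CoindLim.ev ((restrict ofSimplex F).obj (cyclicExtension hM)) (x := x) (y := y) f m =
      M.ev f m := by
  refine (restrict_ev ofSimplex (cyclicExtension hM) f m).trans ?_
  refine ((cyclicData hM).toCoindLim_ev (ofSimplex.map f) m).trans ?_
  exact cyclicEv_map hM f m

/-- An object over the simplex category comes from the cyclic category if and only if its monodromy
is trivial. -/
theorem mem_essImage_restrict_iff (M : CoindLim (ofSimplex ⋙ F)) :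
    (restrict ofSimplex F).essImage M ↔ M.monodromyHom = 𝟙 M := by
  constructor
  · rintro ⟨N, ⟨e⟩⟩
    have h : ((restrict ofSimplex F).obj N).monodromyHom = 𝟙 _ := by
      refine hom_ext_of_app simplexZero (fun y => SimplexCategory.const _ y 0) fun m => ?_
      rw [monodromyHom_app_zero, monodromy_restrict]
      rfl
    rw [← cancel_epi e.hom, monodromyHom_naturality, h, Category.id_comp, Category.comp_id]
  · intro h
    have hM : ∀ m, M.monodromy m = m := fun m => by
      rw [← monodromyHom_app_zero, h]
      rfl
    let a : (restrict ofSimplex F).obj (cyclicExtension hM) ⟶ M :=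
      homMk (fun x => 𝟙 (M.obj x)) fun f m => (restrict_cyclicExtension_ev hM f m).symm
    have : IsIso a := isIso_of_bijective _ fun x => Function.bijective_id
    exact ⟨_, ⟨asIso a⟩⟩

end Cyclic

end CoindLim

section Sigma

variable {k H : Type u} [Field k] [Ring H] [Bialgebra k H]

open SimplexCategory (δ)

theorem HochschildCat.sigma_apply (M : HochschildCat k H) (m : M.obj simplexZero) :
    M.sigma.hom.hom m = CoindLim.monodromy M m := by
  -- `a` corresponds under `δ₀` to the function `s ↦ s₁(s) m`.
  let a : M.obj simplexOne := (M.τ (δ (n := 0) 0)).hom.hom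
    (coindEval extraDegeneracyHom ((extraDegeneracyIso 0 (M.obj simplexZero)).inv.hom m) 1)
  refine (CoindLim.monodromy_eq a fun s => ?_).symm
  rw [← CoindLim.coindEval_τ_inv, CoindLim.τ_inv_hom]
  refine Eq.trans (b := (CoindLim.ringMap (cocyclicAlgebra k H) CyclicCat.extra s * 1) • m) rfl ?_
  rw [mul_one]

end Sigma

/-! ### Transport of semilinear functions by a contraaction -/

section Arcs

variable {k H : Type u} [Field k] [Ring H] [Bialgebra k H]

theorem commute_spread_spread {n : ℕ} (a : ℤ) {N N' : ℕ} (h : N + N' ≤ n + 1) (x y : H) :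
    Commute (spread k H n a N x) (spread k H n (a + N) N' y) := by
  refine commute_spread _ _ _ _ (fun t ht x' => Commute.symm ?_) x
  refine commute_spread _ _ _ _ (fun s hs y' => Commute.symm ?_) y
  exact commute_insertAt n (residue_ne n (by omega) (by omega)) x' y'

theorem spread_eq_mul (n : ℕ) (a : ℤ) {N N' P : ℕ} (h : N + N' = P) :
    spread k H n a P = spread k H n a N * spread k H n (a + N) N' := by
  rw [← h, spread_add]

end Arcs

section Sweedler

open Coalgebra HopfAlgebra

variable {k H : Type u} [Field k] [Ring H] [HopfAlgebra k H] {A M : Type u} [Ring A] [Algebra k A]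
  [AddCommGroup M] [Module k M] [Module H M]

/-- `ψ : A → M` is semilinear over `w : H → A`. -/
def IsSemilinear (w : WithConv (H →ₗ[k] A)) (ψ : A →ₗ[k] M) : Prop :=
  ∀ c x, ψ (w c * x) = c • ψ x

theorem IsSemilinear.comp_mulRight {w : WithConv (H →ₗ[k] A)} {ψ : A →ₗ[k] M}
    (h : IsSemilinear w ψ) (r : A) : IsSemilinear w (ψ ∘ₗ LinearMap.mulRight k r) := fun c x => by
  rw [LinearMap.comp_apply, LinearMap.comp_apply, LinearMap.mulRight_apply,
    LinearMap.mulRight_apply, mul_assoc, h]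

/-- `w ∘ S` is a right inverse of `w` for the convolution product. -/
theorem conv_comp_antipode (w : H →ₐ[k] A) :
    WithConv.toConv w.toLinearMap * WithConv.toConv (w.toLinearMap ∘ₗ antipode k) = 1 := by
  have h := LinearMap.algHom_comp_convMul_distrib w
    (WithConv.toConv (LinearMap.id (R := k) (M := H))) (WithConv.toConv (antipode k))
  rw [LinearMap.id_mul_antipode] at h
  ext c
  refine (congrArg (fun l => l c) h).symm.trans ?_
  simp

/-- The antipode moves a factor of a semilinear function to the other side:
`ψ (u(c) z) = c¹ ψ (w(S(c²)) z)` if `ψ` is semilinear over `c ↦ u(c¹) w(c²)`. -/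
theorem IsSemilinear.apply_mul {u : WithConv (H →ₗ[k] A)} {w : H →ₐ[k] A} {ψ : A →ₗ[k] M}
    (h : IsSemilinear (u * WithConv.toConv w.toLinearMap) ψ) {c : H} {ι : Type*} (r : Repr k c ι)
    (z : A) : ψ (u c * z) = ∑ i ∈ r.index, r.left i • ψ (w (antipode k (r.right i)) * z) := by
  have e : (u * WithConv.toConv w.toLinearMap) *
      WithConv.toConv (w.toLinearMap ∘ₗ antipode k) = u := by
    rw [mul_assoc, conv_comp_antipode, mul_one]
  conv_lhs => rw [← e]
  rw [r.convMul_apply, Finset.sum_mul, map_sum]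
  refine Finset.sum_congr rfl fun i _ => ?_
  rw [mul_assoc, h]
  rfl

/-- The anti-Yetter-Drinfeld twist of `h ↦ ψ (w(h) z)` by `a` is right multiplication by
`w(a¹) u(a²)`. -/
theorem IsSemilinear.aydTwist_eq [IsScalarTower k H M] {u : WithConv (H →ₗ[k] A)}
    {w : H →ₐ[k] A} {ψ : A →ₗ[k] M} (h : IsSemilinear (u * WithConv.toConv w.toLinearMap) ψ)
    (hc : ∀ x y, Commute (u x) (w y)) (φ : H →ₗ[k] M) (z : A) (hφ : ∀ x, φ x = ψ (w x * z))
    (a x : H) :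
    aydTwist φ (comul.lTensor H (comul (R := k) a)) x =
      ψ (w x * ((WithConv.toConv w.toLinearMap * u) a * z)) := by
  have h1 : ∀ b c : H, aydTwist φ (b ⊗ₜ comul (R := k) c) x = ψ (w x * (w b * u c * z)) := by
    intro b c
    have e := Repr.arbitrary k c
    rw [← e.eq, TensorProduct.tmul_sum, map_sum, LinearMap.sum_apply]
    rw [← mul_assoc, ← mul_assoc, ← map_mul, ← (hc c _).eq, mul_assoc, h.apply_mul e]
    refine Finset.sum_congr rfl fun i _ => ?_
    rw [aydTwist_tmul, hφ, map_mul w, mul_assoc]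
  have r := Repr.arbitrary k a
  rw [r.convMul_apply, ← r.eq, map_sum, map_sum, LinearMap.sum_apply, Finset.sum_mul,
    Finset.mul_sum, map_sum]
  refine Finset.sum_congr rfl fun i _ => ?_
  rw [LinearMap.lTensor_tmul, h1]
  rfl

end Sweedler

namespace AYDContramodule

open Coalgebra HopfAlgebra

variable {k H : Type u} [Field k] [Ring H] [HopfAlgebra k H] {A B : Type u} [Ring A] [Algebra k A]
  [Ring B] [Algebra k B] (M : AYDContramodule k H)

/-- The transport of a function `ψ : A → M` along `w : H → A`, namely `x ↦ α (h ↦ ψ (w(h) x))`. -/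
def transport (w : WithConv (H →ₗ[k] A)) (ψ : A →ₗ[k] M.carrier) : A →ₗ[k] M.carrier where
  toFun x := M.α (ψ ∘ₗ LinearMap.mulRight k x ∘ₗ w.ofConv)
  map_add' x y := by
    rw [← map_add]
    congr 1
    ext h
    simp [mul_add]
  map_smul' c x := by
    rw [RingHom.id_apply, ← map_smul]
    congr 1
    ext h
    simp

theorem transport_apply (w : WithConv (H →ₗ[k] A)) (ψ : A →ₗ[k] M.carrier) (x : A) :
    M.transport w ψ x = M.α (ψ ∘ₗ LinearMap.mulRight k x ∘ₗ w.ofConv) := rfl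

/-- Contraassociativity: transport is multiplicative for the convolution product. -/
theorem transport_mul {v w : WithConv (H →ₗ[k] A)} (hc : ∀ x y, Commute (v x) (w y))
    (ψ : A →ₗ[k] M.carrier) : M.transport v (M.transport w ψ) = M.transport (v * w) ψ := by
  ext x
  let Φ : H →ₗ[k] H →ₗ[k] M.carrier := LinearMap.mk₂ k (fun g h => ψ (v g * w h * x))
    (fun g g' h => by simp [add_mul]) (fun c g h => by simp)
    (fun g h h' => by simp [mul_add, add_mul]) (fun c g h => by simp)
  have h1 := M.contra_assoc Φ
  have h2 : M.transport v (M.transport w ψ) x = M.α (M.α ∘ₗ Φ) := by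
    rw [transport_apply]
    congr 1
    ext g
    refine congrArg M.α ?_
    ext h
    change ψ (w h * (v g * x)) = ψ (v g * w h * x)
    rw [← mul_assoc, (hc g h).eq]
  rw [h2, h1, transport_apply]
  congr 1
  ext h
  have r := Repr.arbitrary k h
  change _ = ψ ((v * w) h * x)
  rw [r.convMul_apply, LinearMap.comp_apply, ← r.eq, map_sum, Finset.sum_mul, map_sum]
  rfl

/-- Stability: transport once around is the identity. -/
theorem transport_of_isStable {M : AYDContramodule k H} (hM : IsStable M)
    {w : WithConv (H →ₗ[k] A)} {ψ : A →ₗ[k] M.carrier} (h : IsSemilinear w ψ) :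
    M.transport w ψ = ψ := by
  ext x
  rw [transport_apply, ← hM (ψ x)]
  congr 1
  ext c
  exact h c x

/-- The anti-Yetter-Drinfeld condition: transport moves the initial factor of the map over which
`ψ` is semilinear to its end. -/
theorem isSemilinear_transport {u : WithConv (H →ₗ[k] A)} {w : H →ₐ[k] A}
    {ψ : A →ₗ[k] M.carrier} (h : IsSemilinear (u * WithConv.toConv w.toLinearMap) ψ)
    (hc : ∀ x y, Commute (u x) (w y)) :
    IsSemilinear (WithConv.toConv w.toLinearMap * u)
      (M.transport (WithConv.toConv w.toLinearMap) ψ) := by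
  intro a z
  rw [transport_apply, transport_apply, ← M.ayd]
  congr 1
  ext x
  exact (h.aydTwist_eq hc _ z (fun _ => rfl) a x).symm

theorem transport_comp_algHom (f : A →ₐ[k] B) {v : WithConv (H →ₗ[k] A)}
    {w : WithConv (H →ₗ[k] B)} (hw : ∀ h, f (v h) = w h) (ψ : B →ₗ[k] M.carrier) :
    M.transport v (ψ ∘ₗ f.toLinearMap) = M.transport w ψ ∘ₗ f.toLinearMap := by
  ext x
  refine congrArg M.α ?_
  ext h
  change ψ (f (v h * x)) = ψ (w h * f x)
  rw [map_mul, hw]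

theorem transport_comp_mulRight (w : WithConv (H →ₗ[k] A)) (ψ : A →ₗ[k] M.carrier) (z : A) :
    M.transport w (ψ ∘ₗ LinearMap.mulRight k z) = M.transport w ψ ∘ₗ LinearMap.mulRight k z := by
  ext x
  refine congrArg M.α ?_
  ext h
  change ψ (w h * x * z) = ψ (w h * (x * z))
  rw [mul_assoc]

theorem transport_add (w : WithConv (H →ₗ[k] A)) (ψ ψ' : A →ₗ[k] M.carrier) :
    M.transport w (ψ + ψ') = M.transport w ψ + M.transport w ψ' := by
  ext x
  simp only [transport_apply, LinearMap.add_apply, LinearMap.add_comp, map_add]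

theorem Hom.comp_transport {M N : AYDContramodule k H} (f : M ⟶ N) (w : WithConv (H →ₗ[k] A))
    (ψ : A →ₗ[k] M.carrier) :
    (Hom.toLin f).restrictScalars k ∘ₗ M.transport w ψ =
      N.transport w ((Hom.toLin f).restrictScalars k ∘ₗ ψ) := by
  ext x
  exact Hom.comm f _

section Spread

variable {n : ℕ}

/-- Transport along adjacent arcs. -/
theorem transport_spread (a : ℤ) {N N' : ℕ} (h : N + N' ≤ n + 1)
    (ψ : TensorPow k H n →ₗ[k] M.carrier) :
    M.transport (spread k H n a N) (M.transport (spread k H n (a + N) N') ψ) =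
      M.transport (spread k H n a (N + N')) ψ := by
  rw [spread_add]
  exact M.transport_mul (commute_spread_spread a h) ψ

/-- Transport along the arc from `a` to `a + N` maps functions that are semilinear over the vertex
`a + N` to functions that are semilinear over `a`. -/
theorem isSemilinear_spread (a : ℤ) {N : ℕ} (hN : N ≤ n + 1)
    {ψ : TensorPow k H n →ₗ[k] M.carrier}
    (h : IsSemilinear (spread k H n (a + N) (n + 1)) ψ) :
    IsSemilinear (spread k H n a (n + 1)) (M.transport (spread k H n a N) ψ) := by
  obtain ⟨N', hN'⟩ := Nat.exists_eq_add_of_le hN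
  obtain ⟨w, hw⟩ := exists_algHom_spread (k := k) (H := H) n a N hN
  have hw' : spread k H n a N = WithConv.toConv w.toLinearMap := by
    ext x
    exact (hw x).symm
  have h1 : spread k H n (a + N) (n + 1) = spread k H n (a + N) N' * spread k H n a N := by
    rw [spread_eq_mul n (a + N) (show N' + N = n + 1 by omega), ← spread_shift n a 1 N]
    congr 2
    have : ((n : ℤ) + 1) = N + N' := by exact_mod_cast hN'
    rw [this]; ring
  have hc : ∀ x y, Commute (spread k H n (a + N) N' x) (spread k H n a N y) := fun x y =>
    (commute_spread_spread a hN'.ge y x).symm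
  rw [h1, hw'] at h
  rw [spread_eq_mul n a hN'.symm, hw']
  refine M.isSemilinear_transport h fun x y => ?_
  rw [hw]
  exact hc x y

end Spread

end AYDContramodule

/-! ### The object of the cyclic homology category of a stable contramodule -/

namespace AYDContramodule

open CyclicCat (Lift)

variable {k H : Type u} [Field k] [Ring H] [HopfAlgebra k H] (M : AYDContramodule k H)

/-- The functions `H^{⊗ (n + 1)} → M` that are semilinear over the iterated coproduct placed at the
positions `1, …, n, 0`; this is the coinduced module along the vertex `0` of `[n]`. -/
def coinduced (n : ℕ) : AddSubgroup (TensorPow k H n →ₗ[k] M.carrier) where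
  carrier := {ψ | IsSemilinear (spread k H n 0 (n + 1)) ψ}
  zero_mem' := fun c x => by simp
  add_mem' {ψ ψ'} h h' := fun c x => by
    rw [LinearMap.add_apply, LinearMap.add_apply, h, h', smul_add]
  neg_mem' {ψ} h := fun c x => by rw [LinearMap.neg_apply, LinearMap.neg_apply, h, smul_neg]

variable {M}

/-- `H^{⊗ (n + 1)}` acts on functions by right multiplication in the argument. -/
noncomputable instance (n : ℕ) : Module (TensorPow k H n) (M.coinduced n) where
  smul r ψ := ⟨ψ.1 ∘ₗ LinearMap.mulRight k r, IsSemilinear.comp_mulRight ψ.2 r⟩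
  one_smul ψ := Subtype.ext (LinearMap.ext fun x => congrArg ψ.1 (mul_one x))
  mul_smul r s ψ := Subtype.ext (LinearMap.ext fun x => congrArg ψ.1 (mul_assoc x r s).symm)
  smul_zero _ := rfl
  smul_add _ _ _ := rfl
  add_smul r s ψ := Subtype.ext (LinearMap.ext fun x =>
    (congrArg ψ.1 (mul_add x r s)).trans (map_add ψ.1 _ _))
  zero_smul ψ := Subtype.ext (LinearMap.ext fun x =>
    (congrArg ψ.1 (mul_zero x)).trans (map_zero ψ.1))

theorem coinduced_smul_val {n : ℕ} (r : TensorPow k H n) (ψ : M.coinduced n) :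
    (r • ψ).1 = ψ.1 ∘ₗ LinearMap.mulRight k r := rfl

theorem coinduced_smul_apply {n : ℕ} (r : TensorPow k H n) (ψ : M.coinduced n)
    (x : TensorPow k H n) : (r • ψ).1 x = ψ.1 (x * r) := rfl

theorem isSemilinear_comp_cocyclicMap {m n : ℕ} (f : Lift m n)
    {ψ : TensorPow k H n →ₗ[k] M.carrier} (a : ℤ)
    (h : IsSemilinear (spread k H n (f.toFun a) (n + 1)) ψ) :
    IsSemilinear (spread k H m a (m + 1)) (ψ ∘ₗ (cocyclicMap f).toLinearMap) := by
  intro c x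
  rw [LinearMap.comp_apply, AlgHom.toLinearMap_apply, map_mul, cocyclicMap_spread]
  have e := f.period a
  push_cast
  rw [e, show (f.toFun a + ((n : ℤ) + 1) - f.toFun a).toNat = n + 1 by omega]
  exact h c _

variable (M)

/-- The value of `ψ` at the vertex `a ∈ {0, …, n}`, obtained by transport along the arc from `a` to
`n + 1`. -/
noncomputable def valueAt {n : ℕ} (a : ℤ) (ψ : TensorPow k H n →ₗ[k] M.carrier) :
    TensorPow k H n →ₗ[k] M.carrier :=
  M.transport (spread k H n a (n + 1 - a).toNat) ψ

theorem isSemilinear_valueAt {n : ℕ} {a : ℤ} (h0 : 0 ≤ a) (h1 : a ≤ n) (ψ : M.coinduced n) :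
    IsSemilinear (spread k H n a (n + 1)) (M.valueAt a ψ.1) := by
  refine M.isSemilinear_spread a (by omega) ?_
  rw [show a + ((n + 1 - a).toNat : ℤ) = 0 + (n + 1) * 1 by omega, spread_shift]
  exact ψ.2

/-- Evaluation along a lift of a morphism of `Λ`. -/
noncomputable def liftEval {m n : ℕ} (f : Lift m n) : M.coinduced n →+ M.coinduced m where
  toFun ψ := ⟨M.valueAt (f.toFun 0 % (n + 1)) ψ.1 ∘ₗ (cocyclicMap f).toLinearMap, by
    have hn : (0 : ℤ) < n + 1 := by positivity
    have h0 := Int.emod_nonneg (f.toFun 0) hn.ne'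
    have h1 := Int.emod_lt_of_pos (f.toFun 0) hn
    have h := M.isSemilinear_valueAt h0 (by omega) ψ
    rw [← spread_shift n _ (f.toFun 0 / (n + 1)), Int.emod_add_mul_ediv] at h
    exact isSemilinear_comp_cocyclicMap f 0 h⟩
  map_zero' := Subtype.ext (LinearMap.ext fun x => map_zero M.α)
  map_add' ψ ψ' := Subtype.ext (by
    refine (congrArg (· ∘ₗ (cocyclicMap f).toLinearMap)
      (M.transport_add _ ψ.1 ψ'.1)).trans ?_
    exact LinearMap.add_comp _ _ _)

theorem liftEval_val {m n : ℕ} (f : Lift m n) (h0 : 0 ≤ f.toFun 0) (h1 : f.toFun 0 ≤ n)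
    (ψ : M.coinduced n) :
    (M.liftEval f ψ).1 = M.valueAt (f.toFun 0) ψ.1 ∘ₗ (cocyclicMap f).toLinearMap := by
  change M.valueAt (f.toFun 0 % (n + 1)) ψ.1 ∘ₗ (cocyclicMap f).toLinearMap = _
  rw [Int.emod_eq_of_lt h0 (by omega)]

theorem liftEval_congr {m n : ℕ} {f g : Lift m n} (h : f ≈ g) : M.liftEval f = M.liftEval g := by
  have e := cocyclicMap_congr (k := k) (H := H) h
  obtain ⟨q, hq⟩ := h
  refine AddMonoidHom.ext fun ψ => Subtype.ext (LinearMap.ext fun x => ?_)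
  change M.valueAt (f.toFun 0 % (n + 1)) ψ.1 (cocyclicMap f x) =
    M.valueAt (g.toFun 0 % (n + 1)) ψ.1 (cocyclicMap g x)
  rw [hq, e, Int.add_mul_emod_self_left]

theorem liftEval_smul {m n : ℕ} (f : Lift m n) (r : TensorPow k H m) (ψ : M.coinduced n) :
    M.liftEval f (cocyclicMap f r • ψ) = r • M.liftEval f ψ := by
  refine Subtype.ext (LinearMap.ext fun x => ?_)
  change M.transport _ (ψ.1 ∘ₗ LinearMap.mulRight k (cocyclicMap f r)) (cocyclicMap f x) =
    M.transport _ ψ.1 (cocyclicMap f (x * r))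
  rw [transport_comp_mulRight, map_mul]
  rfl

variable {M}

theorem valueAt_zero (hM : IsStable M) {n : ℕ} (ψ : M.coinduced n) : M.valueAt 0 ψ.1 = ψ.1 := by
  unfold valueAt
  rw [show ((n : ℤ) + 1 - 0).toNat = n + 1 by omega]
  exact transport_of_isStable hM ψ.2

/-- Transport from `0` to `a` is inverse to `valueAt a`. -/
theorem transport_valueAt (hM : IsStable M) {n : ℕ} {a : ℕ} (h : a ≤ n) (ψ : M.coinduced n) :
    M.transport (spread k H n 0 a) (M.valueAt a ψ.1) = ψ.1 := by
  have := M.transport_spread (n := n) 0 (N := a) (N' := ((n : ℤ) + 1 - a).toNat) (by omega) ψ.1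
  rw [zero_add] at this
  unfold valueAt
  rw [this, show a + ((n : ℤ) + 1 - a).toNat = n + 1 by omega]
  exact transport_of_isStable hM ψ.2

/-- Both sides transport along consecutive arcs of `[n]`, from `g (f 0)` to `g 0 + n + 1` and on to
a multiple of `n + 1`; the arcs may add up to more than a full turn, which stability removes. -/
theorem liftEval_comp (hM : IsStable M) {l m n : ℕ} (f : Lift l m) (g : Lift m n)
    (hf0 : 0 ≤ f.toFun 0) (hf1 : f.toFun 0 ≤ m) (hg0 : 0 ≤ g.toFun 0) (hg1 : g.toFun 0 ≤ n)
    (ψ : M.coinduced n) :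
    M.liftEval (f.comp g) ψ = M.liftEval f (M.liftEval g ψ) := by
  refine Subtype.ext ?_
  rw [liftEval_val _ _ hf0 hf1, liftEval_val _ _ hg0 hg1]
  obtain ⟨a, ha⟩ := Int.eq_ofNat_of_zero_le hf0
  obtain ⟨b, hb⟩ := Int.eq_ofNat_of_zero_le hg0
  have hgm : g.toFun (a + ((m : ℤ) + 1 - a).toNat) = b + (n + 1) := by
    rw [← hb, ← g.period]
    congr 1
    omega
  have hga0 : (b : ℤ) ≤ g.toFun a := by
    rw [← hb]
    exact g.mono (by omega)
  have hga1 : g.toFun a ≤ b + (n + 1) := by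
    rw [← hgm]
    exact g.mono (by omega)
  obtain ⟨c, hc⟩ := Int.eq_ofNat_of_zero_le (show 0 ≤ g.toFun a by omega)
  have h1 : M.valueAt (f.toFun 0) (M.valueAt (g.toFun 0) ψ.1 ∘ₗ (cocyclicMap g).toLinearMap) =
      M.transport (spread k H n c (b + (n + 1) - c)) (M.valueAt b ψ.1) ∘ₗ
        (cocyclicMap g).toLinearMap := by
    rw [ha, hb]
    refine M.transport_comp_algHom (cocyclicMap g) (fun h => ?_) _
    refine (cocyclicMap_spread g a _ h).trans ?_
    rw [hgm, hc, show ((b : ℤ) + (n + 1) - c).toNat = b + (n + 1) - c by omega]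
  rw [h1]
  refine LinearMap.ext fun x => ?_
  change M.valueAt (g.toFun (f.toFun 0) % (n + 1)) ψ.1 (cocyclicMap (f.comp g) x) =
    M.transport (spread k H n c (b + (n + 1) - c)) (M.valueAt b ψ.1)
      (cocyclicMap g (cocyclicMap f x))
  rw [cocyclicMap_comp, ha]
  change _ = M.transport (spread k H n c (b + (n + 1) - c)) (M.valueAt b ψ.1)
      ((cocyclicMap g).comp (cocyclicMap f) x)
  congr 1
  change g.toFun a = c at hc
  rw [hc]
  -- The composite arc starts at `c`, which lies in the first or in the second turn.
  by_cases hcn : c ≤ n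
  · rw [Int.emod_eq_of_lt (by omega) (by omega),
      show b + (n + 1) - c = (n + 1 - c) + b by omega,
      ← M.transport_spread c (N := n + 1 - c) (N' := b) (by omega),
      show (c : ℤ) + (n + 1 - c : ℕ) = 0 + (n + 1) * 1 by omega, spread_shift,
      transport_valueAt hM (by omega)]
    unfold valueAt
    congr 2
    omega
  · obtain ⟨d, rfl⟩ := Nat.exists_eq_add_of_le (show n + 1 ≤ c by omega)
    have e : ((n + 1 + d : ℕ) : ℤ) = d + (n + 1) * 1 := by push_cast; ring
    rw [e, spread_shift, Int.add_mul_emod_self_left, Int.emod_eq_of_lt (by omega) (by omega),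
      show b + (n + 1) - (n + 1 + d) = b - d by omega]
    unfold valueAt
    have := M.transport_spread (n := n) d (N := b - d) (N' := ((n : ℤ) + 1 - b).toNat) (by omega)
      ψ.1
    rw [show (d : ℤ) + (b - d : ℕ) = b by omega] at this
    rw [this]
    congr 2
    omega

theorem liftEval_id (hM : IsStable M) {n : ℕ} (ψ : M.coinduced n) :
    M.liftEval (Lift.id n) ψ = ψ := by
  refine Subtype.ext ?_
  rw [liftEval_val _ _ le_rfl (Int.natCast_nonneg n)]
  change M.valueAt 0 ψ.1 ∘ₗ _ = _
  rw [valueAt_zero hM, cocyclicMap_id]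
  rfl

theorem eq_zero_of_liftEval (hM : IsStable M) {m n : ℕ} (f : Lift m n) (hf0 : 0 ≤ f.toFun 0)
    (hf1 : f.toFun 0 ≤ n) (ψ : M.coinduced n)
    (h : ∀ s : TensorPow k H n, M.liftEval f (s • ψ) = 0) : ψ = 0 := by
  obtain ⟨a, ha⟩ := Int.eq_ofNat_of_zero_le hf0
  have h1 : M.valueAt a ψ.1 = 0 := LinearMap.ext fun s => by
    have e := congrArg (fun χ => χ.1 1) (h s)
    rw [liftEval_val _ _ hf0 hf1, ha, LinearMap.comp_apply, AlgHom.toLinearMap_apply, map_one,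
      coinduced_smul_val, valueAt, transport_comp_mulRight, LinearMap.comp_apply,
      LinearMap.mulRight_apply, one_mul] at e
    exact e
  refine Subtype.ext ?_
  rw [← transport_valueAt hM (show a ≤ n by omega) ψ, h1]
  exact LinearMap.ext fun x => map_zero M.α

/-- The function `ψ` is found by transporting `s ↦ φ s 1`, which is semilinear over the vertex
`f 0`, to the vertex `0`. -/
theorem exists_of_liftEval (hM : IsStable M) {m n : ℕ} (f : Lift m n) (hf0 : 0 ≤ f.toFun 0)
    (hf1 : f.toFun 0 ≤ n) (φ : TensorPow k H n → M.coinduced m)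
    (hφ : IsCoind (cocyclicMap f).toRingHom φ) :
    ∃ ψ : M.coinduced n, ∀ s : TensorPow k H n, M.liftEval f (s • ψ) = φ s := by
  obtain ⟨a, ha⟩ := Int.eq_ofNat_of_zero_le hf0
  have hφ' : ∀ r s, φ (cocyclicMap f r * s) = r • φ s := hφ.map_mul
  let χ : TensorPow k H n →ₗ[k] M.carrier :=
    { toFun := fun s => (φ s).1 1
      map_add' := fun s t => by rw [hφ.map_add]; rfl
      map_smul' := fun c s => by
        have e := hφ' (algebraMap k _ c) s
        rw [AlgHom.commutes, ← Algebra.smul_def] at e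
        rw [e, coinduced_smul_apply, one_mul, Algebra.algebraMap_eq_smul_one, map_smul]
        rfl }
  have hχ : ∀ r s, χ (cocyclicMap f r * s) = (φ s).1 r := fun r s => by
    change (φ _).1 1 = _
    rw [hφ', coinduced_smul_apply, one_mul]
  have h1 : IsSemilinear (spread k H n (0 + a) (n + 1)) χ := by
    intro c s
    have e := cocyclicMap_spread (k := k) f 0 (m + 1) c
    have e1 := f.period 0
    push_cast at e
    rw [e1, ha, show ((a : ℤ) + (n + 1) - a).toNat = n + 1 by omega] at e
    rw [zero_add]
    refine (congrArg (fun t => χ (t * s)) e.symm).trans ?_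
    rw [hχ]
    refine Eq.trans ?_ ((φ s).2 c 1)
    rw [mul_one]
  refine ⟨⟨M.transport (spread k H n 0 a) χ, M.isSemilinear_spread 0 (by omega) h1⟩, fun s => ?_⟩
  refine Subtype.ext (LinearMap.ext fun x => ?_)
  rw [liftEval_val _ _ hf0 hf1, ha, coinduced_smul_val, valueAt, transport_comp_mulRight]
  have h2 : M.transport (spread k H n a ((n : ℤ) + 1 - a).toNat)
      (M.transport (spread k H n 0 a) χ) = χ := by
    have e := M.transport_spread (n := n) a (N := ((n : ℤ) + 1 - a).toNat) (N' := a) (by omega) χ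
    rw [show (a : ℤ) + ((n : ℤ) + 1 - a).toNat = 0 + (n + 1) * 1 by omega, spread_shift,
      show ((n : ℤ) + 1 - a).toNat + a = n + 1 by omega] at e
    rw [e]
    rw [zero_add] at h1
    exact transport_of_isStable hM h1
  rw [h2]
  exact hχ x s

end AYDContramodule

/-! ### Semilinear functions are cofree -/

section Cofree

open Coalgebra HopfAlgebra

variable {k H : Type u} [Field k] [Ring H] [HopfAlgebra k H] {B M : Type u} [Ring B]
  [Algebra k B] [AddCommGroup M] [Module k M] [Module H M] [IsScalarTower k H M]

/-- The extension of a linear map `F : B → M` to `H ⊗ B` that is semilinear over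
`c ↦ c¹ ⊗ w(c²)`, namely `b ⊗ z ↦ b¹ F (w(S(b²)) z)`. -/
noncomputable def semilinearExtension (w : H →ₐ[k] B) (F : B →ₗ[k] M) : H ⊗[k] B →ₗ[k] M :=
  TensorProduct.lift (TensorProduct.lift (LinearMap.mk₂ k
    (fun x y : H => Algebra.lsmul k k M x ∘ₗ F ∘ₗ LinearMap.mulLeft k (w (antipode k y)))
    (fun x x' y => by ext; simp)
    (fun c x y => by ext; simp)
    (fun x y y' => by ext; simp [add_mul])
    (fun c x y => by ext; simp [smul_comm x c])) ∘ₗ comul)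

theorem semilinearExtension_tmul (w : H →ₐ[k] B) (F : B →ₗ[k] M) {b : H} {ι : Type*}
    (r : Repr k b ι) (z : B) : semilinearExtension w F (b ⊗ₜ z) =
      ∑ i ∈ r.index, r.left i • F (w (antipode k (r.right i)) * z) := by
  rw [semilinearExtension, TensorProduct.lift.tmul, LinearMap.comp_apply, ← r.eq, map_sum,
    LinearMap.sum_apply]
  rfl

theorem semilinearExtension_one_tmul (w : H →ₐ[k] B) (F : B →ₗ[k] M) (z : B) :
    semilinearExtension w F (1 ⊗ₜ z) = F z := by
  rw [semilinearExtension, TensorProduct.lift.tmul, LinearMap.comp_apply, Bialgebra.comul_one]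
  change (1 : H) • F (w (antipode k 1) * z) = F z
  rw [antipode_one, map_one, one_mul, one_smul]

theorem isSemilinear_semilinearExtension (w : H →ₐ[k] B) (F : B →ₗ[k] M) :
    IsSemilinear (WithConv.toConv (Algebra.TensorProduct.includeLeft (R := k) (S := k)
      (A := H) (B := B)).toLinearMap * WithConv.toConv
        ((Algebra.TensorProduct.includeRight (R := k) (A := H) (B := B)).comp w).toLinearMap)
      (semilinearExtension w F) := by
  intro c x
  induction x using TensorProduct.induction_on with
  | zero => simp
  | add x y hx hy => rw [mul_add, map_add, hx, hy, map_add, smul_add]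
  | tmul b z =>
    have r := Repr.arbitrary k c
    have s := Repr.arbitrary k b
    -- In the convolution algebra, `c¹ ⊗ S(c²) c³ = c ⊗ 1`.
    have key : (WithConv.toConv (Algebra.TensorProduct.includeLeft (R := k) (S := k)
          (A := H) (B := H)).toLinearMap * WithConv.toConv
          ((Algebra.TensorProduct.includeRight (R := k) (A := H) (B := H)).toLinearMap ∘ₗ
            antipode k)) * WithConv.toConv
          (Algebra.TensorProduct.includeRight (R := k) (A := H) (B := H)).toLinearMap =
        WithConv.toConv (Algebra.TensorProduct.includeLeft (R := k) (S := k)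
          (A := H) (B := H)).toLinearMap := by
      have h := LinearMap.algHom_comp_convMul_distrib
        (Algebra.TensorProduct.includeRight (R := k) (A := H) (B := H))
        (WithConv.toConv (antipode k)) (WithConv.toConv (LinearMap.id (R := k) (M := H)))
      rw [LinearMap.antipode_mul_id] at h
      have h' : WithConv.toConv
          ((Algebra.TensorProduct.includeRight (R := k) (A := H) (B := H)).toLinearMap ∘ₗ
            antipode k) * WithConv.toConv
          (Algebra.TensorProduct.includeRight (R := k) (A := H) (B := H)).toLinearMap = 1 := by
        ext c
        refine (congrArg (fun l => l c) h).symm.trans ?_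
        simp [Algebra.TensorProduct.algebraMap_apply, Algebra.TensorProduct.tmul_one_eq_one_tmul]
      rw [mul_assoc, h', mul_one]
    let Q : H × H → H ⊗[k] H →ₗ[k] M := fun j => TensorProduct.lift (LinearMap.mk₂ k
      (fun y t => y • s.left j • F (w (antipode k (s.right j)) * (w t * z)))
      (fun y y' t => by rw [add_smul])
      (fun a y t => by rw [smul_assoc])
      (fun y t t' => by simp [add_mul, mul_add])
      (fun a y t => by simp [smul_comm _ a]))
    have hQ : ∀ j y t, Q j (y ⊗ₜ t) =
        y • s.left j • F (w (antipode k (s.right j)) * (w t * z)) := fun _ _ _ => rfl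
    have step : ∀ y t : H, semilinearExtension w F ((y * b) ⊗ₜ (w t * z)) =
        ∑ j ∈ s.index, Q j ((WithConv.toConv (Algebra.TensorProduct.includeLeft (R := k) (S := k)
          (A := H) (B := H)).toLinearMap * WithConv.toConv
          ((Algebra.TensorProduct.includeRight (R := k) (A := H) (B := H)).toLinearMap ∘ₗ
            antipode k)) y * (1 ⊗ₜ t)) := by
      intro y t
      have p := Repr.arbitrary k y
      rw [semilinearExtension, TensorProduct.lift.tmul, LinearMap.comp_apply,
        Bialgebra.comul_mul, ← p.eq, ← s.eq, Finset.sum_mul_sum, Finset.sum_comm, map_sum,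
        LinearMap.sum_apply]
      refine Finset.sum_congr rfl fun j _ => ?_
      rw [p.convMul_apply, Finset.sum_mul, map_sum, map_sum, LinearMap.sum_apply]
      refine Finset.sum_congr rfl fun i _ => ?_
      refine Eq.trans ?_ (hQ j (p.left i) (antipode k (p.right i) * t)).symm |>.trans ?_
      · rw [Algebra.TensorProduct.tmul_mul_tmul, TensorProduct.lift.tmul]
        change (p.left i * s.left j) • F (w (antipode k (p.right i * s.right j)) * (w t * z)) = _
        rw [antipode_mul_antidistrib, mul_smul, map_mul w, map_mul w, mul_assoc, mul_assoc]
      · congr 1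
        change _ = (p.left i ⊗ₜ[k] (1 : H)) * ((1 : H) ⊗ₜ[k] antipode k (p.right i)) * (1 ⊗ₜ[k] t)
        simp
    have h1 : semilinearExtension w F (b ⊗ₜ z) =
        ∑ j ∈ s.index, s.left j • F (w (antipode k (s.right j)) * z) :=
      semilinearExtension_tmul w F s z
    rw [h1, Finset.smul_sum]
    have h2 : ∀ j, c • s.left j • F (w (antipode k (s.right j)) * z) = Q j (c ⊗ₜ 1) := fun j => by
      rw [hQ, map_one, one_mul]
    simp only [h2]
    have h3 := congrArg (fun l => l c) key
    dsimp only at h3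
    rw [r.convMul_apply] at h3
    have h4 : (c ⊗ₜ[k] (1 : H)) = _ := h3.symm
    rw [h4, r.convMul_apply, Finset.sum_mul, map_sum]
    simp only [map_sum]
    rw [Finset.sum_comm]
    refine Finset.sum_congr rfl fun i _ => ?_
    refine Eq.trans (congrArg (semilinearExtension w F) ?_) (step (r.left i) (r.right i))
    change (r.left i ⊗ₜ[k] (1 : B)) * ((1 : H) ⊗ₜ[k] w (r.right i)) * (b ⊗ₜ z) = _
    simp

end Cofree

/-! ### Semilinear functions on `H^{⊗ 2}` and `H^{⊗ 3}` -/

section SmallPowers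

open Coalgebra HopfAlgebra

section Split

variable (k H : Type u) [Field k] [Ring H] [Bialgebra k H]

/-- The algebra map `H^{⊗ 2} → H ⊗ H` that puts the factor at the position `1` first. -/
noncomputable def splitTwo : TensorPow k H 1 →ₐ[k] H ⊗[k] H :=
  PiTensorProduct.liftAlgHom
    (MultilinearMap.mk' (fun x : Fin 2 → H => x 1 ⊗ₜ[k] x 0)
      (fun m i x y => by fin_cases i <;> simp [TensorProduct.tmul_add, TensorProduct.add_tmul])
      (fun m i c x => by fin_cases i <;> simp [TensorProduct.smul_tmul']))
    rfl (fun x y => by simp)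

/-- The algebra map `H^{⊗ 3} → H ⊗ (H ⊗ H)`. -/
noncomputable def splitThree : TensorPow k H 2 →ₐ[k] H ⊗[k] (H ⊗[k] H) :=
  PiTensorProduct.liftAlgHom
    (MultilinearMap.mk' (fun x : Fin 3 → H => x 0 ⊗ₜ[k] (x 1 ⊗ₜ[k] x 2))
      (fun m i x y => by fin_cases i <;> simp [TensorProduct.tmul_add, TensorProduct.add_tmul])
      (fun m i c x => by fin_cases i <;> simp [← TensorProduct.smul_tmul']))
    rfl (fun x y => by simp)

variable {k H}

theorem splitTwo_insertAt (p : ℤ) (h : H) : splitTwo k H (insertAt k H 1 p h) =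
    (Pi.mulSingle (M := fun _ : Fin 2 => H) (residue 1 p) h 1) ⊗ₜ
      (Pi.mulSingle (M := fun _ : Fin 2 => H) (residue 1 p) h 0) := by
  rw [insertAt, PiTensorProduct.singleAlgHom_apply]
  exact PiTensorProduct.lift.tprod _

theorem splitThree_insertAt (p : ℤ) (h : H) : splitThree k H (insertAt k H 2 p h) =
    (Pi.mulSingle (M := fun _ : Fin 3 => H) (residue 2 p) h 0) ⊗ₜ
      ((Pi.mulSingle (M := fun _ : Fin 3 => H) (residue 2 p) h 1) ⊗ₜ
        (Pi.mulSingle (M := fun _ : Fin 3 => H) (residue 2 p) h 2)) := by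
  rw [insertAt, PiTensorProduct.singleAlgHom_apply]
  exact PiTensorProduct.lift.tprod _

theorem spread_one (n : ℕ) (a : ℤ) :
    spread k H n a 1 = WithConv.toConv (insertAt k H n (a + 1)).toLinearMap := by
  simp [spread]

end Split

variable {k H : Type u} [Field k] [Ring H] [HopfAlgebra k H] {A B M : Type u} [Ring A] [Algebra k A]
  [Ring B] [Algebra k B] [AddCommGroup M] [Module k M] [Module H M]

theorem IsSemilinear.comp_algHom {w : WithConv (H →ₗ[k] B)} {ψ : B →ₗ[k] M}
    (h : IsSemilinear w ψ) (f : A →ₐ[k] B) {v : WithConv (H →ₗ[k] A)} (hv : ∀ c, f (v c) = w c) :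
    IsSemilinear v (ψ ∘ₗ f.toLinearMap) := fun c x => by
  rw [LinearMap.comp_apply, AlgHom.toLinearMap_apply, map_mul, hv]
  exact h c _

theorem map_convMul (f : A →ₐ[k] B) (v w : WithConv (H →ₗ[k] A)) (c : H) :
    f ((v * w) c) = (WithConv.toConv (f.toLinearMap ∘ₗ v.ofConv) *
      WithConv.toConv (f.toLinearMap ∘ₗ w.ofConv)) c :=
  congrArg (fun l => l c) (LinearMap.algHom_comp_convMul_distrib f v w)

theorem convMul_apply_congr {v v' w w' : WithConv (H →ₗ[k] A)} (hv : ∀ x, v x = v' x)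
    (hw : ∀ x, w x = w' x) (c : H) : (v * w) c = (v' * w') c := by
  rw [(Repr.arbitrary k c).convMul_apply, (Repr.arbitrary k c).convMul_apply]
  exact Finset.sum_congr rfl fun i _ => by rw [hv, hw]

/-- A semilinear function on `H^{⊗ 2}` can be prescribed on the factor at the position `0`. -/
theorem exists_isSemilinear_two [IsScalarTower k H M] (φ : H →ₗ[k] M) :
    ∃ ψ : TensorPow k H 1 →ₗ[k] M, IsSemilinear (spread k H 1 0 2) ψ ∧
      ∀ h, ψ (insertAt k H 1 0 h) = φ h := by
  refine ⟨semilinearExtension (AlgHom.id k H) φ ∘ₗ (splitTwo k H).toLinearMap,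
    (isSemilinear_semilinearExtension _ _).comp_algHom (splitTwo k H) fun c => ?_, fun h => ?_⟩
  · rw [spread_eq_mul 1 0 (show 1 + 1 = 2 from rfl), spread_one, spread_one, map_convMul]
    refine convMul_apply_congr (fun x => ?_) (fun x => ?_) c
    · exact splitTwo_insertAt (k := k) (0 + 1) x
    · exact splitTwo_insertAt (k := k) (0 + (1 : ℕ) + 1) x
  · refine Eq.trans ?_ (semilinearExtension_one_tmul (AlgHom.id k H) φ h)
    exact congrArg (semilinearExtension (AlgHom.id k H) φ) (splitTwo_insertAt (k := k) 0 h)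

/-- A semilinear function on `H^{⊗ 3}` can be prescribed on the factors at the positions `1`
and `2`. -/
theorem exists_isSemilinear_three [IsScalarTower k H M] (F : H →ₗ[k] H →ₗ[k] M) :
    ∃ ψ : TensorPow k H 2 →ₗ[k] M, IsSemilinear (spread k H 2 2 3) ψ ∧
      ∀ x y, ψ (insertAt k H 2 1 x * insertAt k H 2 2 y) = F x y := by
  refine ⟨semilinearExtension (Bialgebra.comulAlgHom k H) (TensorProduct.lift F) ∘ₗ
    (splitThree k H).toLinearMap,
    (isSemilinear_semilinearExtension _ _).comp_algHom (splitThree k H) fun c => ?_, fun x y => ?_⟩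
  · rw [spread_eq_mul 2 2 (show 1 + 2 = 3 from rfl), spread_one, map_convMul]
    refine convMul_apply_congr (fun x => ?_) (fun x => ?_) c
    · exact splitThree_insertAt (k := k) (2 + 1) x
    · rw [LinearMap.comp_apply, spread_eq_mul 2 _ (show 1 + 1 = 2 from rfl), spread_one, spread_one]
      refine (map_convMul (splitThree k H) _ _ x).trans ?_
      have r := Repr.arbitrary k x
      change _ = (1 : H) ⊗ₜ[k] (comul (R := k) x)
      rw [r.convMul_apply, ← r.eq, TensorProduct.tmul_sum]
      refine Finset.sum_congr rfl fun i _ => ?_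
      refine Eq.trans (congrArg₂ (· * ·) (splitThree_insertAt (2 + (1 : ℕ) + 1) (r.left i))
        (splitThree_insertAt (2 + (1 : ℕ) + (1 : ℕ) + 1) (r.right i))) ?_
      change (1 : H) ⊗ₜ[k] (r.left i ⊗ₜ[k] (1 : H)) * (1 : H) ⊗ₜ[k] ((1 : H) ⊗ₜ[k] r.right i) = _
      simp
  · refine Eq.trans ?_ (semilinearExtension_one_tmul (Bialgebra.comulAlgHom k H)
      (TensorProduct.lift F) (x ⊗ₜ y))
    rw [LinearMap.comp_apply, AlgHom.toLinearMap_apply, map_mul, splitThree_insertAt,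
      splitThree_insertAt]
    refine congrArg _ ?_
    change (1 : H) ⊗ₜ[k] (x ⊗ₜ[k] (1 : H)) * (1 : H) ⊗ₜ[k] ((1 : H) ⊗ₜ[k] y) = _
    simp

/-- A semilinear function on `H^{⊗ 2}` is determined by its restriction to the factor at the
position `0`. -/
theorem IsSemilinear.ext_two {ψ ψ' : TensorPow k H 1 →ₗ[k] M}
    (hψ : IsSemilinear (spread k H 1 0 2) ψ) (hψ' : IsSemilinear (spread k H 1 0 2) ψ')
    (h : ∀ x, ψ (insertAt k H 1 0 x) = ψ' (insertAt k H 1 0 x)) : ψ = ψ' := by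
  have e : spread k H 1 0 2 =
      spread k H 1 0 1 * WithConv.toConv (insertAt k H 1 0).toLinearMap := by
    rw [spread_eq_mul 1 0 (show 1 + 1 = 2 from rfl), spread_one 1 (0 + (1 : ℕ))]
    rfl
  rw [e] at hψ hψ'
  refine PiTensorProduct.ext (MultilinearMap.ext fun x => ?_)
  have hx : PiTensorProduct.tprod k x =
      spread k H 1 0 1 (x 1) * insertAt k H 1 0 (x 0) := by
    rw [spread_one]
    change _ = insertAt k H 1 (0 + 1) (x 1) * insertAt k H 1 0 (x 0)
    simp only [insertAt, PiTensorProduct.singleAlgHom_apply, PiTensorProduct.tprod_mul_tprod]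
    congr 1
    funext i
    fin_cases i
    · exact (one_mul (x 0)).symm
    · exact (mul_one (x 1)).symm
  have r := Repr.arbitrary k (x 1)
  change ψ (PiTensorProduct.tprod k x) = ψ' (PiTensorProduct.tprod k x)
  rw [hx, hψ.apply_mul r, hψ'.apply_mul r]
  refine Finset.sum_congr rfl fun i _ => ?_
  rw [← map_mul, h]

end SmallPowers

/-! ### The functor from stable contramodules to the cyclic homology category -/

namespace CyclicCat

/-- The vertex `a` of `[n]`. -/
def Lift.vertex (n : ℕ) (a : ℤ) : Lift 0 n where
  toFun i := a + (n + 1) * i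
  mono i j h := by
    dsimp only
    nlinarith
  period i := by push_cast; ring

theorem Lift.vertex_zero (n : ℕ) (a : ℤ) : (Lift.vertex n a).toFun 0 = a := by
  simp [Lift.vertex]

end CyclicCat

namespace AYDContramodule

open CyclicCat (Lift)

variable {k H : Type u} [Field k] [Ring H] [HopfAlgebra k H] {M N : AYDContramodule k H}

/-- The coinduced modules of a contramodule, as modules over the rings of the cocyclic algebra. -/
noncomputable def coinducedModule (M : AYDContramodule k H) (x : CyclicCat) :
    ModuleCat.{u} ((cocyclicAlgebra k H).obj x) :=
  @ModuleCat.of ((cocyclicAlgebra k H).obj x) _ (M.coinduced x.len) _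
    (inferInstanceAs (Module (TensorPow k H x.len) (M.coinduced x.len)))

/-- The evaluation maps of the object of the cyclic homology category of a stable contramodule. -/
noncomputable def evaluationData (hM : IsStable M) : EvaluationData (cocyclicAlgebra k H) where
  obj x := M.coinducedModule x
  e {x y} f := Quotient.lift (s := Lift.setoid x.len y.len) (fun g => M.liftEval g)
    (fun _ _ h => M.liftEval_congr h) f
  e_smul {x y} f r ψ := by
    obtain ⟨g, rfl, -⟩ := CyclicCat.exists_lift f
    exact M.liftEval_smul g r ψ
  e_id x ψ := liftEval_id hM ψ
  e_comp {x y z} f g ψ := by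
    obtain ⟨f, rfl, hf⟩ := CyclicCat.exists_lift f
    obtain ⟨g, rfl, hg⟩ := CyclicCat.exists_lift g
    exact liftEval_comp hM f g hf.1 hf.2 hg.1 hg.2 ψ
  eq_zero {x y} f ψ h := by
    obtain ⟨f, rfl, hf⟩ := CyclicCat.exists_lift f
    exact eq_zero_of_liftEval hM f hf.1 hf.2 ψ h
  exists_e {x y} f φ hφ := by
    obtain ⟨f, rfl, hf⟩ := CyclicCat.exists_lift f
    exact exists_of_liftEval hM f hf.1 hf.2 φ hφ

/-- Composition with a morphism of contramodules. -/
noncomputable def coinducedMap (f : M ⟶ N) (n : ℕ) :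
    M.coinduced n →ₗ[TensorPow k H n] N.coinduced n where
  toFun ψ := ⟨(Hom.toLin f).restrictScalars k ∘ₗ ψ.1, fun c x => by
    rw [LinearMap.comp_apply, ψ.2 c x]
    exact (Hom.toLin f).map_smul c _⟩
  map_add' ψ ψ' := Subtype.ext (LinearMap.comp_add _ _ _)
  map_smul' r ψ := rfl

/-- `coinducedMap` over the rings of the cocyclic algebra. -/
noncomputable def coinducedHom (f : M ⟶ N) (x : CyclicCat) :
    M.coinducedModule x ⟶ N.coinducedModule x :=
  ModuleCat.ofHom (X := M.coinducedModule x) (Y := N.coinducedModule x)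
    { toFun := fun ψ => coinducedMap f x.len ψ
      map_add' := (coinducedMap f x.len).map_add
      map_smul' := (coinducedMap f x.len).map_smul }

theorem liftEval_coinducedMap (f : M ⟶ N) {m n : ℕ} (g : Lift m n) (ψ : M.coinduced n) :
    N.liftEval g (coinducedMap f n ψ) = coinducedMap f m (M.liftEval g ψ) := by
  refine Subtype.ext ?_
  refine (congrArg (· ∘ₗ (cocyclicMap g).toLinearMap) (Hom.comp_transport f _ ψ.1)).symm.trans ?_
  rfl

variable (k H)

/-- The functor from stable anti-Yetter-Drinfeld contramodules to the cyclic homology category. -/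
noncomputable def toCyclic : StableAYDContramodule k H ⥤ CyclicHomologyCat k H where
  obj M := (evaluationData M.property).toCoindLim
  map {M N} f := CoindLim.homMk (fun x => coinducedHom f.hom x) (fun {x y} g ψ => by
    obtain ⟨g, rfl, -⟩ := CyclicCat.exists_lift g
    refine (EvaluationData.toCoindLim_ev (evaluationData N.property) _ _).trans ?_
    refine (liftEval_coinducedMap f.hom g ψ).trans (congrArg (coinducedMap f.hom x.len) ?_)
    exact (EvaluationData.toCoindLim_ev (evaluationData M.property)
      (CyclicCat.homMk (x := x) (y := y) g) ψ).symm)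
  map_id M := CoindLim.hom_ext fun x ψ => rfl
  map_comp f g := CoindLim.hom_ext fun x ψ => rfl

variable {k H}

theorem toCyclic_ev (M : StableAYDContramodule k H) {m n : ℕ} (f : Lift m n)
    (ψ : M.obj.coinduced n) :
    ((toCyclic k H).obj M).ev (CyclicCat.homMk (x := ⟨m⟩) (y := ⟨n⟩) f) ψ = M.obj.liftEval f ψ :=
  EvaluationData.toCoindLim_ev _ _ _

end AYDContramodule

theorem insertAt_zero_eq {k H : Type u} [Field k] [Ring H] [Bialgebra k H] (p : ℤ) :
    insertAt k H 0 p = insertAt k H 0 0 := by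
  unfold insertAt
  rw [show residue 0 p = residue 0 0 from Subsingleton.elim (α := Fin 1) _ _]

theorem insertAt_zero_bijective (k H : Type u) [Field k] [Ring H] [Bialgebra k H] :
    Function.Bijective (insertAt k H 0 0) := by
  have h : ∀ x, insertAt k H 0 0 x =
      (PiTensorProduct.subsingletonEquiv (R := k) (s := fun _ => H) (0 : Fin 1)).symm x := by
    intro x
    rw [LinearEquiv.eq_symm_apply, insertAt, PiTensorProduct.singleAlgHom_apply]
    refine (PiTensorProduct.subsingletonEquiv_apply_tprod (R := k) (s := fun _ => H)
      (0 : Fin 1) _).trans ?_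
    exact Pi.mulSingle_eq_same (M := fun _ : Fin 1 => H) 0 x
  rw [show ⇑(insertAt k H 0 0) = _ from funext h]
  exact LinearEquiv.bijective _

/-- `H ≅ H^{⊗ 1}`. -/
noncomputable def insertEquiv (k H : Type u) [Field k] [Ring H] [Bialgebra k H] :
    H ≃ₐ[k] TensorPow k H 0 :=
  AlgEquiv.ofBijective (insertAt k H 0 0) (insertAt_zero_bijective k H)

namespace AYDContramodule

open CyclicCat (Lift)

variable {k H : Type u} [Field k] [Ring H] [HopfAlgebra k H]

theorem spread_zero_one (a : ℤ) (c : H) : spread k H 0 a 1 c = insertAt k H 0 0 c := by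
  rw [spread_one, insertAt_zero_eq]
  rfl

/-- `M ≅ Hom_H(H^{⊗ 1}, M)`, `m ↦ (h ↦ h m)`. -/
noncomputable def coinducedZeroEquiv (M : AYDContramodule k H) : M.carrier ≃+ M.coinduced 0 where
  toFun m := ⟨(LinearMap.toSpanSingleton H M.carrier m).restrictScalars k ∘ₗ
    (insertEquiv k H).symm.toLinearMap, fun c x => by
      rw [spread_zero_one]
      change (insertEquiv k H).symm (insertEquiv k H c * x) • m = c • (insertEquiv k H).symm x • m
      rw [map_mul, AlgEquiv.symm_apply_apply, mul_smul]⟩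
  invFun ψ := ψ.1 1
  map_add' m m' := Subtype.ext (LinearMap.ext fun x => smul_add _ m m')
  left_inv m := by
    change (insertEquiv k H).symm 1 • m = m
    rw [map_one, one_smul]
  right_inv ψ := Subtype.ext (LinearMap.ext fun x => by
    obtain ⟨h, rfl⟩ := (insertEquiv k H).surjective x
    change (insertEquiv k H).symm (insertEquiv k H h) • ψ.1 1 = ψ.1 (insertEquiv k H h)
    rw [AlgEquiv.symm_apply_apply, ← ψ.2 h 1, spread_zero_one, mul_one]
    rfl)

theorem coinducedZeroEquiv_smul (M : AYDContramodule k H) (h : H) (m : M.carrier) :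
    coinducedZeroEquiv M (h • m) = insertAt k H 0 0 h • coinducedZeroEquiv M m := by
  refine Subtype.ext (LinearMap.ext fun x => ?_)
  change (insertEquiv k H).symm x • h • m = (insertEquiv k H).symm (x * insertEquiv k H h) • m
  rw [map_mul, AlgEquiv.symm_apply_apply, mul_smul]

theorem toCyclic_faithful : (toCyclic k H).Faithful where
  map_injective {M N f g} h := by
    have h1 : ∀ ψ : M.obj.coinduced 0, coinducedMap f.hom 0 ψ = coinducedMap g.hom 0 ψ :=
      fun ψ => congrArg (fun a => (CoindLim.Hom.app a ⟨0⟩).hom ψ) h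
    refine ObjectProperty.hom_ext _ (Hom.ext (LinearMap.ext fun m => ?_))
    have h2 := congrArg (fun χ => χ.1 1) (h1 (coinducedZeroEquiv M.obj m))
    have h3 := (coinducedZeroEquiv M.obj).symm_apply_apply m
    change Hom.toLin f.hom ((coinducedZeroEquiv M.obj).symm (coinducedZeroEquiv M.obj m)) =
      Hom.toLin g.hom ((coinducedZeroEquiv M.obj).symm (coinducedZeroEquiv M.obj m)) at h2
    rwa [h3] at h2

section Full

variable {M N : StableAYDContramodule k H} (Φ : (toCyclic k H).obj M ⟶ (toCyclic k H).obj N)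

/-- The component at `[n]` of a morphism between images of contramodules. -/
noncomputable def component (n : ℕ) (ψ : M.obj.coinduced n) : N.obj.coinduced n :=
  (CoindLim.Hom.app Φ ⟨n⟩).hom ψ

theorem component_smul {n : ℕ} (r : TensorPow k H n) (ψ : M.obj.coinduced n) :
    component Φ n (r • ψ) = r • component Φ n ψ :=
  (CoindLim.Hom.app Φ ⟨n⟩).hom.map_smul r ψ

theorem component_add {n : ℕ} (ψ ψ' : M.obj.coinduced n) :
    component Φ n (ψ + ψ') = component Φ n ψ + component Φ n ψ' :=
  (CoindLim.Hom.app Φ ⟨n⟩).hom.map_add ψ ψ'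

theorem component_liftEval {m n : ℕ} (f : Lift m n) (ψ : M.obj.coinduced n) :
    N.obj.liftEval f (component Φ n ψ) = component Φ m (M.obj.liftEval f ψ) := by
  rw [← toCyclic_ev, ← toCyclic_ev]
  exact CoindLim.Hom.ev_app Φ _ ψ

/-- The map of `H`-modules that underlies a morphism between images of contramodules. -/
noncomputable def underlyingMap : M.obj.carrier →ₗ[H] N.obj.carrier where
  toFun m := (coinducedZeroEquiv N.obj).symm (component Φ 0 (coinducedZeroEquiv M.obj m))
  map_add' m m' := by rw [map_add, component_add, map_add]
  map_smul' h m := by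
    rw [coinducedZeroEquiv_smul, component_smul, RingHom.id_apply, AddEquiv.symm_apply_eq,
      coinducedZeroEquiv_smul, AddEquiv.apply_symm_apply]

theorem component_zero_apply_one (ψ : M.obj.coinduced 0) :
    (component Φ 0 ψ).1 1 = underlyingMap Φ (ψ.1 1) := by
  have h : coinducedZeroEquiv M.obj (ψ.1 1) = ψ := (coinducedZeroEquiv M.obj).apply_symm_apply ψ
  change _ = (component Φ 0 (coinducedZeroEquiv M.obj (ψ.1 1))).1 1
  rw [h]

/-- A morphism between images of contramodules acts on functions by composition with the underlying
map, since evaluation at the vertex `0` is evaluation at `1 ∈ H^{⊗ (n + 1)}`. -/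
theorem component_apply {n : ℕ} (ψ : M.obj.coinduced n) (x : TensorPow k H n) :
    (component Φ n ψ).1 x = underlyingMap Φ (ψ.1 x) := by
  have key : ∀ {K : StableAYDContramodule k H} (χ : K.obj.coinduced n),
      (K.obj.liftEval (Lift.vertex n 0) χ).1 1 = χ.1 1 := by
    intro K χ
    rw [liftEval_val _ _ (Lift.vertex_zero n 0).ge (by rw [Lift.vertex_zero]; omega),
      Lift.vertex_zero, valueAt_zero K.property, LinearMap.comp_apply, AlgHom.toLinearMap_apply,
      map_one]
  have h1 : ∀ χ : M.obj.coinduced n, (component Φ n χ).1 1 = underlyingMap Φ (χ.1 1) := by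
    intro χ
    rw [← key χ, ← component_zero_apply_one, ← component_liftEval, key]
  have h2 := h1 (x • ψ)
  rwa [component_smul, coinduced_smul_apply, coinduced_smul_apply, one_mul] at h2

/-- The underlying map commutes with the contraactions, because these are the transport between the
two vertices of `[1]`. -/
theorem underlyingMap_α (φ : H →ₗ[k] M.obj.carrier) :
    underlyingMap Φ (M.obj.α φ) = N.obj.α ((underlyingMap Φ).restrictScalars k ∘ₗ φ) := by
  obtain ⟨ψ, hψ, hφ⟩ := exists_isSemilinear_two φ
  have key : ∀ {K : StableAYDContramodule k H} (χ : K.obj.coinduced 1),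
      (K.obj.liftEval (Lift.vertex 1 1) χ).1 1 =
        K.obj.α (χ.1 ∘ₗ (insertAt k H 1 0).toLinearMap) := by
    intro K χ
    rw [liftEval_val _ _ (by rw [Lift.vertex_zero]; omega) (by rw [Lift.vertex_zero]; omega),
      Lift.vertex_zero, LinearMap.comp_apply, AlgHom.toLinearMap_apply, map_one]
    refine congrArg K.obj.α (LinearMap.ext fun h => ?_)
    change χ.1 (spread k H 1 1 1 h * 1) = _
    rw [mul_one, spread_one]
    rfl
  have h1 : φ = ψ ∘ₗ (insertAt k H 1 0).toLinearMap := LinearMap.ext fun h => (hφ h).symm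
  have h2 := congrArg (fun χ => χ.1 1) (component_liftEval Φ (Lift.vertex 1 1) ⟨ψ, hψ⟩)
  rw [component_zero_apply_one, key, key] at h2
  rw [h1, ← h2]
  refine congrArg N.obj.α (LinearMap.ext fun h => ?_)
  exact component_apply Φ _ _

theorem toCyclic_full : (toCyclic k H).Full where
  map_surjective {M N} Φ := by
    refine ⟨ObjectProperty.homMk (Hom.mk (underlyingMap Φ) (underlyingMap_α Φ)), ?_⟩
    refine CoindLim.hom_ext fun x ψ => Subtype.ext (LinearMap.ext fun s => ?_)
    exact (component_apply Φ (n := x.len) ψ s).symm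

end Full

/-- The functor to the cyclic homology category preserves the underlying `H`-modules. -/
noncomputable def toCyclicUnderlyingIso :
    toCyclic k H ⋙ CyclicHomologyCat.underlying k H ≅ IsStable.ι ⋙ forgetToModule k H :=
  (NatIso.ofComponents (fun M => LinearEquiv.toModuleIso
    (X₁ := ModuleCat.of H M.obj.carrier)
    (X₂ := (CyclicHomologyCat.underlying k H).obj ((toCyclic k H).obj M))
    { toFun := coinducedZeroEquiv M.obj
      invFun := (coinducedZeroEquiv M.obj).symm
      map_add' := (coinducedZeroEquiv M.obj).map_add
      map_smul' := coinducedZeroEquiv_smul M.obj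
      left_inv := (coinducedZeroEquiv M.obj).left_inv
      right_inv := (coinducedZeroEquiv M.obj).right_inv })
    fun {M N} f => by
      ext m
      refine Subtype.ext (LinearMap.ext fun x => ?_)
      exact ((Hom.toLin f.hom).map_smul _ m).symm).symm

end AYDContramodule

/-! ### The contramodule of an object of the cyclic homology category -/

namespace CyclicCat

/-- The morphism `[1] ⟶ [n]` that sends the arc from `1` to `0` to the arc from `a` to `b`. -/
def Lift.arc (n : ℕ) (a b : ℤ) (h1 : a ≤ b) (h2 : b ≤ a + (n + 1)) : Lift 1 n where
  toFun i := if i % 2 = 0 then b + (n + 1) * (i / 2 - 1) else a + (n + 1) * (i / 2)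
  mono := by
    refine monotone_int_of_le_succ fun i => ?_
    have hn : (0 : ℤ) < n + 1 := by positivity
    rcases Int.emod_two_eq_zero_or_one i with h | h
    · rw [if_pos h, if_neg (by omega), show (i + 1) / 2 = i / 2 by omega]
      linarith
    · rw [if_neg (by omega), if_pos (by omega), show (i + 1) / 2 = i / 2 + 1 by omega]
      linarith
  period i := by
    push_cast
    rw [show (i + 2) % 2 = i % 2 by omega, show (i + 2) / 2 = i / 2 + 1 by omega]
    split_ifs <;> ring

end CyclicCat

namespace CyclicHomologyCat

open CyclicCat (Lift)
open Coalgebra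

section Fiber

variable {k H : Type u} [Field k] [Ring H] [Bialgebra k H] (N : CyclicHomologyCat k H)

/-- The component at `[n]`, with the structures of a module over `H^{⊗ (n + 1)}`, over `k`, and, for
`n = 0`, over `H`. -/
def fiber (n : ℕ) : Type u := N.obj ⟨n⟩

instance (n : ℕ) : AddCommGroup (N.fiber n) := inferInstanceAs (AddCommGroup (N.obj ⟨n⟩))

noncomputable instance (n : ℕ) : Module (TensorPow k H n) (N.fiber n) :=
  inferInstanceAs (Module ((cocyclicAlgebra k H).obj ⟨n⟩) (N.obj ⟨n⟩))

noncomputable instance (n : ℕ) : Module k (N.fiber n) :=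
  Module.compHom _ (algebraMap k (TensorPow k H n))

instance (n : ℕ) : IsScalarTower k (TensorPow k H n) (N.fiber n) :=
  ⟨fun c r m => by rw [Algebra.smul_def, mul_smul]; rfl⟩

noncomputable instance : Module H (N.fiber 0) :=
  Module.compHom _ (insertAt k H 0 0).toRingHom

theorem smul_fiber (h : H) (m : N.fiber 0) : h • m = insertAt k H 0 0 h • m := rfl

instance : IsScalarTower k H (N.fiber 0) :=
  ⟨fun c h m => by rw [smul_fiber, smul_fiber, map_smul, smul_assoc]⟩

/-- Evaluation along a lift of a morphism of `Λ`. -/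
noncomputable def evalLift {m n : ℕ} (f : Lift m n) : N.fiber n →+ N.fiber m :=
  CoindLim.ev N (CyclicCat.homMk (x := ⟨m⟩) (y := ⟨n⟩) f)

theorem evalLift_smul {m n : ℕ} (f : Lift m n) (r : TensorPow k H m) (z : N.fiber n) :
    N.evalLift f (cocyclicMap f r • z) = r • N.evalLift f z :=
  CoindLim.ev_map_smul N (CyclicCat.homMk (x := ⟨m⟩) (y := ⟨n⟩) f) r z

theorem evalLift_comp {l m n : ℕ} (f : Lift l m) (g : Lift m n) (z : N.fiber n) :
    N.evalLift (f.comp g) z = N.evalLift f (N.evalLift g z) :=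
  CoindLim.ev_comp N (CyclicCat.homMk (x := ⟨l⟩) (y := ⟨m⟩) f)
    (CyclicCat.homMk (x := ⟨m⟩) (y := ⟨n⟩) g) z

theorem evalLift_congr {m n : ℕ} {f g : Lift m n} (q : ℤ)
    (h : ∀ i, g.toFun i = f.toFun i + (n + 1) * q) : N.evalLift f = N.evalLift g := by
  unfold evalLift
  rw [CyclicCat.homMk_eq_homMk q h]

/-- Evaluation at the vertex `a` of `[n]`. -/
noncomputable def evalAt {n : ℕ} (a : ℤ) : N.fiber n →+ N.fiber 0 := N.evalLift (Lift.vertex n a)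

theorem evalAt_shift {n : ℕ} (a q : ℤ) (z : N.fiber n) :
    N.evalAt (a + (n + 1) * q) z = N.evalAt a z := by
  unfold evalAt
  rw [N.evalLift_congr (f := Lift.vertex n a) (g := Lift.vertex n (a + (n + 1) * q)) q fun i => by
    simp only [Lift.vertex]; ring]

theorem evalAt_zero_zero (z : N.fiber 0) : N.evalAt 0 z = z := by
  unfold evalAt
  rw [← N.evalLift_congr (f := Lift.id 0) (g := Lift.vertex 0 0) 0 fun i => by
    simp [Lift.vertex, Lift.id]]
  exact CoindLim.ev_id N ⟨0⟩ z

theorem evalAt_evalLift {m n : ℕ} (f : Lift m n) (a : ℤ) (z : N.fiber n) :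
    N.evalAt a (N.evalLift f z) = N.evalAt (f.toFun a) z := by
  unfold evalAt
  rw [← evalLift_comp]
  congr 2
  exact Lift.ext (funext fun i => f.period_mul a i)

theorem cocyclicMap_vertex (n : ℕ) (a : ℤ) (h : H) :
    cocyclicMap (Lift.vertex n a) (insertAt k H 0 0 h) = spread k H n a (n + 1) h := by
  have e : (Lift.vertex n a).width 1 = n + 1 := by
    have := (Lift.vertex n a).width_eq 1
    simp only [Lift.vertex] at this
    push_cast at this
    have h2 : ((Lift.vertex n a).width 1 : ℤ) = n + 1 := by
      refine this.trans ?_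
      ring
    exact_mod_cast h2
  rw [← insertAt_zero_eq 1, cocyclicMap_insertAt, e]
  congr 2
  simp [Lift.vertex]

theorem evalAt_spread_smul {n : ℕ} (a : ℤ) (h : H) (z : N.fiber n) :
    N.evalAt a (spread k H n a (n + 1) h • z) = h • N.evalAt a z := by
  rw [← cocyclicMap_vertex]
  exact N.evalLift_smul _ _ z

theorem evalAt_smul {n : ℕ} (a : ℤ) (c : k) (z : N.fiber n) :
    N.evalAt a (c • z) = c • N.evalAt a z := by
  have h := N.evalLift_smul (Lift.vertex n a) (algebraMap k _ c) z
  rw [AlgHom.commutes] at h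
  exact h

/-- The function `s ↦ ev_a (s z)` on `H^{⊗ (n + 1)}`. -/
noncomputable def functionAt {n : ℕ} (a : ℤ) (z : N.fiber n) :
    TensorPow k H n →ₗ[k] N.fiber 0 where
  toFun s := N.evalAt a (s • z)
  map_add' s t := by rw [add_smul, map_add]
  map_smul' c s := by rw [smul_assoc, evalAt_smul, RingHom.id_apply]

theorem functionAt_apply {n : ℕ} (a : ℤ) (z : N.fiber n) (s : TensorPow k H n) :
    N.functionAt a z s = N.evalAt a (s • z) := rfl

theorem functionAt_injective {n : ℕ} (a : ℤ) {z z' : N.fiber n}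
    (h : N.functionAt a z = N.functionAt a z') : z = z' :=
  CoindLim.ev_ext N (CyclicCat.homMk (x := ⟨0⟩) (y := ⟨n⟩) (Lift.vertex n a))
    fun s => congrArg (fun l => l s) h

end Fiber

variable {k H : Type u} [Field k] [Ring H] [HopfAlgebra k H] (N : CyclicHomologyCat k H)

theorem isSemilinear_functionAt {n : ℕ} (a : ℤ) (z : N.fiber n) :
    IsSemilinear (spread k H n a (n + 1)) (N.functionAt a z) := fun c x => by
  rw [functionAt_apply, functionAt_apply, mul_smul, evalAt_spread_smul]

/-- The component at `[n]` consists of all functions that are semilinear over the vertex `a`. -/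
theorem exists_functionAt {n : ℕ} (a : ℤ) {ψ : TensorPow k H n →ₗ[k] N.fiber 0}
    (h : IsSemilinear (spread k H n a (n + 1)) ψ) : ∃ z : N.fiber n, N.functionAt a z = ψ := by
  obtain ⟨z, hz⟩ := CoindLim.exists_ev N
    (CyclicCat.homMk (x := ⟨0⟩) (y := ⟨n⟩) (Lift.vertex n a)) (φ := ψ)
    ⟨map_add ψ, fun r (s : TensorPow k H n) => by
      obtain ⟨c, rfl⟩ := (insertAt_zero_bijective k H).2 r
      refine (congrArg (fun t => ψ (t * s)) (cocyclicMap_vertex n a c)).trans ?_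
      exact h c s⟩
  exact ⟨z, LinearMap.ext hz⟩

theorem exists_fiber_one (φ : H →ₗ[k] N.fiber 0) :
    ∃ z : N.fiber 1, ∀ h, N.evalAt 0 (insertAt k H 1 0 h • z) = φ h := by
  obtain ⟨ψ, hψ, hφ⟩ := exists_isSemilinear_two φ
  obtain ⟨z, rfl⟩ := N.exists_functionAt (n := 1) 0 hψ
  exact ⟨z, hφ⟩

theorem fiber_one_ext {z z' : N.fiber 1}
    (h : ∀ x, N.evalAt 0 (insertAt k H 1 0 x • z) = N.evalAt 0 (insertAt k H 1 0 x • z')) :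
    z = z' :=
  N.functionAt_injective 0 ((N.isSemilinear_functionAt 0 z).ext_two
    (N.isSemilinear_functionAt 0 z') h)

/-- The element of the component at `[1]` whose function at the vertex `0` is `φ` on the tensor
factor of the arc from `1` to `0`. -/
noncomputable def edgeElement (φ : H →ₗ[k] N.fiber 0) : N.fiber 1 := (N.exists_fiber_one φ).choose

theorem evalAt_edgeElement (φ : H →ₗ[k] N.fiber 0) (h : H) :
    N.evalAt 0 (insertAt k H 1 0 h • N.edgeElement φ) = φ h :=
  (N.exists_fiber_one φ).choose_spec h

theorem edgeElement_eq {φ : H →ₗ[k] N.fiber 0} {z : N.fiber 1}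
    (h : ∀ x, N.evalAt 0 (insertAt k H 1 0 x • z) = φ x) : N.edgeElement φ = z :=
  N.fiber_one_ext fun x => by rw [evalAt_edgeElement, h]

/-- The contraaction: it moves a function at the vertex `0` of `[1]` to the vertex `1`. -/
noncomputable def contraaction : (H →ₗ[k] N.fiber 0) →ₗ[k] N.fiber 0 where
  toFun φ := N.evalAt 1 (N.edgeElement φ)
  map_add' φ φ' := by
    rw [← map_add]
    congr 1
    exact N.edgeElement_eq fun x => by
      rw [smul_add, map_add, evalAt_edgeElement, evalAt_edgeElement]; rfl
  map_smul' c φ := by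
    rw [RingHom.id_apply, ← evalAt_smul]
    congr 1
    refine N.edgeElement_eq fun x => ?_
    rw [← algebraMap_smul (TensorPow k H 1) c (N.edgeElement φ), ← mul_smul,
      ← Algebra.commutes, mul_smul, algebraMap_smul, evalAt_smul, evalAt_edgeElement]
    rfl

theorem contraaction_eq {φ : H →ₗ[k] N.fiber 0} {z : N.fiber 1}
    (h : ∀ x, N.evalAt 0 (insertAt k H 1 0 x • z) = φ x) : N.contraaction φ = N.evalAt 1 z :=
  congrArg (N.evalAt 1) (N.edgeElement_eq h)

/-- Evaluation at the vertex `a` is the contraaction of the evaluation at `b`, for any arc from `a`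
to `b`. -/
theorem evalAt_eq_contraaction {n : ℕ} (a : ℤ) (l : ℕ) (hl : l ≤ n + 1) (z : N.fiber n) :
    N.evalAt a z = N.contraaction (N.functionAt (a + l) z ∘ₗ (spread k H n a l).ofConv) := by
  let g := Lift.arc n a (a + l) (by omega) (by omega)
  have g1 : g.toFun 1 = a := by simp [g, Lift.arc]
  have g2 : g.toFun 2 = a + l := by simp [g, Lift.arc]
  have g0 : g.toFun 0 = a + l + (n + 1) * (-1) := by simp [g, Lift.arc]
  have gw : g.width 2 = l := by
    have := g.width_eq 2
    norm_num at this
    omega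
  rw [N.contraaction_eq (z := N.evalLift g z), evalAt_evalLift, g1]
  intro x
  have e : insertAt k H 1 0 x = insertAt k H 1 2 x := rfl
  rw [e, ← evalLift_smul, evalAt_evalLift, cocyclicMap_insertAt, gw, g0, evalAt_shift]
  norm_num
  rw [g1]
  rfl

/-- The contramodule structure on the component at `[0]`. Contraassociativity comes from the arcs
`0 → 1 → 2` of `[2]`, contraunitality from the trivial arc of `[0]`, and the anti-Yetter-Drinfeld
condition from the semilinearity over the vertex `1` of `[1]`. -/
noncomputable def toContramodule : AYDContramodule k H where
  carrier := N.fiber 0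
  α := N.contraaction
  contra_assoc F := by
    obtain ⟨ψ, hψ, hF⟩ := exists_isSemilinear_three F
    obtain ⟨z, rfl⟩ := N.exists_functionAt (n := 2) 2 hψ
    have h1 : N.contraaction (N.contraaction ∘ₗ F) = N.evalAt 0 z := by
      rw [N.evalAt_eq_contraaction 0 1 (by omega)]
      congr 1
      ext x
      rw [LinearMap.comp_apply, LinearMap.comp_apply, functionAt_apply,
        N.evalAt_eq_contraaction _ 1 (by omega)]
      congr 1
      ext y
      rw [← hF x y]
      have hc : Commute (insertAt k H 2 1 x) (insertAt k H 2 2 y) :=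
        commute_insertAt 2 (residue_ne 2 (by omega) (by omega)) x y
      rw [hc.eq, functionAt_apply, mul_smul]
      rw [spread_one, spread_one]
      rfl
    have h2 : N.contraaction (TensorProduct.lift F ∘ₗ comul) = N.evalAt 0 z := by
      rw [N.evalAt_eq_contraaction 0 2 (by omega)]
      congr 1
      ext x
      have r := Repr.arbitrary k x
      rw [LinearMap.comp_apply, ← r.eq, map_sum, LinearMap.comp_apply]
      change _ = N.functionAt _ z (spread k H 2 0 2 x)
      rw [spread_eq_mul 2 0 (show 1 + 1 = 2 from rfl), r.convMul_apply, map_sum]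
      refine Finset.sum_congr rfl fun i _ => ?_
      rw [TensorProduct.lift.tmul, ← hF, spread_one, spread_one]
      rfl
    rw [h1, h2]
  contra_unit m := by
    conv_rhs => rw [← N.evalAt_zero_zero m, N.evalAt_eq_contraaction 0 0 (by omega)]
    congr 1
    ext x
    change counit (R := k) x • m = N.evalAt 0 (counit (R := k) x • m)
    rw [evalAt_zero_zero]
  ayd a φ := by
    obtain ⟨ψ, hψ, hφ⟩ := exists_isSemilinear_two φ
    obtain ⟨z, rfl⟩ := N.exists_functionAt (n := 1) 0 hψ
    -- `H` acts over the vertices `0` and `1` of `[1]` through the factors at `1, 0` and at `0, 1`.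
    have e1 : spread k H 1 0 2 =
        spread k H 1 0 1 * WithConv.toConv (insertAt k H 1 0).toLinearMap := by
      rw [spread_eq_mul 1 0 (show 1 + 1 = 2 from rfl), spread_one 1 (0 + (1 : ℕ))]
      rfl
    have e2 : spread k H 1 1 2 =
        WithConv.toConv (insertAt k H 1 0).toLinearMap * spread k H 1 0 1 := by
      rw [spread_eq_mul 1 1 (show 1 + 1 = 2 from rfl), spread_one 1 1, spread_one, spread_one]
      rfl
    rw [e1] at hψ
    have hc : ∀ x y, Commute (spread k H 1 0 1 x) (insertAt k H 1 0 y) := fun x y => by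
      rw [spread_one]
      exact commute_insertAt 1 (residue_ne 1 (p := 0) (q := 0 + 1) (by omega) (by omega)).symm x y
    rw [N.contraaction_eq (φ := φ) (z := z) hφ, ← evalAt_spread_smul]
    refine N.contraaction_eq fun x => ?_
    rw [hψ.aydTwist_eq hc φ 1 (fun x => by rw [mul_one, hφ]) a x, mul_one, functionAt_apply,
      mul_smul, ← e2]

/-- Stability comes from the arc of `[0]` that winds once around. -/
theorem isStable_toContramodule : AYDContramodule.IsStable N.toContramodule :=
    fun (m : N.fiber 0) => by
  change N.contraaction _ = m
  conv_rhs => rw [← N.evalAt_zero_zero m, N.evalAt_eq_contraaction 0 1 (by omega)]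
  congr 1
  ext x
  change x • m = N.evalAt (0 + ((0 : ℕ) + 1) * 1) (spread k H 0 0 1 x • m)
  rw [evalAt_shift, evalAt_zero_zero, AYDContramodule.spread_zero_one]
  rfl

/-- The stable contramodule of an object of the cyclic homology category. -/
noncomputable def toStable : StableAYDContramodule k H :=
  ⟨N.toContramodule, N.isStable_toContramodule⟩

/-! ### The equivalence with stable contramodules -/

/-- The component at `[n]` is coinduced along the vertex `0`. -/
noncomputable def toCoinduced (n : ℕ) :
    N.fiber n →ₗ[TensorPow k H n] N.toContramodule.coinduced n where
  toFun z := ⟨N.functionAt 0 z, N.isSemilinear_functionAt 0 z⟩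
  map_add' z z' := Subtype.ext (LinearMap.ext fun s => by
    change N.evalAt 0 (s • (z + z')) = N.evalAt 0 (s • z) + N.evalAt 0 (s • z')
    rw [smul_add, map_add])
  map_smul' r z := Subtype.ext (LinearMap.ext fun s => by
    change N.evalAt 0 (s • r • z) = N.evalAt 0 ((s * r) • z)
    rw [mul_smul])

theorem toCoinduced_bijective (n : ℕ) : Function.Bijective (N.toCoinduced n) :=
  ⟨fun _ _ h => N.functionAt_injective 0 (congrArg Subtype.val h), fun ψ => by
    obtain ⟨z, hz⟩ := N.exists_functionAt 0 ψ.2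
    exact ⟨z, Subtype.ext hz⟩⟩

theorem liftEval_toCoinduced {m n : ℕ} (f : Lift m n) (h0 : 0 ≤ f.toFun 0) (h1 : f.toFun 0 ≤ n)
    (z : N.fiber n) :
    N.toContramodule.liftEval f (N.toCoinduced n z) = N.toCoinduced m (N.evalLift f z) := by
  refine Subtype.ext (LinearMap.ext fun x => ?_)
  rw [AYDContramodule.liftEval_val _ _ h0 h1]
  change _ = N.evalAt 0 (x • N.evalLift f z)
  rw [← evalLift_smul, evalAt_evalLift,
    N.evalAt_eq_contraaction _ (n + 1 - f.toFun 0).toNat (by omega)]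
  refine congrArg N.contraaction (LinearMap.ext fun h => ?_)
  change N.evalAt 0 ((spread k H n (f.toFun 0) (n + 1 - f.toFun 0).toNat h * cocyclicMap f x) • z) =
    N.evalAt _ (spread k H n (f.toFun 0) (n + 1 - f.toFun 0).toNat h • cocyclicMap f x • z)
  rw [show f.toFun 0 + ((n + 1 - f.toFun 0).toNat : ℤ) = 0 + (n + 1) * 1 by omega, evalAt_shift,
    mul_smul]

/-- The map from an object of the cyclic homology category to the one of its contramodule. -/
noncomputable def toCyclicHom : N ⟶ (AYDContramodule.toCyclic k H).obj N.toStable :=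
  CoindLim.homMk (fun x => ModuleCat.ofHom (X := N.obj x) (Y := N.toContramodule.coinducedModule x)
    { toFun := N.toCoinduced x.len
      map_add' := (N.toCoinduced x.len).map_add
      map_smul' := (N.toCoinduced x.len).map_smul }) fun {x y} f z => by
    obtain ⟨g, rfl, hg⟩ := CyclicCat.exists_lift f
    exact (AYDContramodule.toCyclic_ev N.toStable g (N.toCoinduced y.len z)).trans
      (N.liftEval_toCoinduced g hg.1 hg.2 z)

theorem isIso_toCyclicHom : IsIso N.toCyclicHom :=
  CoindLim.isIso_of_bijective _ fun x => N.toCoinduced_bijective x.len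

end CyclicHomologyCat

namespace AYDContramodule

variable (k H : Type u) [Field k] [Ring H] [HopfAlgebra k H]

theorem toCyclic_isEquivalence : (toCyclic k H).IsEquivalence where
  faithful := toCyclic_faithful
  full := toCyclic_full
  essSurj := ⟨fun N => ⟨N.toStable, ⟨(@asIso _ _ _ _ _ N.isIso_toCyclicHom).symm⟩⟩⟩

end AYDContramodule

/-- For a Hopf algebra `H` with invertible antipode, `HC(_H M)` is equivalent, over the category of
`H`-modules, to the category of stable anti-Yetter-Drinfeld contramodules; `ς` is an automorphism of
the identity functor of `HH(_H M)`, and `HC(_H M) ⥤ HH(_H M)` is fully faithful, with essential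
image the objects on which `ς` is the identity. -/
theorem theorem5 (k H : Type u) [Field k] [Ring H] [HopfAlgebra k H]
    (hS : Function.Bijective (HopfAlgebra.antipode k : H →ₗ[k] H)) :
    (∃ E : CyclicHomologyCat k H ≌ StableAYDContramodule k H,
      Nonempty (E.functor ⋙ AYDContramodule.IsStable.ι ⋙ AYDContramodule.forgetToModule k H ≅
        CyclicHomologyCat.underlying k H)) ∧
    ∃ ς : 𝟭 (HochschildCat k H) ≅ 𝟭 (HochschildCat k H),
      (∀ M : HochschildCat k H,
        (CoindLim.proj (cosimplicialAlgebra k H) simplexZero).map (ς.hom.app M) =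
          M.sigma.hom) ∧
      (cyclicToHochschild k H).Full ∧ (cyclicToHochschild k H).Faithful ∧
      ∀ M : HochschildCat k H,
        (cyclicToHochschild k H).essImage M ↔ ς.hom.app M = 𝟙 M := by
  constructor
  · have := AYDContramodule.toCyclic_isEquivalence k H
    let e := (AYDContramodule.toCyclic k H).asEquivalence
    exact ⟨e.symm, ⟨Functor.isoWhiskerLeft e.inverse
      (AYDContramodule.toCyclicUnderlyingIso (k := k) (H := H)).symm ≪≫
        (Functor.associator _ _ _).symm ≪≫
        Functor.isoWhiskerRight e.counitIso (CyclicHomologyCat.underlying k H) ≪≫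
        Functor.leftUnitor _⟩⟩
  · refine ⟨CoindLim.monodromyIso (cocyclicAlgebra k H), fun M => ?_, CoindLim.restrict_full,
      CoindLim.restrict_faithful, fun M => CoindLim.mem_essImage_restrict_iff M⟩
    refine ModuleCat.hom_ext (LinearMap.ext fun m => ?_)
    exact (CoindLim.monodromyHom_app_zero (M := M) m).trans (HochschildCat.sigma_apply M m).symm
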